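/- **Setting.** Let $\Bbbk$ be a commutative ring with $1$, $n\ge 1$ an integer, and $Q$ a finite quiver with vertex set $I$. Let $\overline Q$ be its double, obtained by adding a reverse edge $a^*:j\to i$ for each edge $a:i\to j$ of $Q$; put $(a^*)^*=a$, and write $t(a)$, $h(a)$ for the tail and the head of an edge. Put $\varepsilon(a)=1$ and $\varepsilon(a^*)=-1$ for $a\in Q$. Let $\langle\alpha,\beta\rangle=\sum_{j\in I}\alpha_j\beta_j-\sum_{a\in Q}\alpha_{t(a)}\beta_{h(a)}$ on $\mathbb Z^I$, $(\alpha,\beta)=\langle\alpha,\beta\rangle+\langle\beta,\alpha\rangle$, and let $\epsilon_j$ be the coordinate vectors. Let $B=\bigoplus_{j\in I}\Bbbk e_j$, with the $e_j$ orthogonal idempotents, let $E$ be the $B$-bimodule that is free over $\Bbbk$ on the edges of $\overline Q$, with $e_{h(a)}ae_{t(a)}=a$, and let $\mathscr B=B^{\otimes n}$ and $\mathscr E=\bigoplus_{\ell=1}^n B^{\otimes(\ell-1)}\otimes E\otimes B^{\otimes(n-\ell)}$. For $\underline j=(j_1,\dots,j_n)\in I^n$ write $|_{\underline j}=e_{j_1}\otimes\cdots\otimes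 e_{j_n}$, let $a_\ell|_{\underline j}$ be the same tensor with $ae_{j_\ell}$ as its $\ell$-th factor, and, if $t(a)=j_\ell$, let $a_\ell(\underline j)$ be $\underline j$ with $j_\ell$ replaced by $h(a)$. The same notation is used for elements of the path algebra of $\overline Q$. Let $s_{\ell m}\in S_n$ be the transposition of $\ell$ and $m$. For $\lambda=\sum_j\lambda_je_j\in B$ and $\nu\in\Bbbk$, let $\mathscr A_{n,\lambda,\nu}$ be the quotient of $T_{\mathscr B}\mathscr E\rtimes\Bbbk[S_n]$ by the relations (i) $\bigl(\sum_{a\in Q}(aa^*-a^*a)-\lambda\bigr)_\ell\big|_{\underline j}=\nu\sum_{m\ne\ell,\ j_m=j_\ell}s_{\ell m}|_{\underline j}$ for all $\ell$ and $\underline j$; (ii) for all $\ell\ne m$, all edges $a,b$ of $\overline Q$, and all $\underline j$ with $j_\ell=t(a)$, $j_m=t(b)$: the element $a_\ell|_{b_m(\underline j)}\,b_m|_{\underline j}-b_m|_{a_\ell(\underline j)}\,a_\ell|_{\underline j}$ is $\nu s_{\ell m}|_{\underline j}$ if $b\in Q$ and $a=b^*$, is $-\nu s_{\ell m}|_{\underline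 j}$ if $a\in Q$ and $b=a^*$, and is $0$ otherwise. Let $\mathscr A_{n,\lambda,\nu}\text{-mod}$ be the category of left modules. **The reflection functor.** Let $i\in I$ be a vertex without edge-loop, and let $(r_i\lambda)_j=\lambda_j-(\epsilon_i,\epsilon_j)\lambda_i$; then $r_i(r_i\lambda)=\lambda$. Let $R$ be the set of edges of $\overline Q$ with head $i$. (If $i$ is a sink of $Q$, then $R=\{a\in Q\mid h(a)=i\}$ and all signs $\varepsilon$ below equal $1$.) Let $V$ be an $\mathscr A_{n,\lambda,\nu}$-module. For $\underline j\in I^n$ put $V_{\underline j}=|_{\underline j}V$ and $\Delta(\underline j)=\{m\mid j_m=i\}$. For $D\subseteq\Delta(\underline j)$ and $\xi:D\to R$ let $t(\underline j,\xi)$ be $\underline j$ with $j_m$ replaced by $t(\xi(m))$ for all $m\in D$, and let $$V(\underline j,D)=\bigoplus_{\xi:D\to R}V_{t(\underline j,\xi)}.$$ A permutation $\sigma\in S_n$ maps $V(\underline j,D)$ to $V(\sigma\underline j,\sigma D)$; it sends the summand of $\xi$ to that of $\xi\sigma^{-1}$ by the action of $\sigma$ on $V$. For $p\in D$ let $$\pi_p:V(\underline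 j,D)\to V(\underline j,D\setminus\{p\}),\qquad \mu_p:V(\underline j,D\setminus\{p\})\to V(\underline j,D)$$ be the maps with the following components. The map $\pi_p$ sends the summand of $\xi$ to that of $\xi|_{D\setminus\{p\}}$ by the action of $\xi(p)_p$, and $\mu_p$ sends the summand of $\eta$ to the summand of each $\xi$ that extends $\eta$, by the action of $\varepsilon(\xi(p))\,\xi(p)^*_p$. For $r\in R$ and $\ell\in D$ let $$\tau^!_{r,\ell}:V(\underline j,D)\to V(r^*_\ell(\underline j),D\setminus\{\ell\}),\qquad \tau_{r,\ell\,!}:V(r^*_\ell(\underline j),D\setminus\{\ell\})\to V(\underline j,D)$$ be the projection to, and the inclusion of, the sum of the summands with $\xi(\ell)=r$. Then $$F_i(V)=\bigoplus_{\underline j\in I^n}V'_{\underline j},\qquad V'_{\underline j}=\bigcap_{p\in\Delta(\underline j)}\operatorname{Ker}\pi_p\subseteq V(\underline j,\Delta(\underline j))$$ (with $V'_{\underline j}=V_{\underline j}$ if $\Delta(\underline j)=\emptyset$). It is an $\mathscr A_{n,r_i\lambda,\nu}$-module, on which $|_{\underline j}$ acts as the projection to $V'_{\underline j}$, $S_n$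 acts as above, and $a_\ell|_{\underline j}$ with $t(a)=j_\ell$ acts as the following map $V'_{\underline j}\to V'_{a_\ell(\underline j)}$: - if $h(a),t(a)\neq i$: on the summand of each $\xi$, the action of $a_\ell$; - if $t(a)=i$: $\varepsilon(a^*)\,\tau^!_{a^*,\ell}$; - if $h(a)=i$: $\bigl(-\lambda_i+\mu_\ell\pi_\ell+\nu\sum_{m\in\Delta(\underline j)}s_{m\ell}\bigr)\,\tau_{a,\ell\,!}$. A homomorphism $g:V\to W$ induces $F_i(g):F_i(V)\to F_i(W)$ componentwise. This defines a functor $F_i:\mathscr A_{n,\lambda,\nu}\text{-mod}\to\mathscr A_{n,r_i\lambda,\nu}\text{-mod}$ for all $\lambda\in B$ and $\nu\in\Bbbk$. **Theorem.** Let $i$ be a vertex without edge-loop, and let $\lambda\in B$ and $\nu\in\Bbbk$ be such that $\lambda_i+\nu\sum_{m=2}^rs_{1m}$ and $\lambda_i-\nu\sum_{m=2}^rs_{1m}$ are invertible in $\Bbbk[S_r]$ for all $r\in\{1,\dots,n\}$. Then the functor $$F_i:\mathscr A_{n,\lambda,\nu}\text{-mod}\longrightarrow\mathscr A_{n,r_i\lambda,\nu}\text{-mod}$$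 is an equivalence of categories, and the functor $F_i:\mathscr A_{n,r_i\lambda,\nu}\text{-mod}\to\mathscr A_{n,r_i(r_i\lambda),\nu}\text{-mod}=\mathscr A_{n,\lambda,\nu}\text{-mod}$ is quasi-inverse to it: both composites $F_iF_i$ are naturally isomorphic to the identity functors. -/

import Mathlib

open CategoryTheory

set_option linter.unusedSectionVars false

universe u w

namespace WreathReflection

section Quiver

variable (k : Type u) [CommRing k]
variable {I : Type} [Quiver.{0} I]

/-- The edges of the double quiver: `Sum.inl a` is the edge `a` of `Q`, and `Sum.inr a` is the
reverse edge `a*`. -/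
abbrev DEdge (I : Type) [Quiver.{0} I] : Type := Quiver.Total I ⊕ Quiver.Total I

/-- The tail `t(a)` of an edge of the double. -/
def tail : DEdge I → I := Sum.elim (fun a => a.left) (fun a => a.right)

/-- The head `h(a)` of an edge of the double. -/
def head : DEdge I → I := Sum.elim (fun a => a.right) (fun a => a.left)

/-- The involution `a ↦ a*` of the edges of the double. -/
def star : DEdge I → DEdge I := Sum.swap

/-- The sign of an edge of the double: `1` on the edges `a ∈ Q` and `-1` on the edges `a*`. -/
def sgn : DEdge I → k := Sum.elim (fun _ => 1) (fun _ => -1)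

variable [Fintype I] [Fintype (Quiver.Total I)]

/-- The Ringel form `⟨α, β⟩ = ∑ᵢ αᵢ βᵢ - ∑_{a ∈ Q} α_{t(a)} β_{h(a)}`. -/
def ringelForm (α β : I → ℤ) : ℤ :=
  ∑ j, α j * β j - ∑ a : Quiver.Total I, α a.left * β a.right

/-- The symmetrized Ringel form `(α, β) = ⟨α, β⟩ + ⟨β, α⟩`. -/
def symForm (α β : I → ℤ) : ℤ := ringelForm α β + ringelForm β α

variable {k} [DecidableEq I]

/-- The dual simple reflection `(rᵢ λ)_j = λ_j - (εᵢ, ε_j) λᵢ` on parameters. -/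
def reflect (i : I) (lam : I → k) : I → k :=
  fun j => lam j - symForm (Pi.single i 1) (Pi.single j 1) • lam i

end Quiver

section Algebra

variable {k : Type u} [CommRing k]
variable {I : Type} [Quiver.{0} I] [Fintype I] [DecidableEq I]

/-- Generators of the algebra: the idempotents `e_{j₁} ⊗ ⋯ ⊗ e_{jₙ}`, the elements
`a_ℓ = 1 ⊗ ⋯ ⊗ a ⊗ ⋯ ⊗ 1` (the edge `a` in the position `ℓ`), and the permutations. -/
inductive Gen (I : Type) [Quiver.{0} I] (n : ℕ) : Type
  | idem (j : Fin n → I)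
  | edge (a : DEdge I) (l : Fin n)
  | perm (s : Equiv.Perm (Fin n))

variable (k) in
/-- The generator `e_{j₁} ⊗ ⋯ ⊗ e_{jₙ}` of the free algebra. -/
abbrev gIdem {n : ℕ} (j : Fin n → I) : FreeAlgebra k (Gen I n) := FreeAlgebra.ι k (Gen.idem j)

variable (k) in
/-- The generator `a_ℓ` of the free algebra. -/
abbrev gEdge {n : ℕ} (a : DEdge I) (l : Fin n) : FreeAlgebra k (Gen I n) :=
  FreeAlgebra.ι k (Gen.edge a l)

variable (k I) in
/-- The generator `σ` of the free algebra. -/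
abbrev gPerm {n : ℕ} (s : Equiv.Perm (Fin n)) : FreeAlgebra k (Gen I n) :=
  FreeAlgebra.ι k (Gen.perm s)

variable [Fintype (Quiver.Total I)] [DecidableEq (Quiver.Total I)]

/-- The defining relations. The relations from `idem_mul_self` to `perm_edge` present
`T_𝓑 𝓔 ⋊ k[Sₙ]`: the `idem j` are the orthogonal idempotents that span `𝓑 = B^{⊗ n}`, the elements
`a_ℓ|_j = a_ℓ · idem j` with `t(a) = j_ℓ` are the basis of the bimodule `𝓔`, on which `𝓑` acts on the
left through `a_ℓ(j)` (`j` with `j_ℓ` replaced by `h(a)`), and `Sₙ` permutes the positions. The last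
two are the relations that depend on the parameters. -/
inductive Rel (n : ℕ) (lam : I → k) (nu : k) :
    FreeAlgebra k (Gen I n) → FreeAlgebra k (Gen I n) → Prop
  | idem_mul_self (j : Fin n → I) : Rel n lam nu (gIdem k j * gIdem k j) (gIdem k j)
  | idem_mul_ne (j j' : Fin n → I) (h : j ≠ j') : Rel n lam nu (gIdem k j * gIdem k j') 0
  | sum_idem : Rel n lam nu (∑ j : Fin n → I, gIdem k j) 1
  | edge_idem (a : DEdge I) (l : Fin n) (j : Fin n → I) (h : j l = tail a) :
      Rel n lam nu (gEdge k a l * gIdem k j)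
        (gIdem k (Function.update j l (head a)) * gEdge k a l)
  | edge_idem_ne (a : DEdge I) (l : Fin n) (j : Fin n → I) (h : j l ≠ tail a) :
      Rel n lam nu (gEdge k a l * gIdem k j) 0
  | perm_one : Rel n lam nu (gPerm k I 1) 1
  | perm_mul (s s' : Equiv.Perm (Fin n)) :
      Rel n lam nu (gPerm k I (s * s')) (gPerm k I s * gPerm k I s')
  | perm_idem (s : Equiv.Perm (Fin n)) (j : Fin n → I) :
      Rel n lam nu (gPerm k I s * gIdem k j) (gIdem k (j ∘ s.symm) * gPerm k I s)
  | perm_edge (s : Equiv.Perm (Fin n)) (a : DEdge I) (l : Fin n) :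
      Rel n lam nu (gPerm k I s * gEdge k a l) (gEdge k a (s l) * gPerm k I s)
  | rel_i (l : Fin n) (j : Fin n → I) :
      Rel n lam nu
        ((∑ a : Quiver.Total I,
            (gEdge k (Sum.inl a) l * gEdge k (Sum.inr a) l -
              gEdge k (Sum.inr a) l * gEdge k (Sum.inl a) l) -
          algebraMap k _ (lam (j l))) * gIdem k j)
        (nu • ∑ m with m ≠ l ∧ j m = j l, gPerm k I (Equiv.swap l m) * gIdem k j)
  | rel_ii (l m : Fin n) (hlm : l ≠ m) (a b : DEdge I) (j : Fin n → I)
      (ha : j l = tail a) (hb : j m = tail b) :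
      Rel n lam nu
        (gEdge k a l * gIdem k (Function.update j m (head b)) * (gEdge k b m * gIdem k j) -
          gEdge k b m * gIdem k (Function.update j l (head a)) * (gEdge k a l * gIdem k j))
        (if b = star a then -(sgn k a * nu) • (gPerm k I (Equiv.swap l m) * gIdem k j) else 0)

/-- The algebra `𝒜_{n,λ,ν}`. -/
def WAlg (n : ℕ) (lam : I → k) (nu : k) : Type u := RingQuot (Rel n lam nu)

variable (n : ℕ) (lam : I → k) (nu : k)

noncomputable instance : Ring (WAlg n lam nu) := inferInstanceAs (Ring (RingQuot _))

noncomputable instance : Algebra k (WAlg n lam nu) := inferInstanceAs (Algebra k (RingQuot _))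

/-- The quotient map from the free algebra. -/
noncomputable def mk : FreeAlgebra k (Gen I n) →ₐ[k] WAlg n lam nu :=
  RingQuot.mkAlgHom k (Rel n lam nu)

variable {n}

/-- The idempotent `e_{j₁} ⊗ ⋯ ⊗ e_{jₙ}` of `𝒜_{n,λ,ν}`. -/
noncomputable def idem (j : Fin n → I) : WAlg n lam nu := mk n lam nu (gIdem k j)

/-- The element `a_ℓ` of `𝒜_{n,λ,ν}`. -/
noncomputable def edge (a : DEdge I) (l : Fin n) : WAlg n lam nu := mk n lam nu (gEdge k a l)

/-- The element `σ` of `𝒜_{n,λ,ν}`. -/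
noncomputable def perm (s : Equiv.Perm (Fin n)) : WAlg n lam nu := mk n lam nu (gPerm k I s)


section Facts

variable (lam : I → k) (nu : k)

theorem head_star (a : DEdge I) : head (star a) = tail a := by cases a <;> rfl
theorem tail_star (a : DEdge I) : tail (star a) = head a := by cases a <;> rfl
theorem star_star (a : DEdge I) : star (star a) = a := by cases a <;> rfl
theorem sgn_star (a : DEdge I) : sgn k (star a) = -sgn k a := by cases a <;> simp [star, sgn]
theorem sgn_mul_self (a : DEdge I) : sgn k a * sgn k a = 1 := by cases a <;> simp [sgn]

theorem eq_star_comm {a b : DEdge I} : b = star a ↔ a = star b :=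
  ⟨fun h => by rw [h, star_star], fun h => by rw [h, star_star]⟩

theorem mk_rel {x y : FreeAlgebra k (Gen I n)} (h : Rel n lam nu x y) :
    mk n lam nu x = mk n lam nu y :=
  RingQuot.mkAlgHom_rel k h

theorem idem_mul_self (j : Fin n → I) : idem lam nu j * idem lam nu j = idem lam nu j := by
  simpa [idem] using mk_rel lam nu (Rel.idem_mul_self j)

theorem idem_mul_ne {j j' : Fin n → I} (h : j ≠ j') : idem lam nu j * idem lam nu j' = 0 := by
  simpa [idem] using mk_rel lam nu (Rel.idem_mul_ne j j' h)

theorem sum_idem : ∑ j : Fin n → I, idem lam nu j = 1 := by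
  simpa [idem] using mk_rel lam nu (Rel.sum_idem)

theorem edge_idem (a : DEdge I) (l : Fin n) (j : Fin n → I) (h : j l = tail a) :
    edge lam nu a l * idem lam nu j =
      idem lam nu (Function.update j l (head a)) * edge lam nu a l := by
  simpa [idem, edge] using
    mk_rel lam nu (Rel.edge_idem a l j h)

theorem edge_idem_ne (a : DEdge I) (l : Fin n) (j : Fin n → I) (h : j l ≠ tail a) :
    edge lam nu a l * idem lam nu j = 0 := by
  simpa [idem, edge] using
    mk_rel lam nu (Rel.edge_idem_ne a l j h)

theorem perm_one : perm lam nu (1 : Equiv.Perm (Fin n)) = 1 := by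
  simpa [perm] using mk_rel lam nu (Rel.perm_one)

theorem perm_mul (s s' : Equiv.Perm (Fin n)) :
    perm lam nu (s * s') = perm lam nu s * perm lam nu s' := by
  simpa [perm] using mk_rel lam nu (Rel.perm_mul s s')

theorem perm_idem (s : Equiv.Perm (Fin n)) (j : Fin n → I) :
    perm lam nu s * idem lam nu j = idem lam nu (j ∘ s.symm) * perm lam nu s := by
  simpa [perm, idem] using mk_rel lam nu (Rel.perm_idem s j)

theorem perm_edge (s : Equiv.Perm (Fin n)) (a : DEdge I) (l : Fin n) :
    perm lam nu s * edge lam nu a l = edge lam nu a (s l) * perm lam nu s := by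
  simpa [perm, edge] using mk_rel lam nu (Rel.perm_edge s a l)

theorem sum_sgn (f : DEdge I → DEdge I → WAlg n lam nu) :
    ∑ a : DEdge I, sgn k a • f a (star a) =
      ∑ a : Quiver.Total I, (f (Sum.inl a) (Sum.inr a) - f (Sum.inr a) (Sum.inl a)) := by
  rw [Fintype.sum_sum_type, Finset.sum_sub_distrib, sub_eq_add_neg, ← Finset.sum_neg_distrib]
  simp [sgn, star]

theorem rel_i (l : Fin n) (j : Fin n → I) :
    (∑ a : DEdge I, sgn k a • (edge lam nu a l * edge lam nu (star a) l)) * idem lam nu j =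
      lam (j l) • idem lam nu j +
        nu • ∑ m with m ≠ l ∧ j m = j l, perm lam nu (Equiv.swap l m) * idem lam nu j := by
  have := mk_rel lam nu (Rel.rel_i l j)
  rw [sum_sgn lam nu fun a b => edge lam nu a l * edge lam nu b l]
  simp only [map_mul, map_sub, map_sum, map_smul, sub_mul,
    ← Algebra.smul_def, sub_eq_iff_eq_add] at this
  simp only [add_comm (lam (j l) • _)]
  exact this

theorem rel_ii (l m : Fin n) (hlm : l ≠ m) (a b : DEdge I) (j : Fin n → I)
    (ha : j l = tail a) (hb : j m = tail b) :
    edge lam nu a l * edge lam nu b m * idem lam nu j -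
      edge lam nu b m * edge lam nu a l * idem lam nu j =
      if b = star a then -(sgn k a * nu) • (perm lam nu (Equiv.swap l m) * idem lam nu j)
      else 0 := by
  have := mk_rel lam nu (Rel.rel_ii l m hlm a b j ha hb)
  simp only [map_mul, map_sub, apply_ite (mk n lam nu), map_smul,
    map_zero] at this
  change edge lam nu a l * idem lam nu _ * (edge lam nu b m * idem lam nu j) -
    edge lam nu b m * idem lam nu _ * (edge lam nu a l * idem lam nu j) = if _ then
      -(sgn k a * nu) • (perm lam nu (Equiv.swap l m) * idem lam nu j) else 0 at this
  rw [← this, mul_assoc _ (idem lam nu _) (_ * _), mul_assoc _ (idem lam nu _) (_ * _),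
    edge_idem lam nu b m j hb, edge_idem lam nu a l j ha, ← mul_assoc (idem lam nu _) (idem lam nu _),
    ← mul_assoc (idem lam nu _) (idem lam nu _), idem_mul_self, idem_mul_self,
    ← edge_idem lam nu b m j hb, ← edge_idem lam nu a l j ha, mul_assoc, mul_assoc]

theorem ext_idem {x y : WAlg n lam nu} (h : ∀ j, x * idem lam nu j = y * idem lam nu j) : x = y := by
  rw [← mul_one x, ← mul_one y, ← sum_idem lam nu, Finset.mul_sum, Finset.mul_sum]
  exact Finset.sum_congr rfl fun j _ => h j

theorem edge_edge_idem_zero (l m : Fin n) (hlm : l ≠ m) (a b : DEdge I) (j : Fin n → I)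
    (h : ¬(j l = tail a ∧ j m = tail b)) :
    edge lam nu a l * edge lam nu b m * idem lam nu j = 0 := by
  by_cases hb : j m = tail b
  · rw [mul_assoc, edge_idem _ _ _ _ _ hb, ← mul_assoc, edge_idem_ne, zero_mul]
    rw [Function.update_of_ne hlm]
    tauto
  · rw [mul_assoc, edge_idem_ne _ _ _ _ _ hb, mul_zero]

theorem edge_comm (l m : Fin n) (hlm : l ≠ m) (a b : DEdge I) (hab : b ≠ star a) :
    edge lam nu a l * edge lam nu b m = edge lam nu b m * edge lam nu a l := by
  refine ext_idem lam nu fun j => ?_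
  by_cases h : j l = tail a ∧ j m = tail b
  · have := rel_ii lam nu l m hlm a b j h.1 h.2
    rwa [if_neg hab, sub_eq_zero] at this
  · rw [edge_edge_idem_zero _ _ _ _ hlm _ _ _ h,
      edge_edge_idem_zero _ _ _ _ hlm.symm _ _ _ (by tauto)]

end Facts

section Operators

/-- `R`: the edges of the double with head `i` (if `i` is a sink, these are the edges `a ∈ Q` with
`h(a) = i`). -/
abbrev InEdge (i : I) : Type := {r : DEdge I // head r = i}

/-- A letter is a vertex or an element of `R`. -/
abbrev Letter (i : I) : Type := I ⊕ InEdge i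

/-- A word `x` encodes a triple `(j, D, ξ)` with `j ∈ Iⁿ`, `D ⊆ Δ(j)` and `ξ : D → R`: for `m ∈ D`
the letter `x m` is `ξ(m)`, for `m ∉ D` it is `j_m`. -/
abbrev Word (n : ℕ) (i : I) : Type := Fin n → Letter i

/-- The vertex `j_m` of `j` that a letter of the word `(j, D, ξ)` stands for. -/
def base {i : I} : Letter i → I := Sum.elim id fun _ => i

/-- The vertex `t(j, ξ)_m` that a letter of the word `(j, D, ξ)` stands for. -/
def src {i : I} : Letter i → I := Sum.elim id fun r => tail r.1

variable {lam : I → k} {nu : k} {i : I}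
variable {V : Type w} [AddCommGroup V] [Module k V] [Module (WAlg n lam nu) V]
variable [IsScalarTower k (WAlg n lam nu) V]

/-- The operator `f ↦ c · f` composed with the replacement of the letter `u` at the position `l`
by the letter `v`. -/
noncomputable def letterOp (c : WAlg n lam nu) (l : Fin n) (u v : Letter i) :
    (Word n i → V) →ₗ[k] (Word n i → V) where
  toFun f x := if x l = u then c • f (Function.update x l v) else 0
  map_add' f g := by ext x; by_cases h : x l = u <;> simp [h]
  map_smul' t f := by ext x; by_cases h : x l = u <;> simp [h, smul_comm t c]

/-- The action of the idempotent of `j` on `⨁ V(j, D)`. -/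
def idemOp (i : I) (j : Fin n → I) : (Word n i → V) →ₗ[k] (Word n i → V) where
  toFun f x := if base ∘ x = j then f x else 0
  map_add' f g := by ext x; by_cases h : base ∘ x = j <;> simp [h]
  map_smul' t f := by ext x; by_cases h : base ∘ x = j <;> simp [h]

variable (lam nu i V) in
/-- The action of a permutation `σ` on `⨁ V(j, D)`. -/
noncomputable def permOp (s : Equiv.Perm (Fin n)) : (Word n i → V) →ₗ[k] (Word n i → V) where
  toFun f x := perm lam nu s • f (x ∘ s)
  map_add' f g := by ext x; simp
  map_smul' t f := by ext x; simp [smul_comm t (perm lam nu s)]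

variable (lam nu i V) in
/-- The map `∑_{m ∈ D ∖ {ℓ}} s_{mℓ}` on the `V(j, D)` with `ℓ ∈ D`. -/
noncomputable def swapOp (l : Fin n) : (Word n i → V) →ₗ[k] (Word n i → V) where
  toFun f x := ∑ m with m ≠ l ∧ (x m).isRight ∧ (x l).isRight,
    permOp lam nu i V (Equiv.swap m l) f x
  map_add' f g := by ext x; simp [Finset.sum_add_distrib]
  map_smul' t f := by ext x; simp [Finset.smul_sum]

variable (lam nu i V) in
/-- The maps `π_p : V(j, D) → V(j, D ∖ {p})`. -/
noncomputable def piOp (p : Fin n) : (Word n i → V) →ₗ[k] (Word n i → V) :=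
  ∑ r : InEdge i, letterOp (edge lam nu r.1 p) p (Sum.inl i) (Sum.inr r)

variable (lam nu i V) in
/-- The maps `μ_p : V(j, D ∖ {p}) → V(j, D)`. If `i` is a sink then all the signs are `1`. -/
noncomputable def muOp (p : Fin n) : (Word n i → V) →ₗ[k] (Word n i → V) :=
  ∑ r : InEdge i, sgn k r.1 • letterOp (edge lam nu (star r.1) p) p (Sum.inr r) (Sum.inl i)

variable (lam nu V) in
/-- The maps `τ^!_{r,ℓ} : V(j, D) → V(r*_ℓ(j), D ∖ {ℓ})`. -/
noncomputable def tauUp (r : InEdge i) (l : Fin n) : (Word n i → V) →ₗ[k] (Word n i → V) :=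
  letterOp (1 : WAlg n lam nu) l (Sum.inl (tail r.1)) (Sum.inr r)

variable (lam nu V) in
/-- The maps `τ_{r,ℓ !} : V(r*_ℓ(j), D ∖ {ℓ}) → V(j, D)`. -/
noncomputable def tauDown (r : InEdge i) (l : Fin n) : (Word n i → V) →ₗ[k] (Word n i → V) :=
  letterOp (1 : WAlg n lam nu) l (Sum.inr r) (Sum.inl (tail r.1))

variable (lam nu V) in
/-- The maps `θ_{r,ℓ} : V(j, D) → V(r_ℓ(j), D ∪ {ℓ})`. -/
noncomputable def theta (r : InEdge i) (l : Fin n) : (Word n i → V) →ₗ[k] (Word n i → V) :=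
  (-lam i • LinearMap.id + muOp lam nu i V l ∘ₗ piOp lam nu i V l + nu • swapOp lam nu i V l) ∘ₗ
    tauDown lam nu V r l

variable (lam nu i V) in
/-- The action `a'_ℓ` of an edge `a` of the double in the position `ℓ`, in the three cases `h(a) = i`,
`t(a) = i`, and `h(a), t(a) ≠ i`. If `i` is a sink then the sign in the second case is `1`. -/
noncomputable def edgeOp (a : DEdge I) (l : Fin n) : (Word n i → V) →ₗ[k] (Word n i → V) :=
  if h : head a = i then theta lam nu V ⟨a, h⟩ l
  else if h : tail a = i then
    sgn k (star a) • tauUp lam nu V (⟨star a, (head_star a).trans h⟩ : InEdge i) l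
  else letterOp (edge lam nu a l) l (Sum.inl (head a)) (Sum.inl (tail a))

variable (lam nu i V) in
/-- The `k`-module `V' = ⨁ V'_j`, with `V'_j = ⋂_{p ∈ Δ(j)} Ker π_p ⊆ V(j, Δ(j))`. The first condition
says that `f` is in `⨁ V(j, D)`, the second one that only the `V(j, Δ(j))` contribute. -/
noncomputable def reflCarrier : Submodule k (Word n i → V) where
  carrier := {f | (∀ x, idem lam nu (src ∘ x) • f x = f x) ∧
    (∀ x m, x m = Sum.inl i → f x = 0) ∧ ∀ p, piOp lam nu i V p f = 0}
  zero_mem' := by simp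
  add_mem' := by
    rintro f g ⟨hf, hf', hf''⟩ ⟨hg, hg', hg''⟩
    refine ⟨fun x => ?_, fun x m h => ?_, fun p => ?_⟩
    · simp [hf, hg]
    · simp [hf' x m h, hg' x m h]
    · simp [hf'', hg'']
  smul_mem' := by
    rintro t f ⟨hf, hf', hf''⟩
    refine ⟨fun x => ?_, fun x m h => ?_, fun p => ?_⟩
    · simp [smul_comm _ t, hf]
    · simp [hf' x m h]
    · simp [hf'']

end Operators

section OperatorFacts

variable {lam : I → k} {nu : k} {i : I}
variable {V : Type w} [AddCommGroup V] [Module k V] [Module (WAlg n lam nu) V]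
variable [IsScalarTower k (WAlg n lam nu) V]

theorem letterOp_apply (c : WAlg n lam nu) (l : Fin n) (u v : Letter i) (f : Word n i → V)
    (x : Word n i) :
    letterOp c l u v f x = if x l = u then c • f (Function.update x l v) else 0 := rfl

theorem idemOp_apply (j : Fin n → I) (f : Word n i → V) (x : Word n i) :
    idemOp (k := k) i j f x = if base ∘ x = j then f x else 0 := rfl

theorem permOp_apply (s : Equiv.Perm (Fin n)) (f : Word n i → V) (x : Word n i) :
    permOp lam nu i V s f x = perm lam nu s • f (x ∘ s) := rfl

theorem swapOp_apply (l : Fin n) (f : Word n i → V) (x : Word n i) :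
    swapOp lam nu i V l f x = ∑ m with m ≠ l ∧ (x m).isRight ∧ (x l).isRight,
      perm lam nu (Equiv.swap m l) • f (x ∘ Equiv.swap m l) := rfl

theorem piOp_apply (p : Fin n) (f : Word n i → V) (x : Word n i) :
    piOp lam nu i V p f x = if x p = Sum.inl i then
      ∑ r : InEdge i, edge lam nu r.1 p • f (Function.update x p (Sum.inr r)) else 0 := by
  simp only [piOp, LinearMap.sum_apply, Finset.sum_apply, letterOp_apply]
  split_ifs <;> simp

theorem muOp_apply_inr (p : Fin n) (f : Word n i → V) (x : Word n i) (s : InEdge i)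
    (h : x p = Sum.inr s) :
    muOp lam nu i V p f x =
      sgn k s.1 • edge lam nu (star s.1) p • f (Function.update x p (Sum.inl i)) := by
  simp only [muOp, LinearMap.sum_apply, Finset.sum_apply, letterOp_apply, LinearMap.smul_apply,
    Pi.smul_apply, h, Sum.inr.injEq]
  rw [Finset.sum_eq_single s] <;> simp +contextual [eq_comm]

theorem muOp_apply_inl (p : Fin n) (f : Word n i → V) (x : Word n i) (v : I)
    (h : x p = Sum.inl v) : muOp lam nu i V p f x = 0 := by
  simp [muOp, letterOp_apply, h]

theorem theta_apply_inl (r : InEdge i) (l : Fin n) (f : Word n i → V) (x : Word n i) (v : I)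
    (h : x l = Sum.inl v) : theta lam nu V r l f x = 0 := by
  simp [theta, muOp_apply_inl _ _ _ _ h, swapOp_apply, h, tauDown, letterOp_apply]

theorem comp_swap_update {α : Type*} (x : Fin n → α) (m l : Fin n) (c : α) (h : m ≠ l) :
    Function.update (x ∘ Equiv.swap m l) l c =
      Function.update (Function.update x m (x l)) l c := by
  ext q
  by_cases hq : q = l
  · simp [hq]
  · by_cases hm : q = m
    · subst hm; simp [hq]
    · simp [hq, hm, Equiv.swap_apply_of_ne_of_ne]

theorem theta_apply_inr (r : InEdge i) (l : Fin n) (f : Word n i → V) (x : Word n i)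
    (s : InEdge i) (h : x l = Sum.inr s) : theta lam nu V r l f x =
      (if s = r then -(lam i • f (Function.update x l (Sum.inl (tail r.1)))) else 0) +
      sgn k s.1 • edge lam nu (star s.1) l • edge lam nu r.1 l •
        f (Function.update x l (Sum.inl (tail r.1))) +
      nu • ∑ m with m ≠ l ∧ x m = Sum.inr r, perm lam nu (Equiv.swap m l) •
        f (Function.update (Function.update x m (Sum.inr s)) l (Sum.inl (tail r.1))) := by
  simp only [theta, LinearMap.comp_apply, LinearMap.add_apply, LinearMap.smul_apply, Pi.add_apply,
    Pi.smul_apply, LinearMap.id_apply]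
  congr 1
  · congr 1
    · simp only [tauDown, letterOp_apply, h, Sum.inr.injEq]
      split_ifs <;> simp
    · rw [muOp_apply_inr _ _ _ _ h, piOp_apply, if_pos (by simp), Finset.sum_eq_single r]
      · simp [tauDown, letterOp_apply]
      · intro b _ hb
        simp [tauDown, letterOp_apply, hb]
      · simp
  · congr 1
    rw [swapOp_apply, Finset.sum_filter, Finset.sum_filter]
    refine Finset.sum_congr rfl fun m _ => ?_
    by_cases hm : m = l
    · simp [hm]
    · by_cases hr : x m = Sum.inr r
      · rw [if_pos (by simp [hm, hr, h]), if_pos ⟨hm, hr⟩]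
        simp [tauDown, letterOp_apply, hr, comp_swap_update x m l _ hm, h]
      · rw [if_neg (c := m ≠ l ∧ x m = _) (by tauto)]
        simp [tauDown, letterOp_apply, hr]

theorem letterOp_comm (c d : WAlg n lam nu) (hcd : c * d = d * c) (l m : Fin n) (hlm : l ≠ m)
    (u v u' v' : Letter i) (f : Word n i → V) :
    letterOp c l u v (letterOp d m u' v' f) = letterOp d m u' v' (letterOp c l u v f) := by
  ext x
  simp only [letterOp_apply, Function.update_of_ne hlm, Function.update_of_ne hlm.symm]
  split_ifs <;> simp [smul_smul, hcd, Function.update_comm hlm]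

/-- The condition of lying in `⨁ V(j, D)`. -/
def IsGraded (lam : I → k) (nu : k) {i : I} {V : Type w} [AddCommGroup V] [Module (WAlg n lam nu) V]
    (f : Word n i → V) : Prop := ∀ x, idem lam nu (src ∘ x) • f x = f x

theorem comp_update' {i : I} (g : Letter i → I) (x : Word n i) (l : Fin n) (u : Letter i) :
    g ∘ Function.update x l u = Function.update (g ∘ x) l (g u) := Function.comp_update _ _ _ _

theorem IsGraded.letterOp {f : Word n i → V} (hf : IsGraded lam nu f) (c : WAlg n lam nu)
    (l : Fin n) (u v : Letter i)
    (hc : ∀ j : Fin n → I, j l = src v →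
      c * idem lam nu j = idem lam nu (Function.update j l (src u)) * c) :
    IsGraded lam nu (letterOp c l u v f) := by
  intro x
  rw [letterOp_apply]
  split_ifs with h
  · conv_rhs => rw [← hf (Function.update x l v)]
    rw [smul_smul c, hc _ (by simp), comp_update', Function.update_idem, ← h]
    conv_rhs => rw [← smul_smul]
    rw [show Function.update (src ∘ x) l (src (x l)) = src ∘ x by simp]
  · simp

theorem IsGraded.permOp {f : Word n i → V} (hf : IsGraded lam nu f) (s : Equiv.Perm (Fin n)) :
    IsGraded lam nu (permOp lam nu i V s f) := by
  intro x
  rw [permOp_apply]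
  conv_rhs => rw [← hf, smul_smul, perm_idem, ← smul_smul]
  congr 3
  ext m; simp

theorem isGraded_iff {f : Word n i → V} : IsGraded lam nu f ↔ ∀ x, idem lam nu (src ∘ x) • f x = f x :=
  Iff.rfl

theorem IsGraded.sum {α : Type*} (t : Finset α) (F : α → Word n i → V)
    (hf : ∀ a ∈ t, IsGraded lam nu (F a)) : IsGraded lam nu (∑ a ∈ t, F a) := by
  intro x
  rw [Finset.sum_apply, Finset.smul_sum]
  exact Finset.sum_congr rfl fun a ha => hf a ha x

theorem IsGraded.smul {f : Word n i → V} (hf : IsGraded lam nu f) (t : k) :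
    IsGraded lam nu (t • f) := by
  intro x
  rw [Pi.smul_apply, smul_comm, hf]

theorem IsGraded.add {f g : Word n i → V} (hf : IsGraded lam nu f) (hg : IsGraded lam nu g) :
    IsGraded lam nu (f + g) := by
  intro x
  rw [Pi.add_apply, smul_add, hf, hg]

theorem IsGraded.theta {f : Word n i → V} (hf : IsGraded lam nu f) (r : InEdge i) (l : Fin n) :
    IsGraded lam nu (theta lam nu V r l f) := by
  have h1 : IsGraded lam nu (tauDown lam nu V r l f) := by
    refine hf.letterOp _ _ _ _ fun j hj => ?_
    rw [one_mul, mul_one, show src (Sum.inr r) = j l from hj.symm, Function.update_eq_self]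
  refine ((h1.smul _).add (?_)).add (IsGraded.smul ?_ _)
  · simp only [muOp, piOp, LinearMap.comp_apply, LinearMap.sum_apply]
    refine IsGraded.sum _ _ fun s _ => ?_
    refine (IsGraded.letterOp ?_ _ _ _ _ fun j hj => ?_).smul _
    · refine IsGraded.sum _ _ fun s _ => h1.letterOp _ _ _ _ fun j hj => ?_
      rw [edge_idem _ _ _ _ _ hj, s.2]; rfl
    · rw [edge_idem _ _ _ _ _ (by rw [tail_star, s.2]; exact hj), head_star]; rfl
  · intro x
    rw [swapOp_apply, Finset.smul_sum]
    exact Finset.sum_congr rfl fun m _ => h1.permOp (Equiv.swap m l) x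

theorem IsGraded.edgeOp {f : Word n i → V} (hf : IsGraded lam nu f) (a : DEdge I) (l : Fin n) :
    IsGraded lam nu (edgeOp lam nu i V a l f) := by
  unfold WreathReflection.edgeOp
  split_ifs with h h'
  · exact hf.theta _ _
  · refine IsGraded.smul (hf.letterOp _ _ _ _ fun j hj => ?_) _
    have e := Function.update_eq_self l j
    rw [hj] at e
    rw [one_mul, mul_one]
    exact congrArg _ e.symm
  · exact hf.letterOp _ _ _ _ fun j hj => edge_idem _ _ _ _ _ hj

theorem update_comp_perm {α : Type*} (x : Fin n → α) (s : Equiv.Perm (Fin n)) (l : Fin n) (v : α) :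
    Function.update x (s l) v ∘ s = Function.update (x ∘ s) l v := by
  ext q
  by_cases hq : q = l
  · simp [hq]
  · simp [hq]

theorem permOp_letterOp (s : Equiv.Perm (Fin n)) (c c' : WAlg n lam nu)
    (hc : perm lam nu s * c = c' * perm lam nu s) (l : Fin n) (u v : Letter i) (f : Word n i → V) :
    permOp lam nu i V s (letterOp c l u v f) = letterOp c' (s l) u v (permOp lam nu i V s f) := by
  ext x
  simp only [permOp_apply, letterOp_apply, Function.comp_apply, update_comp_perm]
  split_ifs
  · rw [smul_smul, smul_smul, hc]
  · simp

theorem permOp_mul (s t : Equiv.Perm (Fin n)) (f : Word n i → V) :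
    permOp lam nu i V (s * t) f = permOp lam nu i V s (permOp lam nu i V t f) := by
  ext x
  simp only [permOp_apply, perm_mul, smul_smul]
  rfl

theorem permOp_piOp (s : Equiv.Perm (Fin n)) (p : Fin n) (f : Word n i → V) :
    permOp lam nu i V s (piOp lam nu i V p f) = piOp lam nu i V (s p) (permOp lam nu i V s f) := by
  simp only [piOp, LinearMap.sum_apply, map_sum]
  exact Finset.sum_congr rfl fun r _ => permOp_letterOp _ _ _ (perm_edge _ _ _ _ _) _ _ _ _

theorem permOp_muOp (s : Equiv.Perm (Fin n)) (p : Fin n) (f : Word n i → V) :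
    permOp lam nu i V s (muOp lam nu i V p f) = muOp lam nu i V (s p) (permOp lam nu i V s f) := by
  simp only [muOp, LinearMap.sum_apply, map_sum, LinearMap.smul_apply, map_smul]
  exact Finset.sum_congr rfl fun r _ => congrArg _ <|
    permOp_letterOp _ _ _ (perm_edge _ _ _ _ _) _ _ _ _

theorem permOp_swapOp (s : Equiv.Perm (Fin n)) (l : Fin n) (f : Word n i → V) :
    permOp lam nu i V s (swapOp lam nu i V l f) =
      swapOp lam nu i V (s l) (permOp lam nu i V s f) := by
  ext x
  simp only [swapOp_apply, permOp_apply, Finset.smul_sum, Finset.sum_filter]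
  refine Fintype.sum_equiv s _ _ fun m => ?_
  have h := Equiv.mul_swap_eq_swap_mul s m l
  simp only [Function.comp_apply, s.injective.ne_iff]
  split_ifs
  · rw [smul_smul, ← perm_mul, h, smul_smul, ← perm_mul]
    congr 2
    ext q
    have := DFunLike.congr_fun h q
    simp only [Equiv.Perm.mul_apply] at this
    simp [Function.comp_apply, this]
  · exact smul_zero _

theorem permOp_theta (s : Equiv.Perm (Fin n)) (r : InEdge i) (l : Fin n) (f : Word n i → V) :
    permOp lam nu i V s (theta lam nu V r l f) = theta lam nu V r (s l) (permOp lam nu i V s f) := by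
  simp only [theta, LinearMap.comp_apply, LinearMap.add_apply, LinearMap.smul_apply, map_add,
    map_smul, LinearMap.id_apply, permOp_swapOp, permOp_muOp, permOp_piOp, tauDown]
  rw [permOp_letterOp s 1 1 (by simp)]

theorem permOp_edgeOp (s : Equiv.Perm (Fin n)) (a : DEdge I) (l : Fin n) (f : Word n i → V) :
    permOp lam nu i V s (edgeOp lam nu i V a l f) =
      edgeOp lam nu i V a (s l) (permOp lam nu i V s f) := by
  unfold edgeOp
  split_ifs
  · exact permOp_theta _ _ _ _
  · rw [LinearMap.smul_apply, LinearMap.smul_apply, map_smul, tauUp, tauUp,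
      permOp_letterOp s 1 1 (by simp)]
  · exact permOp_letterOp _ _ _ (perm_edge _ _ _ _ _) _ _ _ _

theorem update_eq_iff' {α : Type*} [DecidableEq α] (y j : Fin n → α) (l : Fin n) (b b' : α)
    (hj : j l = b') (hy : y l = b) :
    Function.update y l b' = j ↔ y = Function.update j l b := by
  constructor
  · rintro rfl
    rw [Function.update_idem, ← hy, Function.update_eq_self]
  · rintro rfl
    rw [Function.update_idem, ← hj, Function.update_eq_self]

theorem letterOp_idemOp (c : WAlg n lam nu) (l : Fin n) (u v : Letter i) (j : Fin n → I)
    (h : j l = base v) (f : Word n i → V) :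
    letterOp c l u v (idemOp (k := k) i j f) =
      idemOp (k := k) i (Function.update j l (base u)) (letterOp c l u v f) := by
  ext x
  simp only [letterOp_apply, idemOp_apply, comp_update']
  by_cases hx : x l = u
  · rw [if_pos hx, if_pos hx]
    simp only [update_eq_iff' (base ∘ x) j l (base u) (base v) h (by simp [hx])]
    split_ifs <;> simp
  · simp [hx]

theorem letterOp_idemOp_ne (c : WAlg n lam nu) (l : Fin n) (u v : Letter i) (j : Fin n → I)
    (h : j l ≠ base v) (f : Word n i → V) :
    letterOp c l u v (idemOp (k := k) i j f) = 0 := by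
  ext x
  simp only [letterOp_apply, idemOp_apply, comp_update']
  rw [if_neg (c := Function.update _ _ _ = j)]
  · simp
  · rintro rfl
    simp at h

theorem swapOp_idemOp (l : Fin n) (j : Fin n → I) (f : Word n i → V) :
    swapOp lam nu i V l (idemOp (k := k) i j f) =
      idemOp (k := k) i j (swapOp lam nu i V l f) := by
  ext x
  simp only [swapOp_apply, idemOp_apply]
  have h : ∀ m ∈ ({m | m ≠ l ∧ (x m).isRight ∧ (x l).isRight} : Finset (Fin n)),
      base ∘ (x ∘ Equiv.swap m l) = base ∘ x := by
    intro m hm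
    simp only [Finset.mem_filter, Finset.mem_univ, true_and] at hm
    obtain ⟨a, ha⟩ := Sum.isRight_iff.1 hm.2.1
    obtain ⟨b, hb⟩ := Sum.isRight_iff.1 hm.2.2
    ext q
    simp only [Function.comp_apply, Equiv.swap_apply_def]
    split_ifs with h1 h2
    · rw [h1, ha, hb]; rfl
    · rw [h2, ha, hb]; rfl
    · rfl
  rw [Finset.sum_congr rfl fun m hm => by rw [h m hm]]
  split_ifs <;> simp

theorem piOp_idemOp (p : Fin n) (j : Fin n → I) (h : j p = i) (f : Word n i → V) :
    piOp lam nu i V p (idemOp (k := k) i j f) = idemOp (k := k) i j (piOp lam nu i V p f) := by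
  simp only [piOp, LinearMap.sum_apply, map_sum]
  refine Finset.sum_congr rfl fun s _ => ?_
  rw [letterOp_idemOp _ _ _ (Sum.inr s) j h, show base (Sum.inl i : Letter i) = j p from h.symm,
    Function.update_eq_self]

theorem piOp_idemOp_ne (p : Fin n) (j : Fin n → I) (h : j p ≠ i) (f : Word n i → V) :
    piOp lam nu i V p (idemOp (k := k) i j f) = 0 := by
  simp only [piOp, LinearMap.sum_apply]
  exact Finset.sum_eq_zero fun s _ => letterOp_idemOp_ne _ _ _ (Sum.inr s) j h _

theorem muOp_idemOp (p : Fin n) (j : Fin n → I) (h : j p = i) (f : Word n i → V) :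
    muOp lam nu i V p (idemOp (k := k) i j f) = idemOp (k := k) i j (muOp lam nu i V p f) := by
  simp only [muOp, LinearMap.sum_apply, map_sum, LinearMap.smul_apply, map_smul]
  refine Finset.sum_congr rfl fun s _ => ?_
  rw [letterOp_idemOp _ _ (Sum.inr s) (Sum.inl i) j h, show base (Sum.inr s) = j p from h.symm,
    Function.update_eq_self]

theorem theta_idemOp (r : InEdge i) (l : Fin n) (j : Fin n → I) (h : j l = tail r.1)
    (f : Word n i → V) : theta lam nu V r l (idemOp (k := k) i j f) =
      idemOp (k := k) i (Function.update j l i) (theta lam nu V r l f) := by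
  have hb : base (Sum.inr r) = i := rfl
  have hu : Function.update j l i l = i := by simp
  simp only [theta, LinearMap.comp_apply, LinearMap.add_apply, LinearMap.smul_apply, map_add,
    map_smul, LinearMap.id_apply, tauDown, letterOp_idemOp (1 : WAlg n lam nu) l (Sum.inr r)
      (Sum.inl (tail r.1)) j h, swapOp_idemOp, hb, piOp_idemOp l _ hu,
      muOp_idemOp l _ hu]

theorem edgeOp_idemOp (a : DEdge I) (l : Fin n) (j : Fin n → I) (h : j l = tail a)
    (f : Word n i → V) : edgeOp lam nu i V a l (idemOp (k := k) i j f) =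
      idemOp (k := k) i (Function.update j l (head a)) (edgeOp lam nu i V a l f) := by
  unfold edgeOp
  split_ifs with h1 h2
  · rw [theta_idemOp _ _ _ h, h1]
  · rw [LinearMap.smul_apply, LinearMap.smul_apply, map_smul, tauUp,
      letterOp_idemOp _ _ _ (Sum.inr _) _ (h.trans h2)]
    have : base (Sum.inl (tail (star a)) : Letter i) = head a := tail_star a
    simp only [this]
  · exact letterOp_idemOp _ _ _ _ _ h _

theorem edgeOp_idemOp_ne (a : DEdge I) (l : Fin n) (j : Fin n → I) (h : j l ≠ tail a)
    (f : Word n i → V) : edgeOp lam nu i V a l (idemOp (k := k) i j f) = 0 := by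
  unfold edgeOp
  split_ifs with h1 h2
  · rw [theta, LinearMap.comp_apply, tauDown, letterOp_idemOp_ne _ _ _ _ _ h, map_zero]
  · rw [LinearMap.smul_apply, tauUp, letterOp_idemOp_ne _ _ _ (Sum.inr _) _ (fun e => h (e.trans h2.symm)),
      smul_zero]
  · exact letterOp_idemOp_ne _ _ _ _ _ h _

theorem rel_i_mod (v : V) (j : Fin n → I) (hv : idem lam nu j • v = v) (l : Fin n) :
    ∑ a with head a = j l, sgn k a • edge lam nu a l • edge lam nu (star a) l • v =
      lam (j l) • v + nu • ∑ m with m ≠ l ∧ j m = j l, perm lam nu (Equiv.swap l m) • v := by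
  have h := congrArg (· • v) (rel_i lam nu l j)
  simp only [mul_smul, hv, add_smul, Finset.sum_smul, smul_assoc] at h
  rw [← h, Finset.sum_filter]
  refine Finset.sum_congr rfl fun a _ => ?_
  split_ifs with ha
  · rfl
  · rw [← hv, smul_smul (edge lam nu (star a) l), edge_idem_ne _ _ _ _ _ (by
      rw [tail_star]; exact fun e => ha e.symm)]
    simp

theorem rel_ii_mod (v : V) (j : Fin n → I) (hv : idem lam nu j • v = v) (l m : Fin n)
    (hlm : l ≠ m) (a b : DEdge I) (ha : j l = tail a) (hb : j m = tail b) :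
    edge lam nu a l • edge lam nu b m • v = edge lam nu b m • edge lam nu a l • v +
      if b = star a then -(sgn k a * nu) • perm lam nu (Equiv.swap l m) • v else 0 := by
  have h := congrArg (· • v) (rel_ii lam nu l m hlm a b j ha hb)
  simp only [sub_smul, mul_smul, hv, ite_smul, smul_assoc, zero_smul, sub_eq_iff_eq_add'] at h
  exact h

theorem edge_mem (v : V) (j : Fin n → I) (hv : idem lam nu j • v = v) (l : Fin n) (a : DEdge I)
    (ha : j l = tail a) :
    idem lam nu (Function.update j l (head a)) • edge lam nu a l • v = edge lam nu a l • v := by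
  rw [smul_smul, ← edge_idem _ _ _ _ _ ha, mul_smul, hv]

theorem sum_inEdge {M : Type*} [AddCommMonoid M] (F : DEdge I → M) :
    ∑ r : InEdge i, F r.1 = ∑ a with head a = i, F a :=
  (Finset.sum_subtype _ (fun a => by simp) F).symm

theorem tail_ne (hi : IsEmpty (i ⟶ i)) {a : DEdge I} (h : head a = i) : tail a ≠ i := by
  intro h'
  rcases a with ⟨x, y, f⟩ | ⟨x, y, f⟩
  · obtain rfl : y = i := h
    obtain rfl : x = y := h'
    exact hi.false f
  · obtain rfl : x = i := h
    obtain rfl : y = x := h'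
    exact hi.false f

theorem ker_eq {f : Word n i → V} (hf : f ∈ reflCarrier lam nu i V) (p : Fin n) (x : Word n i) :
    ∑ r : InEdge i, edge lam nu r.1 p • f (Function.update x p (Sum.inr r)) = 0 := by
  have := congrFun (hf.2.2 p) (Function.update x p (Sum.inl i))
  simpa [piOp_apply] using this

theorem idemOp_mem {f : Word n i → V} (hf : f ∈ reflCarrier lam nu i V) (j : Fin n → I) :
    idemOp (k := k) i j f ∈ reflCarrier lam nu i V := by
  refine ⟨fun x => ?_, fun x m h => ?_, fun p => ?_⟩
  · rw [idemOp_apply]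
    split_ifs
    · exact hf.1 x
    · simp
  · rw [idemOp_apply, hf.2.1 x m h, ite_self]
  · by_cases h : j p = i
    · rw [piOp_idemOp _ _ h, hf.2.2, map_zero]
    · rw [piOp_idemOp_ne _ _ h]

theorem permOp_mem {f : Word n i → V} (hf : f ∈ reflCarrier lam nu i V) (s : Equiv.Perm (Fin n)) :
    permOp lam nu i V s f ∈ reflCarrier lam nu i V := by
  refine ⟨IsGraded.permOp hf.1 s, fun x m h => ?_, fun p => ?_⟩
  · rw [permOp_apply, hf.2.1 _ (s.symm m) (by simp [h]), smul_zero]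
  · have := permOp_piOp (lam := lam) (nu := nu) s (s.symm p) f
    rw [Equiv.apply_symm_apply, hf.2.2, map_zero] at this
    exact this.symm

theorem theta_mem_aux (hi : IsEmpty (i ⟶ i)) {f : Word n i → V} (hf : f ∈ reflCarrier lam nu i V)
    (r : InEdge i) (l : Fin n) (y : Word n i) :
    ∑ u : InEdge i, edge lam nu u.1 l •
      theta lam nu V r l f (Function.update y l (Sum.inr u)) = 0 := by
  have hr := tail_ne hi r.2
  simp only [theta_apply_inr r l f _ _ (Function.update_self l _ y), Function.update_idem, smul_add,
    Finset.sum_add_distrib]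
  have h1 : ∑ u : InEdge i, edge lam nu u.1 l • (if u = r then
      -(lam i • f (Function.update y l (Sum.inl (tail r.1)))) else 0) =
      -(lam i • edge lam nu r.1 l • f (Function.update y l (Sum.inl (tail r.1)))) := by
    rw [Finset.sum_eq_single r]
    · rw [if_pos rfl, smul_neg, smul_comm]
    · intro b _ hb
      rw [if_neg hb, smul_zero]
    · simp
  have h2 : ∑ u : InEdge i, edge lam nu u.1 l • sgn k u.1 • edge lam nu (star u.1) l •
      edge lam nu r.1 l • f (Function.update y l (Sum.inl (tail r.1))) =
      lam i • edge lam nu r.1 l • f (Function.update y l (Sum.inl (tail r.1))) := by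
    have hw := edge_mem _ _ (hf.1 (Function.update y l (Sum.inl (tail r.1)))) l r.1 (by simp [src])
    have := rel_i_mod _ _ hw l
    simp only [Function.update_self, r.2] at this
    rw [← sum_inEdge] at this
    simp only [smul_comm _ (sgn k _)]
    rw [this, add_eq_left, Finset.sum_eq_zero, smul_zero]
    intro m hm
    simp only [Finset.mem_filter, Finset.mem_univ, true_and] at hm
    obtain ⟨hml, hm⟩ := hm
    rw [Function.update_of_ne hml] at hm
    simp only [Function.comp_apply, Function.update_of_ne hml] at hm
    rw [hf.2.1 _ m, smul_zero, smul_zero]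
    rw [Function.update_of_ne hml]
    rcases hy : y m with v | s
    · rw [hy] at hm; exact congrArg _ hm
    · rw [hy] at hm; exact absurd hm (tail_ne hi s.2)
  rw [h1, h2, neg_add_cancel, zero_add]
  simp only [smul_comm _ nu]
  rw [← Finset.smul_sum]
  convert smul_zero nu
  simp only [Finset.smul_sum, Finset.sum_filter]
  rw [Finset.sum_comm]
  refine Finset.sum_eq_zero fun m _ => ?_
  by_cases hml : m = l
  · simp [hml]
  by_cases hm : y m = Sum.inr r
  · have := congrArg (perm lam nu (Equiv.swap m l) • ·)
      (ker_eq hf m (Function.update y l (Sum.inl (tail r.1))))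
    simp only [Finset.smul_sum, smul_zero] at this
    rw [← this]
    refine Finset.sum_congr rfl fun u _ => ?_
    rw [if_pos (by simp [hml, hm]), smul_smul, smul_smul, perm_edge, Equiv.swap_apply_left,
      Function.update_comm hml, Function.update_idem]
  · simp [hm, hml]

theorem theta_mem_aux' (hi : IsEmpty (i ⟶ i)) {f : Word n i → V} (hf : f ∈ reflCarrier lam nu i V)
    (r : InEdge i) (l p : Fin n) (hpl : p ≠ l) (y : Word n i) :
    ∑ u : InEdge i, edge lam nu u.1 p •
      theta lam nu V r l f (Function.update y p (Sum.inr u)) = 0 := by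
  have hr := tail_ne hi r.2
  rcases hy : y l with v | s
  · refine Finset.sum_eq_zero fun u _ => ?_
    rw [theta_apply_inl _ _ _ _ v (by simp [hpl.symm, hy]), smul_zero]
  set G : InEdge i → V := fun u =>
    f (Function.update (Function.update y p (Sum.inr u)) l (Sum.inl (tail r.1))) with hG
  have hG' (u : InEdge i) : G u =
    f (Function.update (Function.update y l (Sum.inl (tail r.1))) p (Sum.inr u)) := by
    change f _ = f _
    rw [Function.update_comm hpl]
  have hk : ∑ u : InEdge i, edge lam nu u.1 p • G u = 0 := by
    simp only [hG']; exact ker_eq hf _ _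
  have hθ := fun u : InEdge i => theta_apply_inr (lam := lam) (nu := nu) r l f
    (Function.update y p (Sum.inr u)) s (by simp [hpl.symm, hy])
  simp only [hθ, smul_add, Finset.sum_add_distrib]
  have h1 : ∑ u : InEdge i, edge lam nu u.1 p • (if s = r then -(lam i • G u) else 0) = 0 := by
    split_ifs
    · simp only [smul_neg, smul_comm _ (lam i), Finset.sum_neg_distrib, ← Finset.smul_sum, hk]
      simp
    · simp
  have h2 : ∑ u : InEdge i, edge lam nu u.1 p • sgn k s.1 • edge lam nu (star s.1) l •
      edge lam nu r.1 l • G u =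
      -(nu • perm lam nu (Equiv.swap p l) • edge lam nu r.1 l • G s) := by
    have e (u : InEdge i) : edge lam nu u.1 p • edge lam nu (star s.1) l • edge lam nu r.1 l • G u =
        edge lam nu (star s.1) l • edge lam nu r.1 l • edge lam nu u.1 p • G u +
        if u = s then -(sgn k s.1 * nu) • perm lam nu (Equiv.swap p l) • edge lam nu r.1 l • G s
          else 0 := by
      have hw := edge_mem _ _ (hf.1 (Function.update (Function.update y p (Sum.inr u)) l
        (Sum.inl (tail r.1)))) l r.1 (by simp [src])
      rw [rel_ii_mod _ _ hw p l hpl u.1 (star s.1) (by simp [hpl, src]) (by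
        simp [tail_star, r.2, s.2])]
      congr 1
      · rw [smul_smul (edge lam nu u.1 p), edge_comm _ _ _ _ hpl _ _ (by
          intro e
          apply tail_ne hi u.2
          rw [← head_star, ← e, r.2]), ← smul_smul]
      · by_cases hus : u = s
        · simp [hus, hG]
        · rw [if_neg hus, if_neg]
          intro e
          apply hus
          apply Subtype.ext
          rw [← star_star u.1, ← e, star_star]
    simp only [smul_comm _ (sgn k s.1), e, ← Finset.smul_sum, Finset.sum_add_distrib, hk]
    simp only [smul_zero, zero_add, Finset.sum_ite_eq', Finset.mem_univ, if_true, neg_smul,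
      smul_neg, smul_smul, ← mul_assoc, sgn_mul_self, one_mul]
  have h3 : ∑ u : InEdge i, edge lam nu u.1 p • nu •
      ∑ m with m ≠ l ∧ Function.update y p (Sum.inr u) m = Sum.inr r, perm lam nu (Equiv.swap m l) •
        f (Function.update (Function.update (Function.update y p (Sum.inr u)) m (Sum.inr s)) l
          (Sum.inl (tail r.1))) =
      nu • perm lam nu (Equiv.swap p l) • edge lam nu r.1 l • G s := by
    simp only [smul_comm _ nu, ← Finset.smul_sum]
    congr 1
    simp only [Finset.smul_sum, Finset.sum_filter]
    rw [Finset.sum_comm, Finset.sum_eq_single p]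
    · rw [Finset.sum_eq_single r]
      · rw [if_pos (by simp [hpl]), Function.update_idem, smul_smul, smul_smul, perm_edge,
          Equiv.swap_apply_right]
      · intro u _ hu
        simp [hu]
      · simp
    · intro m _ hmp
      by_cases hm : m ≠ l ∧ y m = Sum.inr r
      · have := congrArg (perm lam nu (Equiv.swap m l) • ·) (ker_eq hf p
          (Function.update (Function.update y m (Sum.inr s)) l (Sum.inl (tail r.1))))
        simp only [Finset.smul_sum, smul_zero] at this
        rw [← this]
        refine Finset.sum_congr rfl fun u _ => ?_
        rw [if_pos (by simpa [hmp] using hm), smul_smul, smul_smul, perm_edge,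
          Equiv.swap_apply_of_ne_of_ne hmp.symm hpl, Function.update_comm hmp.symm,
          Function.update_comm hpl]
      · refine Finset.sum_eq_zero fun u _ => ?_
        rw [if_neg (by simpa [hmp] using hm), smul_zero]
    · simp
  rw [h1, h2, h3]
  simp

theorem theta_mem (hi : IsEmpty (i ⟶ i)) {f : Word n i → V} (hf : f ∈ reflCarrier lam nu i V)
    (r : InEdge i) (l : Fin n) : theta lam nu V r l f ∈ reflCarrier lam nu i V := by
  refine ⟨IsGraded.theta hf.1 r l, fun x m hm => ?_, fun p => ?_⟩
  · rcases hx : x l with v | s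
    · exact theta_apply_inl _ _ _ _ v hx
    · have hml : m ≠ l := by rintro rfl; simp [hm] at hx
      rw [theta_apply_inr _ _ _ _ s hx, hf.2.1 (Function.update x l _) m (by simp [hml, hm]),
        Finset.sum_eq_zero]
      · simp
      · intro q hq
        simp only [Finset.mem_filter, Finset.mem_univ, true_and] at hq
        have hmq : m ≠ q := by rintro rfl; simp [hm] at hq
        rw [hf.2.1 _ m (by simp [hml, hmq, hm]), smul_zero]
  · ext y
    rw [piOp_apply]
    split_ifs
    · by_cases hpl : p = l
      · subst hpl; exact theta_mem_aux hi hf _ _ _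
      · exact theta_mem_aux' hi hf _ _ _ hpl _
    · rfl

theorem letterOp_mem {f : Word n i → V} (hf : f ∈ reflCarrier lam nu i V) (c : WAlg n lam nu)
    (l : Fin n) (u v : Letter i)
    (hc : ∀ j : Fin n → I, j l = src v →
      c * idem lam nu j = idem lam nu (Function.update j l (src u)) * c)
    (hc' : ∀ (p : Fin n) (r : InEdge i), l ≠ p → c * edge lam nu r.1 p = edge lam nu r.1 p * c)
    (hu : ∃ v, u = Sum.inl v ∧ v ≠ i) : letterOp c l u v f ∈ reflCarrier lam nu i V := by
  obtain ⟨w, rfl, hw⟩ := hu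
  refine ⟨IsGraded.letterOp hf.1 _ _ _ _ hc, fun x m h => ?_, fun p => ?_⟩
  · rw [letterOp_apply]
    split_ifs with hx
    · have hml : m ≠ l := by rintro rfl; rw [h] at hx; exact hw (Sum.inl.inj hx).symm
      rw [hf.2.1 _ m (by simp [hml, h]), smul_zero]
    · rfl
  · by_cases hpl : l = p
    · subst hpl
      ext y
      simp [piOp_apply, letterOp_apply]
    · rw [← map_zero (letterOp c l (Sum.inl w) v), ← hf.2.2 p]
      simp only [piOp, LinearMap.sum_apply, map_sum]
      exact Finset.sum_congr rfl fun r _ =>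
        letterOp_comm _ _ (hc' p r hpl).symm _ _ (Ne.symm hpl) _ _ _ _ _

theorem edgeOp_mem (hi : IsEmpty (i ⟶ i)) {f : Word n i → V} (hf : f ∈ reflCarrier lam nu i V)
    (a : DEdge I) (l : Fin n) : edgeOp lam nu i V a l f ∈ reflCarrier lam nu i V := by
  unfold edgeOp
  split_ifs with h h'
  · exact theta_mem hi hf _ _
  · refine Submodule.smul_mem _ _ (letterOp_mem hf _ _ _ _ (fun j hj => ?_) (by simp)
      ⟨_, rfl, by rwa [tail_star]⟩)
    have e := Function.update_eq_self l j
    rw [hj] at e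
    rw [one_mul, mul_one]
    exact congrArg _ e.symm
  · refine letterOp_mem hf _ _ _ _ (fun j hj => edge_idem _ _ _ _ _ hj) (fun p r hpl =>
      edge_comm _ _ _ _ hpl _ _ fun e => h' ?_) ⟨_, rfl, h⟩
    rw [← head_star, ← e, r.2]

theorem theta_aux (x : Word n i) (l m : Fin n) (hlm : l ≠ m) (q w : InEdge i) (v : I)
    (f : Word n i → V) (Y : Word n i)
    (hY : Y = Function.update (Function.update x l (Sum.inl v)) m (Sum.inl (tail q.1))) :
    theta lam nu V q m f (Function.update (Function.update x m (Sum.inr w)) l (Sum.inl v)) =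
      (if w = q then -(lam i • f Y) else 0) +
      sgn k w.1 • edge lam nu (star w.1) m • edge lam nu q.1 m • f Y +
      nu • ∑ p with p ≠ l ∧ p ≠ m ∧ x p = Sum.inr q,
        perm lam nu (Equiv.swap p m) • f (Function.update Y p (Sum.inr w)) := by
  have e : Function.update (Function.update (Function.update x m (Sum.inr w)) l (Sum.inl v)) m
      (Sum.inl (tail q.1)) = Y := by
    rw [hY, Function.update_comm hlm, Function.update_idem, Function.update_comm hlm.symm]
  rw [theta_apply_inr _ _ _ _ w (by simp [hlm.symm]), e]
  congr 2
  rw [Finset.sum_filter, Finset.sum_filter]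
  refine Finset.sum_congr rfl fun p _ => ?_
  by_cases hpm : p = m
  · simp [hpm]
  by_cases hpl : p = l
  · simp [hpl]
  simp only [ne_eq, hpm, hpl, not_false_eq_true, true_and, Function.update_of_ne]
  rw [Function.update_comm hpm, e]

theorem sum_split {M : Type*} [AddCommMonoid M] (P : Fin n → Prop) [DecidablePred P] (m : Fin n)
    (Q : Prop) [Decidable Q] (hQ : P m ↔ Q) (F : Fin n → M) :
    ∑ p with P p, F p = (if Q then F m else 0) + ∑ p with p ≠ m ∧ P p, F p := by
  rw [Finset.sum_filter, Finset.sum_filter, ← Finset.add_sum_erase _ _ (Finset.mem_univ m)]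
  congr 1
  · simp only [hQ]
  · rw [← Finset.add_sum_erase (a := m) _ _ (Finset.mem_univ m), if_neg (by simp), zero_add]
    refine Finset.sum_congr rfl fun p hp => ?_
    simp [(Finset.mem_erase.1 hp).1]

set_option maxHeartbeats 400000 in
theorem theta_theta {f : Word n i → V} (hf : IsGraded lam nu f)
    (r q : InEdge i) (l m : Fin n) (hlm : l ≠ m) (s u : InEdge i) (x : Word n i)
    (hs : x l = Sum.inr s) (hu : x m = Sum.inr u) (Y : Word n i)
    (hY : Y = Function.update (Function.update x l (Sum.inl (tail r.1))) m (Sum.inl (tail q.1))) :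
    theta lam nu V r l (theta lam nu V q m f) x =
      (if s = r then if u = q then lam i • lam i • f Y else 0 else 0) +
      (if s = r then
        -(lam i • sgn k u.1 • edge lam nu (star u.1) m • edge lam nu q.1 m • f Y) else 0) +
      (if s = r then -(lam i • nu • ∑ p with p ≠ l ∧ p ≠ m ∧ x p = Sum.inr q,
        perm lam nu (Equiv.swap p m) • f (Function.update Y p (Sum.inr u))) else 0) +
      (if u = q then
        -(lam i • sgn k s.1 • edge lam nu (star s.1) l • edge lam nu r.1 l • f Y) else 0) +
      (sgn k s.1 • sgn k u.1 • edge lam nu (star s.1) l • edge lam nu (star u.1) m •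
        edge lam nu r.1 l • edge lam nu q.1 m • f Y) +
      nu • (sgn k s.1 • edge lam nu (star s.1) l • edge lam nu r.1 l •
        ∑ p with p ≠ l ∧ p ≠ m ∧ x p = Sum.inr q,
          perm lam nu (Equiv.swap p m) • f (Function.update Y p (Sum.inr u))) +
      (if u = r then if s = q then
        -(lam i • nu • perm lam nu (Equiv.swap m l) • f Y) else 0 else 0) +
      (if u = q then -(lam i • nu • ∑ p with p ≠ l ∧ p ≠ m ∧ x p = Sum.inr r,
        perm lam nu (Equiv.swap p l) • f (Function.update Y p (Sum.inr s))) else 0) +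
      nu • (sgn k u.1 • edge lam nu (star u.1) m • edge lam nu q.1 m •
        ∑ p with p ≠ l ∧ p ≠ m ∧ x p = Sum.inr r,
          perm lam nu (Equiv.swap p l) • f (Function.update Y p (Sum.inr s))) +
      nu • nu • ((if u = r then ∑ p with p ≠ l ∧ p ≠ m ∧ x p = Sum.inr q,
          perm lam nu (Equiv.swap m l * Equiv.swap p m) • f (Function.update Y p (Sum.inr s))
          else 0) +
        (if s = q then ∑ p with p ≠ l ∧ p ≠ m ∧ x p = Sum.inr r,
          perm lam nu (Equiv.swap p l * Equiv.swap p m) • f (Function.update Y p (Sum.inr u))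
          else 0) +
        ∑ p with p ≠ l ∧ p ≠ m ∧ x p = Sum.inr r,
          ∑ p' with p' ≠ p ∧ p' ≠ l ∧ p' ≠ m ∧ x p' = Sum.inr q,
            perm lam nu (Equiv.swap p l * Equiv.swap p' m) •
              f (Function.update (Function.update Y p (Sum.inr s)) p' (Sum.inr u))) := by
  have g0 := theta_aux (lam := lam) (nu := nu) x l m hlm q u (tail r.1) f Y hY
  rw [show Function.update x m (Sum.inr u) = x by rw [← hu, Function.update_eq_self]] at g0
  have gm := theta_aux (lam := lam) (nu := nu) x l m hlm q s (tail r.1) f Y hY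
  have gp (p : Fin n) (hpl : p ≠ l) (hpm : p ≠ m) :=
    theta_aux (lam := lam) (nu := nu) (Function.update x p (Sum.inr s)) l m hlm q u (tail r.1) f
      (Function.update Y p (Sum.inr s)) (by
        rw [hY, Function.update_comm hpm.symm, Function.update_comm hpl.symm])
  have gp' (p : Fin n) (hpl : p ≠ l) (hpm : p ≠ m) : Function.update (Function.update x p
      (Sum.inr s)) m (Sum.inr u) = Function.update x p (Sum.inr s) := by
    rw [Function.update_comm hpm, ← hu, Function.update_eq_self]
  have hYg : idem lam nu (Function.update (src ∘ Y) m i) • edge lam nu q.1 m • f Y =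
      edge lam nu q.1 m • f Y := by
    have := edge_mem _ _ (hf Y) m q.1 (by simp [hY, src])
    rwa [q.2] at this
  have hB : sgn k s.1 • edge lam nu (star s.1) l • edge lam nu r.1 l •
      sgn k u.1 • edge lam nu (star u.1) m • edge lam nu q.1 m • f Y =
      (sgn k s.1 • sgn k u.1 • edge lam nu (star s.1) l • edge lam nu (star u.1) m •
        edge lam nu r.1 l • edge lam nu q.1 m • f Y) +
      if u = r then -(nu • perm lam nu (Equiv.swap m l) • sgn k s.1 • edge lam nu (star s.1) m •
        edge lam nu q.1 m • f Y) else 0 := by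
    simp only [smul_comm (_ : WAlg n lam nu) (sgn k _)]
    rw [rel_ii_mod _ _ hYg l m hlm r.1 (star u.1) (by simp [hY, hlm, src])
      (by simp [tail_star, u.2])]
    rw [smul_add, smul_add, smul_add, smul_comm (sgn k s.1) (sgn k u.1)]
    congr 1
    by_cases hur : u = r
    · rw [if_pos (by rw [hur]), if_pos hur, hur, Equiv.swap_comm l m]
      simp only [neg_smul, smul_neg, smul_comm (_ : WAlg n lam nu) (sgn k _),
        smul_comm (_ : WAlg n lam nu) nu, mul_smul]
      rw [smul_smul (sgn k r.1), sgn_mul_self, one_smul, smul_smul (edge lam nu (star s.1) l),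
        smul_smul (perm lam nu _), perm_edge, Equiv.swap_apply_left, smul_comm (sgn k s.1) nu]
    · rw [if_neg hur, if_neg]
      · simp
      · intro e
        exact hur (Subtype.ext (by rw [← star_star u.1, e, star_star]))
  have hC : ∑ p with p ≠ l ∧ x p = Sum.inr r, perm lam nu (Equiv.swap p l) •
      theta lam nu V q m f (Function.update (Function.update x p (Sum.inr s)) l
        (Sum.inl (tail r.1))) =
      (if u = r then (if s = q then -(lam i • perm lam nu (Equiv.swap m l) • f Y) else 0) +
        perm lam nu (Equiv.swap m l) • sgn k s.1 • edge lam nu (star s.1) m •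
          edge lam nu q.1 m • f Y +
        nu • ∑ p with p ≠ l ∧ p ≠ m ∧ x p = Sum.inr q,
          perm lam nu (Equiv.swap m l * Equiv.swap p m) • f (Function.update Y p (Sum.inr s))
        else 0) +
      ((if u = q then -(lam i • ∑ p with p ≠ l ∧ p ≠ m ∧ x p = Sum.inr r,
        perm lam nu (Equiv.swap p l) • f (Function.update Y p (Sum.inr s))) else 0) +
      (sgn k u.1 • edge lam nu (star u.1) m • edge lam nu q.1 m •
        ∑ p with p ≠ l ∧ p ≠ m ∧ x p = Sum.inr r,
          perm lam nu (Equiv.swap p l) • f (Function.update Y p (Sum.inr s))) +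
      nu • ((if s = q then ∑ p with p ≠ l ∧ p ≠ m ∧ x p = Sum.inr r,
          perm lam nu (Equiv.swap p l * Equiv.swap p m) • f (Function.update Y p (Sum.inr u))
          else 0) +
        ∑ p with p ≠ l ∧ p ≠ m ∧ x p = Sum.inr r,
          ∑ p' with p' ≠ p ∧ p' ≠ l ∧ p' ≠ m ∧ x p' = Sum.inr q,
            perm lam nu (Equiv.swap p l * Equiv.swap p' m) •
              f (Function.update (Function.update Y p (Sum.inr s)) p' (Sum.inr u)))) := by
    rw [sum_split _ m (u = r) (by simp [hlm.symm, hu])]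
    congr 1
    · by_cases hur : u = r
      · rw [if_pos hur, if_pos hur, gm]
        simp only [smul_add, smul_comm (_ : WAlg n lam nu) nu, Finset.smul_sum, perm_mul, mul_smul]
        congr 2
        split_ifs
        · rw [smul_neg, smul_comm]
        · simp
      · rw [if_neg hur, if_neg hur]
    · have f1 : Finset.univ.filter (fun p => p ≠ m ∧ p ≠ l ∧ x p = Sum.inr r) =
        Finset.univ.filter (fun p => p ≠ l ∧ p ≠ m ∧ x p = Sum.inr r) := by ext p; simp; tauto
      rw [f1]
      have key : ∀ p ∈ Finset.univ.filter (fun p => p ≠ l ∧ p ≠ m ∧ x p = Sum.inr r),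
          perm lam nu (Equiv.swap p l) • theta lam nu V q m f (Function.update
            (Function.update x p (Sum.inr s)) l (Sum.inl (tail r.1))) =
          (if u = q then -(lam i •
            perm lam nu (Equiv.swap p l) • f (Function.update Y p (Sum.inr s))) else 0) +
          (sgn k u.1 • edge lam nu (star u.1) m • edge lam nu q.1 m •
              perm lam nu (Equiv.swap p l) • f (Function.update Y p (Sum.inr s))) +
          nu • ((if s = q then
              perm lam nu (Equiv.swap p l * Equiv.swap p m) • f (Function.update Y p (Sum.inr u))
              else 0) +
              ∑ p' with p' ≠ p ∧ p' ≠ l ∧ p' ≠ m ∧ x p' = Sum.inr q,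
                perm lam nu (Equiv.swap p l * Equiv.swap p' m) •
                  f (Function.update (Function.update Y p (Sum.inr s)) p' (Sum.inr u))) := by
        intro p hp
        simp only [Finset.mem_filter, Finset.mem_univ, true_and] at hp
        obtain ⟨hpl, hpm, hp⟩ := hp
        have := gp p hpl hpm
        rw [gp' p hpl hpm] at this
        rw [this, smul_add, smul_add]
        congr 1
        · congr 1
          · split_ifs
            · rw [smul_neg, smul_comm]
            · simp
          · rw [smul_comm (perm lam nu _) (sgn k _), smul_smul (perm lam nu _), perm_edge,
              Equiv.swap_apply_of_ne_of_ne hpm.symm hlm.symm, mul_smul,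
              smul_smul (perm lam nu _), perm_edge,
              Equiv.swap_apply_of_ne_of_ne hpm.symm hlm.symm, mul_smul]
        · rw [smul_comm _ nu, sum_split _ p (s = q) (by simp [hpl, hpm])]
          congr 1
          rw [smul_add]
          congr 1
          · split_ifs
            · rw [Function.update_idem, perm_mul, mul_smul]
            · simp
          · rw [Finset.smul_sum]
            refine Finset.sum_congr ?_ fun p' _ => by rw [perm_mul, mul_smul]
            ext p'
            simp only [Finset.mem_filter, Finset.mem_univ, true_and]
            refine and_congr_right fun h => ?_
            rw [Function.update_of_ne h]
      rw [Finset.sum_congr rfl key]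
      simp only [Finset.sum_add_distrib, ← Finset.smul_sum]
      congr 3
      · split_ifs <;> simp [Finset.smul_sum]
      · split_ifs <;> simp
  rw [theta_apply_inr r l _ x s hs, hC, g0]
  have hA (a b c : V) : (if s = r then -(lam i • ((if u = q then -(lam i • a) else 0) + b + nu • c))
      else 0) = (if s = r then if u = q then lam i • lam i • a else 0 else 0) +
      (if s = r then -(lam i • b) else 0) + (if s = r then -(lam i • nu • c) else 0) := by
    split_ifs <;> simp only [smul_add, smul_neg, neg_add, neg_neg, smul_zero, add_zero, neg_zero]
  have hA2 (a : V) : sgn k s.1 • edge lam nu (star s.1) l • edge lam nu r.1 l •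
      (if u = q then -(lam i • a) else 0) =
      if u = q then -(lam i • sgn k s.1 • edge lam nu (star s.1) l • edge lam nu r.1 l • a) else 0 := by
    split_ifs
    · simp only [smul_neg, smul_comm (_ : WAlg n lam nu) (lam i), smul_comm (sgn k _) (lam i)]
    · simp
  have hA3 (a : V) : sgn k s.1 • edge lam nu (star s.1) l • edge lam nu r.1 l • nu • a =
      nu • sgn k s.1 • edge lam nu (star s.1) l • edge lam nu r.1 l • a := by
    simp only [smul_comm (_ : WAlg n lam nu) nu, smul_comm (sgn k _) nu]
  have hA4 (a b c : V) : nu • (if u = r then (if s = q then -(lam i • a) else 0) + b + nu • c else 0) =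
      (if u = r then if s = q then -(lam i • nu • a) else 0 else 0) +
      (if u = r then nu • b else 0) + nu • nu • (if u = r then c else 0) := by
    split_ifs <;> simp [smul_comm nu (lam i)]
  have hA5 (a : V) : nu • (if u = q then -(lam i • a) else 0) =
      if u = q then -(lam i • nu • a) else 0 := by
    split_ifs <;> simp [smul_comm nu (lam i)]
  have hA6 (a : V) : (if u = r then -a else 0) = -(if u = r then a else 0) := by
    split_ifs <;> simp
  rw [hA, smul_add (edge lam nu r.1 l), smul_add (edge lam nu r.1 l), smul_add (edge lam nu _ l),
    smul_add (edge lam nu _ l), smul_add (sgn k _), smul_add (sgn k _), hA2, hA3, hB,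
    smul_add nu, hA4, smul_add nu, smul_add nu, hA5, hA6]
  simp only [smul_add nu]
  abel

theorem ite_ite_swap {M : Type*} [Zero M] (P Q : Prop) [Decidable P] [Decidable Q] (a : M) :
    (if P then if Q then a else 0 else 0) = if Q then if P then a else 0 else 0 := by
  split_ifs <;> rfl

set_option maxHeartbeats 400000 in
theorem theta_comm (hi : IsEmpty (i ⟶ i)) {f : Word n i → V} (hf : IsGraded lam nu f)
    (r q : InEdge i) (l m : Fin n) (hlm : l ≠ m) :
    theta lam nu V r l (theta lam nu V q m f) = theta lam nu V q m (theta lam nu V r l f) := by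
  have zero (r q : InEdge i) (l m : Fin n) (hlm : l ≠ m) (x : Word n i) (v : I)
      (hx : x l = Sum.inl v) : theta lam nu V q m (theta lam nu V r l f) x = 0 := by
    rcases hm : x m with v' | u
    · exact theta_apply_inl _ _ _ _ v' hm
    · rw [theta_apply_inr _ _ _ _ u hm, theta_apply_inl _ _ _ (Function.update x m _) v
        (by simp [hlm, hx]), Finset.sum_eq_zero]
      · simp
      · intro p hp
        simp only [Finset.mem_filter, Finset.mem_univ, true_and] at hp
        have hpl : l ≠ p := by rintro rfl; simp [hx] at hp
        rw [theta_apply_inl _ _ _ _ v (by simp [hlm, hpl, hx]), smul_zero]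
  ext x
  rcases hl : x l with v | s
  · rw [theta_apply_inl _ _ _ _ v hl, zero r q l m hlm x v hl]
  rcases hm : x m with v | u
  · rw [theta_apply_inl _ _ _ _ v hm, zero q r m l hlm.symm x v hm]
  rw [theta_theta hf r q l m hlm s u x hl hm _ rfl,
    theta_theta hf q r m l hlm.symm u s x hm hl
      (Function.update (Function.update x l (Sum.inl (tail r.1))) m (Sum.inl (tail q.1)))
      (Function.update_comm hlm _ _ _)]
  set Y := Function.update (Function.update x l (Sum.inl (tail r.1))) m (Sum.inl (tail q.1))
  have c1 : edge lam nu (star s.1) l • edge lam nu (star u.1) m •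
        edge lam nu r.1 l • edge lam nu q.1 m • f Y = edge lam nu (star u.1) m •
        edge lam nu (star s.1) l • edge lam nu q.1 m • edge lam nu r.1 l • f Y := by
    rw [smul_smul (edge lam nu r.1 l), smul_smul (edge lam nu (star s.1) l),
      edge_comm _ _ _ _ hlm, edge_comm _ _ l m hlm r.1, ← smul_smul, ← smul_smul]
    · intro e; exact tail_ne hi r.2 (by rw [← head_star, ← e, q.2])
    · intro e
      rw [star_star] at e
      exact tail_ne hi u.2 (by rw [← head_star, e, s.2])
  have c2 : ∀ p, p ≠ l → p ≠ m → Equiv.swap m l * Equiv.swap p m =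
      Equiv.swap p m * Equiv.swap p l := by
    intro p hpl hpm
    have := Equiv.mul_swap_eq_swap_mul (Equiv.swap p m) p l
    rw [this, Equiv.swap_apply_left, Equiv.swap_apply_of_ne_of_ne hpl.symm hlm]
  have c2' : ∀ p, p ≠ l → p ≠ m → Equiv.swap l m * Equiv.swap p l =
      Equiv.swap p l * Equiv.swap p m := by
    intro p hpl hpm
    have := Equiv.mul_swap_eq_swap_mul (Equiv.swap p l) p m
    rw [this, Equiv.swap_apply_left, Equiv.swap_apply_of_ne_of_ne hpm.symm hlm.symm]
  have f1 (z : InEdge i) : Finset.univ.filter (fun p => p ≠ m ∧ p ≠ l ∧ x p = Sum.inr z) =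
      Finset.univ.filter (fun p => p ≠ l ∧ p ≠ m ∧ x p = Sum.inr z) := by ext p; simp; tauto
  simp only [f1]
  have d1 : ∑ p with p ≠ l ∧ p ≠ m ∧ x p = Sum.inr q,
      perm lam nu (Equiv.swap m l * Equiv.swap p m) • f (Function.update Y p (Sum.inr s)) =
      ∑ p with p ≠ l ∧ p ≠ m ∧ x p = Sum.inr q,
      perm lam nu (Equiv.swap p m * Equiv.swap p l) • f (Function.update Y p (Sum.inr s)) := by
    refine Finset.sum_congr rfl fun p hp => ?_
    simp only [Finset.mem_filter, Finset.mem_univ, true_and] at hp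
    rw [c2 p hp.1 hp.2.1]
  have d2 : ∑ p with p ≠ l ∧ p ≠ m ∧ x p = Sum.inr r,
      perm lam nu (Equiv.swap l m * Equiv.swap p l) • f (Function.update Y p (Sum.inr u)) =
      ∑ p with p ≠ l ∧ p ≠ m ∧ x p = Sum.inr r,
      perm lam nu (Equiv.swap p l * Equiv.swap p m) • f (Function.update Y p (Sum.inr u)) := by
    refine Finset.sum_congr rfl fun p hp => ?_
    simp only [Finset.mem_filter, Finset.mem_univ, true_and] at hp
    rw [c2' p hp.1 hp.2.1]
  have d3 : ∑ p with p ≠ l ∧ p ≠ m ∧ x p = Sum.inr r,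
          ∑ p' with p' ≠ p ∧ p' ≠ l ∧ p' ≠ m ∧ x p' = Sum.inr q,
            perm lam nu (Equiv.swap p l * Equiv.swap p' m) •
              f (Function.update (Function.update Y p (Sum.inr s)) p' (Sum.inr u)) =
      ∑ p with p ≠ l ∧ p ≠ m ∧ x p = Sum.inr q,
          ∑ p' with p' ≠ p ∧ p' ≠ m ∧ p' ≠ l ∧ x p' = Sum.inr r,
            perm lam nu (Equiv.swap p m * Equiv.swap p' l) •
              f (Function.update (Function.update Y p (Sum.inr u)) p' (Sum.inr s)) := by
    rw [Finset.sum_comm' (t' := {p | p ≠ l ∧ p ≠ m ∧ x p = Sum.inr q})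
      (s' := fun p => {p' | p' ≠ p ∧ p' ≠ m ∧ p' ≠ l ∧ x p' = Sum.inr r})
      (by intro a b; simp; tauto)]
    refine Finset.sum_congr rfl fun p hp => Finset.sum_congr rfl fun p' hp' => ?_
    simp only [Finset.mem_filter, Finset.mem_univ, true_and] at hp hp'
    rw [Function.update_comm hp'.1, (Equiv.Perm.Disjoint.commute ?_).eq]
    exact Equiv.Perm.disjoint_swap_swap (by simp; tauto)
  rw [c1, d1, d2, d3, smul_comm (sgn k s.1) (sgn k u.1), Equiv.swap_comm m l]
  rw [ite_ite_swap (s = r) (u = q), ite_ite_swap (s = q) (u = r)]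
  simp only [smul_add nu]
  abel

theorem edgeOp_in (r : InEdge i) (l : Fin n) : edgeOp lam nu i V r.1 l = theta lam nu V r l := by
  rw [edgeOp, dif_pos r.2]

theorem edgeOp_out (hi : IsEmpty (i ⟶ i)) (r : InEdge i) (l : Fin n) :
    edgeOp lam nu i V (star r.1) l = sgn k r.1 • tauUp lam nu V r l := by
  have h1 : head (star r.1) ≠ i := by rw [head_star]; exact tail_ne hi r.2
  have h2 : tail (star r.1) = i := by rw [tail_star, r.2]
  have h3 : (⟨star (star r.1), (head_star _).trans h2⟩ : InEdge i) = r :=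
    Subtype.ext (star_star _)
  rw [edgeOp, dif_neg h1, dif_pos h2, h3, star_star]

theorem edgeOp_off (a : DEdge I) (h : head a ≠ i) (h' : tail a ≠ i) (l : Fin n) :
    edgeOp lam nu i V a l = letterOp (edge lam nu a l) l (Sum.inl (head a)) (Sum.inl (tail a)) := by
  rw [edgeOp, dif_neg h, dif_neg h']

theorem edge_cases (i : I) (a : DEdge I) : (∃ r : InEdge i, a = r.1) ∨ (∃ r : InEdge i, a = star r.1) ∨
    (head a ≠ i ∧ tail a ≠ i) := by
  by_cases h : head a = i
  · exact Or.inl ⟨⟨a, h⟩, rfl⟩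
  by_cases h' : tail a = i
  · exact Or.inr (Or.inl ⟨⟨star a, by rw [head_star, h']⟩, (star_star a).symm⟩)
  · exact Or.inr (Or.inr ⟨h, h'⟩)

theorem theta_letterOp (r : InEdge i) (l m : Fin n) (hlm : l ≠ m) (c : WAlg n lam nu) (w : I)
    (v : Letter i) (hc : c * edge lam nu r.1 l = edge lam nu r.1 l * c)
    (hc' : ∀ s : InEdge i, c * edge lam nu (star s.1) l = edge lam nu (star s.1) l * c)
    (hp : ∀ p, p ≠ m → c * perm lam nu (Equiv.swap p l) = perm lam nu (Equiv.swap p l) * c)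
    (f : Word n i → V) (x : Word n i) :
    letterOp c m (Sum.inl w) v (theta lam nu V r l f) x =
      theta lam nu V r l (letterOp c m (Sum.inl w) v f) x +
      if v = Sum.inr r ∧ x m = Sum.inl w ∧ (x l).isRight then
        nu • c • perm lam nu (Equiv.swap m l) •
          f (Function.update (Function.update x m (x l)) l (Sum.inl (tail r.1))) else 0 := by
  rcases hx : x l with v' | s
  · rw [letterOp_apply, theta_apply_inl _ _ _ _ v' hx,
      theta_apply_inl _ _ _ _ v' (by simp [hlm, hx])]
    simp
  have e0 : ∀ z : Word n i, z m ≠ Sum.inl w → letterOp c m (Sum.inl w) v f z = 0 :=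
    fun z hz => by rw [letterOp_apply, if_neg hz]
  have e1 : ∀ z : Word n i, z m = Sum.inl w →
      letterOp c m (Sum.inl w) v f z = c • f (Function.update z m v) :=
    fun z hz => by rw [letterOp_apply, if_pos hz]
  by_cases hxm : x m = Sum.inl w
  swap
  · rw [letterOp_apply, if_neg hxm, theta_apply_inr _ _ _ _ s hx, if_neg (c := _ ∧ _) (by tauto),
      e0 _ (by simp [hlm.symm, hxm]), Finset.sum_eq_zero]
    · simp
    · intro p _
      rw [e0, smul_zero]
      by_cases hpm : m = p
      · subst hpm; simp [hlm.symm]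
      · simp [hlm.symm, hpm, hxm]
  rw [letterOp_apply, if_pos hxm, theta_apply_inr _ _ _ _ s (by simp [hlm, hx]),
    theta_apply_inr _ _ _ _ s hx, smul_add, smul_add, add_assoc (_ + _), e1 _ (by simp [hlm.symm, hxm])]
  congr 1
  · rw [Function.update_comm hlm]
    congr 1
    · split_ifs
      · rw [smul_neg, smul_comm]
      · simp
    · rw [smul_comm c (sgn k _), smul_smul c, hc', mul_smul, smul_smul c, hc, mul_smul]
  · simp only [hxm, Sum.isRight_inr, and_true]
    rw [smul_comm c nu, ← smul_zero nu, ← smul_ite, ← smul_add]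
    congr 1
    rw [sum_split (fun p => p ≠ l ∧ Function.update x m v p = Sum.inr r) m (v = Sum.inr r)
      (by simp [hlm.symm]), sum_split (fun p => p ≠ l ∧ x p = Sum.inr r) m False (by simp [hxm]),
      if_neg not_false, zero_add, smul_add, add_comm]
    congr 1
    · rw [Finset.smul_sum]
      refine Finset.sum_congr ?_ fun p hp' => ?_
      · ext p
        simp only [Finset.mem_filter, Finset.mem_univ, true_and]
        exact and_congr_right fun h => by rw [Function.update_of_ne h]
      · simp only [Finset.mem_filter, Finset.mem_univ, true_and] at hp'
        rw [e1 _ (by simp [hlm.symm, hp'.1.symm, hxm]), smul_smul, hp p hp'.1,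
          mul_smul, Function.update_comm hlm, Function.update_comm hp'.1]
    · split_ifs
      · rw [Function.update_idem]
      · simp

variable (lam nu) in
/-- The commutation relation between `a'_ℓ` and `b'_m`. -/
def EdgeComm (f : Word n i → V) (a b : DEdge I) (l m : Fin n) : Prop :=
  edgeOp lam nu i V a l (edgeOp lam nu i V b m f) = edgeOp lam nu i V b m (edgeOp lam nu i V a l f) +
    if b = star a then -(sgn k a * nu) • permOp lam nu i V (Equiv.swap l m) f else 0

theorem EdgeComm.symm {f : Word n i → V} {a b : DEdge I} {l m : Fin n} (h : EdgeComm lam nu f a b l m) :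
    EdgeComm lam nu f b a m l := by
  unfold EdgeComm at *
  rw [h, Equiv.swap_comm m l, add_assoc, left_eq_add]
  by_cases hb : b = star a
  · rw [if_pos hb, if_pos (eq_star_comm.1 hb), hb, sgn_star, ← add_smul]
    simp
  · rw [if_neg hb, if_neg (fun e => hb (eq_star_comm.2 e)), add_zero]

theorem edgeComm (hi : IsEmpty (i ⟶ i)) {f : Word n i → V} (hf : f ∈ reflCarrier lam nu i V)
    (j : Fin n → I) (hj : ∀ x : Word n i, f x ≠ 0 → base ∘ x = j) (a b : DEdge I) (l m : Fin n)
    (hlm : l ≠ m) (ha : j l = tail a) (hb : j m = tail b) : EdgeComm lam nu f a b l m := by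
  have key {a b : DEdge I} {l m : Fin n} (hne : b ≠ star a)
    (h : edgeOp lam nu i V a l (edgeOp lam nu i V b m f) =
      edgeOp lam nu i V b m (edgeOp lam nu i V a l f)) : EdgeComm lam nu f a b l m := by
    rw [EdgeComm, h, if_neg hne, add_zero]
  have hin_off (r : InEdge i) (b : DEdge I) (h : head b ≠ i) (h' : tail b ≠ i) (l m : Fin n)
      (hlm : l ≠ m) : EdgeComm lam nu f r.1 b l m := by
    refine key (fun e => h' (by rw [e, tail_star, r.2])) ?_
    rw [edgeOp_in, edgeOp_off b h h']
    ext x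
    rw [theta_letterOp r l m hlm, if_neg (by simp), add_zero]
    · refine edge_comm _ _ _ _ hlm.symm _ _ fun e => h' ?_
      rw [← head_star, ← e, r.2]
    · refine fun s => edge_comm _ _ _ _ hlm.symm _ _ fun e => h ?_
      rw [← star_star b, ← e, star_star, s.2]
    · intro p hp
      rw [perm_edge, Equiv.swap_apply_of_ne_of_ne hp.symm hlm.symm]
  have hin_out (r q : InEdge i) (l m : Fin n) (hlm : l ≠ m) (ha : j l = tail r.1) (hb : j m = i) :
      EdgeComm lam nu f r.1 (star q.1) l m := by
    unfold EdgeComm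
    rw [edgeOp_in, edgeOp_out hi, LinearMap.smul_apply, LinearMap.smul_apply, map_smul]
    ext x
    simp only [Pi.add_apply, Pi.smul_apply, tauUp]
    rw [theta_letterOp r l m hlm _ _ _ (by simp) (by simp) (by simp), smul_add, add_assoc,
      left_eq_add]
    by_cases hqr : q = r
    · subst hqr
      simp only [true_and, if_true, Pi.smul_apply, permOp_apply, one_smul]
      by_cases hx : x m = Sum.inl (tail q.1) ∧ (x l).isRight
      · have := Function.update_eq_self l (x ∘ Equiv.swap m l)
        rw [show (x ∘ Equiv.swap m l) l = Sum.inl (tail q.1) by simp [hx.1]] at this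
        rw [if_pos hx, ← comp_swap_update x m l _ hlm.symm, Equiv.swap_comm l m, smul_smul (sgn k _),
          this, ← add_smul, add_neg_cancel, zero_smul]
      · rw [if_neg hx, smul_zero, zero_add]
        by_cases hfx : f (x ∘ Equiv.swap l m) = 0
        · simp [hfx]
        exfalso
        have h0 := hj _ hfx
        have h1 := congrFun h0 l
        have h2 := congrFun h0 m
        simp only [Function.comp_apply, Equiv.swap_apply_left, Equiv.swap_apply_right] at h1 h2
        rw [ha] at h1
        rw [hb] at h2
        refine hx ⟨?_, ?_⟩
        · rcases hxm : x m with v | s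
          · rw [hxm] at h1; exact congrArg _ h1
          · rw [hxm] at h1; exact absurd h1.symm (tail_ne hi q.2)
        · rcases hxl : x l with v | s
          · exfalso
            rw [hxl] at h2
            exact hfx (hf.2.1 _ m (by simp [hxl]; exact h2))
          · rfl
    · rw [if_neg (fun e => hqr (Sum.inr.inj e.1)), if_neg (fun e => hqr (Subtype.ext (by
        rw [← star_star q.1, e, star_star])))]
      simp
  have hout_off (r : InEdge i) (b : DEdge I) (h : head b ≠ i) (h' : tail b ≠ i) (l m : Fin n)
      (hlm : l ≠ m) : EdgeComm lam nu f (star r.1) b l m := by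
    refine key (fun e => h (by rw [e, star_star, r.2])) ?_
    rw [edgeOp_out hi, edgeOp_off b h h', LinearMap.smul_apply, LinearMap.smul_apply, map_smul, tauUp,
      letterOp_comm _ _ (by simp) _ _ hlm]
  rcases edge_cases i a with ⟨r, rfl⟩ | ⟨r, rfl⟩ | ⟨h1, h1'⟩ <;>
    rcases edge_cases i b with ⟨q, rfl⟩ | ⟨q, rfl⟩ | ⟨h2, h2'⟩
  · refine key (fun e => tail_ne hi r.2 ?_) ?_
    · rw [← head_star, ← e, q.2]
    · rw [edgeOp_in, edgeOp_in, theta_comm hi hf.1 r q l m hlm]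
  · exact hin_out r q l m hlm ha (by rw [hb, tail_star, q.2])
  · exact hin_off r b h2 h2' l m hlm
  · exact (hin_out q r m l hlm.symm hb (by rw [ha, tail_star, r.2])).symm
  · refine key (fun e => tail_ne hi q.2 ?_) ?_
    · rw [← head_star, e, star_star, r.2]
    · rw [edgeOp_out hi, edgeOp_out hi, LinearMap.smul_apply, LinearMap.smul_apply,
        LinearMap.smul_apply, LinearMap.smul_apply, map_smul, map_smul, tauUp, tauUp,
        letterOp_comm _ _ (by simp) _ _ hlm, smul_comm]
  · exact hout_off r b h2 h2' l m hlm
  · exact (hin_off q a h1 h1' m l hlm.symm).symm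
  · exact (hout_off q a h1 h1' m l hlm.symm).symm
  · unfold EdgeComm
    rw [edgeOp_off a h1 h1', edgeOp_off b h2 h2']
    ext x
    simp only [letterOp_apply, Pi.add_apply, Function.update_of_ne hlm, Function.update_of_ne hlm.symm]
    by_cases hx : x l = Sum.inl (head a) ∧ x m = Sum.inl (head b)
    · rw [if_pos hx.1, if_pos hx.2, if_pos hx.2, if_pos hx.1, Function.update_comm hlm.symm,
        rel_ii_mod _ _ (hf.1 _) l m hlm a b (by simp [src, hlm]) (by simp [src])]
      congr 1
      by_cases hba : b = star a
      · rw [if_pos hba, if_pos hba, Pi.smul_apply, permOp_apply]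
        congr 3
        rw [hba, tail_star, ← hx.1, ← head_star, ← hba, ← hx.2]
        ext q
        simp only [Function.comp_apply, Equiv.swap_apply_def]
        by_cases hq : q = m
        · subst hq; simp [hlm.symm]
        · by_cases hq' : q = l
          · subst hq'; simp [hlm]
          · simp [hq, hq']
      · rw [if_neg hba, if_neg hba]; rfl
    · have e : (if b = star a then -(sgn k a * nu) • permOp lam nu i V (Equiv.swap l m) f else 0) x =
          0 := by
        by_cases hba : b = star a
        · rw [if_pos hba, Pi.smul_apply, permOp_apply]
          by_cases hfx : f (x ∘ Equiv.swap l m) = 0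
          · simp [hfx]
          exfalso
          have h0 := hj _ hfx
          have e1 := congrFun h0 l
          have e2 := congrFun h0 m
          simp only [Function.comp_apply, Equiv.swap_apply_left, Equiv.swap_apply_right] at e1 e2
          rw [ha] at e1
          rw [hb] at e2
          refine hx ⟨?_, ?_⟩
          · rcases hxl : x l with v | s
            · rw [hxl] at e2; rw [hba, tail_star] at e2; exact congrArg _ e2
            · rw [hxl] at e2; exact absurd e2.symm h2'
          · rcases hxm : x m with v | s
            · rw [hxm] at e1; rw [hba, head_star]; exact congrArg _ e1
            · rw [hxm] at e1; exact absurd e1.symm h1'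
        · rw [if_neg hba]; rfl
      rw [e, add_zero]
      by_cases hx1 : x l = Sum.inl (head a)
      · have hx2 : ¬x m = Sum.inl (head b) := fun h => hx ⟨hx1, h⟩
        simp [hx2]
      · simp [hx1]

theorem symForm_single (i v : I) : symForm (Pi.single i 1) (Pi.single v 1) =
    (if v = i then 2 else 0) - ∑ a : DEdge I, if head a = i ∧ tail a = v then 1 else 0 := by
  have h1 (a b : I) (x : Quiver.Total I) :
      (Pi.single a 1 : I → ℤ) x.left * (Pi.single b 1 : I → ℤ) x.right =
      if x.right = b ∧ x.left = a then 1 else 0 := by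
    simp only [Pi.single_apply]
    split_ifs <;> simp_all
  have h2 (a b : I) : ∑ j, (Pi.single a 1 : I → ℤ) j * (Pi.single b 1 : I → ℤ) j =
      if b = a then 1 else 0 := by
    simp [Pi.single_apply, eq_comm]
  rw [symForm, ringelForm, ringelForm, Fintype.sum_sum_type]
  have e1 : ∑ a : Quiver.Total I, (if head (Sum.inl a) = i ∧ tail (Sum.inl a) = v then (1 : ℤ) else 0) =
      ∑ a : Quiver.Total I, if a.right = i ∧ a.left = v then 1 else 0 :=
    Finset.sum_congr rfl fun a _ => if_congr Iff.rfl rfl rfl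
  have e2 : ∑ a : Quiver.Total I, (if head (Sum.inr a) = i ∧ tail (Sum.inr a) = v then (1 : ℤ) else 0) =
      ∑ a : Quiver.Total I, if a.right = v ∧ a.left = i then 1 else 0 :=
    Finset.sum_congr rfl fun a _ => if_congr and_comm rfl rfl
  simp only [h1, h2, e1, e2]
  simp only [eq_comm (a := i) (b := v)]
  split_ifs <;> ring

theorem reflect_self (hi : IsEmpty (i ⟶ i)) : reflect i lam i = -lam i := by
  rw [reflect, symForm_single, Finset.sum_eq_zero]
  · simp only [if_true, sub_zero, two_smul]; abel
  · intro a _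
    rw [if_neg]
    rintro ⟨h, h'⟩
    exact tail_ne hi h h'

theorem reflect_of_ne {v : I} (hv : v ≠ i) : reflect i lam v =
    lam v + ∑ r : InEdge i, if tail r.1 = v then lam i else 0 := by
  rw [reflect, symForm_single, if_neg hv, zero_sub, neg_smul, sub_neg_eq_add, Finset.sum_smul,
    sum_inEdge fun a => if tail a = v then lam i else 0, Finset.sum_filter]
  congr 1
  refine Finset.sum_congr rfl fun a _ => ?_
  split_ifs <;> simp_all

/-- The reflection is an involution. -/
theorem reflect_reflect (hi : IsEmpty (i ⟶ i)) (lam : I → k) : reflect i (reflect i lam) = lam := by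
  ext v
  by_cases hv : v = i
  · subst hv; rw [reflect_self hi, reflect_self hi, neg_neg]
  · rw [reflect_of_ne hv, reflect_of_ne hv, reflect_self hi, add_assoc, ← Finset.sum_add_distrib,
      Finset.sum_eq_zero, add_zero]
    intro r _
    split_ifs <;> simp

theorem edgeOp_apply_ne (hi : IsEmpty (i ⟶ i)) (a : DEdge I) (l : Fin n) (f : Word n i → V)
    (x : Word n i) (h : head a ≠ base (x l)) : edgeOp lam nu i V a l f x = 0 := by
  rcases edge_cases i a with ⟨r, rfl⟩ | ⟨r, rfl⟩ | ⟨h1, h1'⟩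
  · rcases hx : x l with v | s
    · rw [edgeOp_in, theta_apply_inl _ _ _ _ v hx]
    · rw [hx] at h; exact absurd r.2 h
  · rw [edgeOp_out hi, LinearMap.smul_apply, Pi.smul_apply, tauUp, letterOp_apply, if_neg, smul_zero]
    intro e
    rw [e, head_star] at h
    exact h rfl
  · rw [edgeOp_off a h1 h1', letterOp_apply, if_neg]
    intro e
    rw [e] at h
    exact h rfl

theorem edge_sum_inr (hi : IsEmpty (i ⟶ i)) {f : Word n i → V} (hf : f ∈ reflCarrier lam nu i V)
    (l : Fin n) (x : Word n i) (s : InEdge i) (hs : x l = Sum.inr s) :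
    ∑ a : DEdge I, sgn k a • edgeOp lam nu i V a l (edgeOp lam nu i V (star a) l f) x =
      -(lam i • f x) + nu • ∑ m with m ≠ l ∧ base (x m) = i,
        perm lam nu (Equiv.swap l m) • f (x ∘ Equiv.swap l m) := by
  have h1 : ∑ a : DEdge I, sgn k a • edgeOp lam nu i V a l (edgeOp lam nu i V (star a) l f) x =
      ∑ r : InEdge i, sgn k r.1 • edgeOp lam nu i V r.1 l (edgeOp lam nu i V (star r.1) l f) x := by
    rw [sum_inEdge fun a => sgn k a • edgeOp lam nu i V a l (edgeOp lam nu i V (star a) l f) x,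
      Finset.sum_filter]
    refine Finset.sum_congr rfl fun a _ => ?_
    split_ifs with h
    · rfl
    · rw [edgeOp_apply_ne hi _ _ _ _ (by rw [hs]; exact h), smul_zero]
  have ht (r : InEdge i) (z : Word n i) :
      tauUp lam nu V r l f (Function.update z l (Sum.inl (tail r.1))) =
        f (Function.update z l (Sum.inr r)) := by
    rw [tauUp, letterOp_apply, if_pos (by simp), Function.update_idem, one_smul]
  have h2 (r : InEdge i) :
      sgn k r.1 • edgeOp lam nu i V r.1 l (edgeOp lam nu i V (star r.1) l f) x =
      (if s = r then -(lam i • f x) else 0) +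
      sgn k s.1 • edge lam nu (star s.1) l • edge lam nu r.1 l •
        f (Function.update x l (Sum.inr r)) +
      nu • ∑ m with m ≠ l ∧ x m = Sum.inr r, perm lam nu (Equiv.swap l m) •
        f (x ∘ Equiv.swap l m) := by
    rw [edgeOp_in, edgeOp_out hi, LinearMap.smul_apply, map_smul, Pi.smul_apply, smul_smul,
      sgn_mul_self, one_smul, theta_apply_inr _ _ _ _ s hs, ht]
    congr 1
    · congr 1
      by_cases h : s = r
      · rw [if_pos h, if_pos h, ← h, ← hs, Function.update_eq_self]
      · rw [if_neg h, if_neg h]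
    · congr 1
      refine Finset.sum_congr rfl fun m hm => ?_
      simp only [Finset.mem_filter, Finset.mem_univ, true_and] at hm
      rw [ht, ← hs, ← comp_swap_update x m l _ hm.1, Equiv.swap_comm l m]
      have := Function.update_eq_self l (x ∘ Equiv.swap m l)
      rw [show (x ∘ Equiv.swap m l) l = Sum.inr r by simp [hm.2]] at this
      rw [this]
  rw [h1]
  simp only [h2, Finset.sum_add_distrib, ← Finset.smul_sum, ker_eq hf l x]
  rw [smul_zero, smul_zero, add_zero]
  congr 1
  · simp
  · congr 1
    simp only [Finset.sum_filter]
    rw [Finset.sum_comm]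
    refine Finset.sum_congr rfl fun m _ => ?_
    by_cases hml : m = l
    · simp [hml]
    rcases hm : x m with v | q
    · by_cases hv : v = i
      · rw [hf.2.1 (x ∘ Equiv.swap l m) l (by simp [hm, hv])]
        simp
      · simp [base, hv]
    · simp [base, hml]

theorem edge_sum_inl (hi : IsEmpty (i ⟶ i)) {f : Word n i → V} (hf : f ∈ reflCarrier lam nu i V)
    (l : Fin n) (x : Word n i) (v : I) (hs : x l = Sum.inl v) (hv : v ≠ i) :
    ∑ a : DEdge I, sgn k a • edgeOp lam nu i V a l (edgeOp lam nu i V (star a) l f) x =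
      reflect i lam v • f x + nu • ∑ m with m ≠ l ∧ base (x m) = v,
        perm lam nu (Equiv.swap l m) • f (x ∘ Equiv.swap l m) := by
  have h2 (a : DEdge I) (ha : head a = v) :
      sgn k a • edgeOp lam nu i V a l (edgeOp lam nu i V (star a) l f) x =
      sgn k a • edge lam nu a l • edge lam nu (star a) l • f x +
      ∑ r : InEdge i, if r.1 = star a then lam i • f x -
        nu • ∑ m with m ≠ l ∧ x m = Sum.inr r, perm lam nu (Equiv.swap l m) • f x else 0 := by
    rcases edge_cases i a with ⟨r, rfl⟩ | ⟨r, rfl⟩ | ⟨h1, h1'⟩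
    · exact absurd (ha.symm.trans r.2) hv
    · rw [head_star] at ha
      rw [star_star, edgeOp_out hi, edgeOp_in, LinearMap.smul_apply, Pi.smul_apply, smul_smul,
        sgn_star, neg_mul, sgn_mul_self, tauUp, letterOp_apply, if_pos (by rw [hs, ha]), one_smul,
        theta_apply_inr _ _ _ _ r (by simp), Finset.sum_eq_single r]
      · rw [if_pos rfl, if_pos rfl]
        have e : Function.update x l (Sum.inl (tail r.1)) = x := by
          rw [ha, ← hs, Function.update_eq_self]
        rw [Function.update_idem, e, neg_smul, one_smul, neg_add, neg_add, neg_neg, neg_smul]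
        have e2 : ∑ m with m ≠ l ∧ Function.update x l (Sum.inr r) m = Sum.inr r,
            perm lam nu (Equiv.swap m l) • f (Function.update (Function.update (Function.update x l
              (Sum.inr r)) m (Sum.inr r)) l (Sum.inl (tail r.1))) =
            ∑ m with m ≠ l ∧ x m = Sum.inr r, perm lam nu (Equiv.swap l m) • f x := by
          rw [Finset.sum_filter, Finset.sum_filter]
          refine Finset.sum_congr rfl fun m _ => ?_
          by_cases hml : m = l
          · simp [hml]
          by_cases hm : x m = Sum.inr r
          · rw [if_pos (by simp [hml, hm]), if_pos ⟨hml, hm⟩, Equiv.swap_comm m l,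
              Function.update_comm hml, Function.update_idem, ← hm, e, Function.update_eq_self]
          · simp [hml, hm]
        rw [e2]
        abel
      · intro q _ hq
        rw [if_neg (fun e => hq (Subtype.ext e))]
      · simp
    · rw [Finset.sum_eq_zero, add_zero]
      · rw [edgeOp_off a h1 h1', edgeOp_off (star a) (by rwa [head_star]) (by rwa [tail_star]),
          letterOp_apply, if_pos (by rw [hs, ha]), letterOp_apply, if_pos (by simp [head_star]),
          Function.update_idem, tail_star, ha, ← hs, Function.update_eq_self]
      · intro r _
        rw [if_neg]
        intro e
        exact h1' (by rw [← head_star, ← e, r.2])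
  have h3 : ∑ a : DEdge I, sgn k a • edgeOp lam nu i V a l (edgeOp lam nu i V (star a) l f) x =
      ∑ a with head a = v, (sgn k a • edge lam nu a l • edge lam nu (star a) l • f x +
      ∑ r : InEdge i, if r.1 = star a then lam i • f x -
        nu • ∑ m with m ≠ l ∧ x m = Sum.inr r, perm lam nu (Equiv.swap l m) • f x else 0) := by
    rw [Finset.sum_filter]
    refine Finset.sum_congr rfl fun a _ => ?_
    split_ifs with h
    · exact h2 a h
    · rw [edgeOp_apply_ne hi _ _ _ _ (by rw [hs]; exact h), smul_zero]
  have h4 := rel_i_mod _ _ (hf.1 x) l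
  have hsl : (src ∘ x) l = v := by simp [hs, src]
  rw [hsl] at h4
  have h5 : ∑ a : DEdge I with head a = v, ∑ r : InEdge i, (if r.1 = star a then lam i • f x -
        nu • ∑ m with m ≠ l ∧ x m = Sum.inr r, perm lam nu (Equiv.swap l m) • f x else 0) =
      ∑ r : InEdge i, if tail r.1 = v then lam i • f x -
        nu • ∑ m with m ≠ l ∧ x m = Sum.inr r, perm lam nu (Equiv.swap l m) • f x else 0 := by
    rw [Finset.sum_comm]
    refine Finset.sum_congr rfl fun r _ => ?_
    rw [Finset.sum_filter, Finset.sum_eq_single (star r.1)]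
    · rw [head_star, star_star, if_pos rfl]
    · intro b _ hb
      rw [if_neg (c := r.1 = star b) (fun e => hb (eq_star_comm.1 e)), ite_self]
    · simp
  rw [h3, Finset.sum_add_distrib, h4, h5, reflect_of_ne hv, add_smul, Finset.sum_smul]
  have h6 : (∑ r : InEdge i, if tail r.1 = v then lam i • f x -
        nu • ∑ m with m ≠ l ∧ x m = Sum.inr r, perm lam nu (Equiv.swap l m) • f x else 0) =
      (∑ r : InEdge i, (if tail r.1 = v then lam i else 0) • f x) -
      nu • ∑ m with m ≠ l, ∑ r : InEdge i, if tail r.1 = v ∧ x m = Sum.inr r then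
        perm lam nu (Equiv.swap l m) • f x else 0 := by
    rw [Finset.sum_comm, Finset.smul_sum, ← Finset.sum_sub_distrib]
    refine Finset.sum_congr rfl fun r _ => ?_
    split_ifs with h
    · congr 2
      simp only [h, true_and, Finset.sum_filter, ite_and]
    · simp [h]
  have h7 : ∑ m with m ≠ l ∧ (src ∘ x) m = v, perm lam nu (Equiv.swap l m) • f x =
      (∑ m with m ≠ l, ∑ r : InEdge i, if tail r.1 = v ∧ x m = Sum.inr r then
        perm lam nu (Equiv.swap l m) • f x else 0) + ∑ m with m ≠ l ∧ base (x m) = v,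
        perm lam nu (Equiv.swap l m) • f (x ∘ Equiv.swap l m) := by
    simp only [Finset.sum_filter, ite_and]
    rw [← Finset.sum_add_distrib]
    refine Finset.sum_congr rfl fun m _ => ?_
    by_cases hml : m = l
    · simp [hml]
    rw [if_pos hml, if_pos hml, if_pos hml]
    rcases hm : x m with w | q
    · have : v = w → x ∘ Equiv.swap l m = x := by
        rintro rfl
        ext q
        simp only [Function.comp_apply, Equiv.swap_apply_def]
        split_ifs with h h'
        · rw [hm, h, hs]
        · rw [hs, h', hm]
        · rfl
      by_cases hw : w = v
      · simp [src, base, hm, hw, this hw.symm]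
      · simp [src, base, hm, hw]
    · simp [src, base, hm, hv.symm]
      rw [Finset.sum_eq_single q] <;> simp +contextual [eq_comm]
  rw [h6, h7, smul_add]
  abel

theorem edge_sum (hi : IsEmpty (i ⟶ i)) {f : Word n i → V} (hf : f ∈ reflCarrier lam nu i V)
    (l : Fin n) (x : Word n i) :
    ∑ a : DEdge I, sgn k a • edgeOp lam nu i V a l (edgeOp lam nu i V (star a) l f) x =
      reflect i lam (base (x l)) • f x + nu • ∑ m with m ≠ l ∧ base (x m) = base (x l),
        perm lam nu (Equiv.swap l m) • f (x ∘ Equiv.swap l m) := by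
  rcases hx : x l with v | s
  · by_cases hv : v = i
    · subst hv
      rw [hf.2.1 x l hx, Finset.sum_eq_zero, Finset.sum_eq_zero]
      · simp
      · intro m _
        rw [hf.2.1 _ m (by simp [hx]), smul_zero]
      · intro a _
        rw [(edgeOp_mem hi (edgeOp_mem hi hf (star a) l) a l).2.1 x l hx, smul_zero]
    · exact edge_sum_inl hi hf l x v hx hv
  · rw [edge_sum_inr hi hf l x s hx, show base (Sum.inr s) = i from rfl, reflect_self hi, neg_smul]

variable (lam nu i V) in
/-- The action of the generators on `F_i(V) = V'`. -/
noncomputable def genAction (hi : IsEmpty (i ⟶ i)) : Gen I n → Module.End k (reflCarrier (n := n) lam nu i V)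
  | Gen.idem j => (idemOp i j).restrict fun _ hf => idemOp_mem hf j
  | Gen.edge a l => (edgeOp lam nu i V a l).restrict fun _ hf => edgeOp_mem hi hf a l
  | Gen.perm s => (permOp lam nu i V s).restrict fun _ hf => permOp_mem hf s

theorem base_swap (x : Word n i) (l m : Fin n) (j : Fin n → I) (h : j m = j l) :
    base ∘ (x ∘ Equiv.swap l m) = j ↔ base ∘ x = j := by
  have : j ∘ Equiv.swap l m = j := by
    ext q
    simp only [Function.comp_apply, Equiv.swap_apply_def]
    split_ifs with h1 h2
    · rw [h, h1]
    · rw [h2, h]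
    · rfl
  rw [← Function.comp_assoc]
  constructor
  · intro e
    have e' := congrArg (· ∘ Equiv.swap l m) e
    simp only [Function.comp_assoc, this] at e'
    rw [← e']
    ext q; simp
  · rintro e
    rw [e, this]

theorem idemOp_edge_sum (hi : IsEmpty (i ⟶ i)) {f : Word n i → V} (hf : f ∈ reflCarrier lam nu i V)
    (l : Fin n) (j : Fin n → I) :
    ∑ a : DEdge I, sgn k a • edgeOp lam nu i V a l (edgeOp lam nu i V (star a) l
        (idemOp (k := k) i j f)) =
      reflect i lam (j l) • idemOp (k := k) i j f + nu • ∑ m with m ≠ l ∧ j m = j l,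
        permOp lam nu i V (Equiv.swap l m) (idemOp (k := k) i j f) := by
  ext x
  have := edge_sum hi (idemOp_mem hf j) l x
  simp only [Finset.sum_apply, Pi.add_apply, Pi.smul_apply, permOp_apply]
  rw [this]
  by_cases hx : base ∘ x = j
  · subst hx; rfl
  · have e (m : Fin n) (h : j m = j l) : idemOp (k := k) i j f (x ∘ Equiv.swap l m) = 0 := by
      rw [idemOp_apply, if_neg]
      rwa [base_swap _ _ _ _ h]
    have e' (m : Fin n) (h : base (x m) = base (x l)) :
        idemOp (k := k) i j f (x ∘ Equiv.swap l m) = 0 := by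
      rw [idemOp_apply, if_neg]
      intro h'
      apply hx
      rw [← h']
      exact ((base_swap x l m (base ∘ x) h).2 rfl).symm
    rw [show idemOp (k := k) i j f x = 0 by rw [idemOp_apply, if_neg hx], Finset.sum_eq_zero,
      Finset.sum_eq_zero]
    · simp
    · intro m hm
      rw [e m (Finset.mem_filter.1 hm).2.2, smul_zero]
    · intro m hm
      rw [e' m (Finset.mem_filter.1 hm).2.2, smul_zero]

theorem idemOp_idemOp (j : Fin n → I) (f : Word n i → V) :
    idemOp (k := k) i j (idemOp (k := k) i j f) = idemOp (k := k) i j f := by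
  ext x
  simp only [idemOp_apply]
  split_ifs <;> rfl

theorem genAction_rel (hi : IsEmpty (i ⟶ i)) {x y : FreeAlgebra k (Gen I n)}
    (h : Rel n (reflect i lam) nu x y) :
    FreeAlgebra.lift k (genAction lam nu i V hi) x = FreeAlgebra.lift k (genAction lam nu i V hi) y := by
  have hI (j : Fin n → I) (f : reflCarrier (n := n) lam nu i V) :
      (genAction lam nu i V hi (Gen.idem j) f).1 = idemOp (k := k) i j f.1 := rfl
  have hE (a : DEdge I) (l : Fin n) (f : reflCarrier (n := n) lam nu i V) :
      (genAction lam nu i V hi (Gen.edge a l) f).1 = edgeOp lam nu i V a l f.1 := rfl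
  have hP (s : Equiv.Perm (Fin n)) (f : reflCarrier (n := n) lam nu i V) :
      (genAction lam nu i V hi (Gen.perm s) f).1 = permOp lam nu i V s f.1 := rfl
  refine LinearMap.ext fun f => Subtype.ext ?_
  cases h with
  | idem_mul_self j =>
    simp only [map_mul, FreeAlgebra.lift_ι_apply, Module.End.mul_apply, hI, idemOp_idemOp]
  | idem_mul_ne j j' h =>
    simp only [map_mul, FreeAlgebra.lift_ι_apply, Module.End.mul_apply, hI, map_zero]
    ext x
    simp only [idemOp_apply]
    split_ifs with h1 h2
    · exact absurd (h1.symm.trans h2) h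
    · rfl
    · rfl
  | sum_idem =>
    simp only [map_sum, FreeAlgebra.lift_ι_apply, map_one, LinearMap.sum_apply,
      AddSubmonoidClass.coe_finsetSum, hI, Module.End.one_apply]
    ext x
    simp [Finset.sum_apply, idemOp_apply]
  | edge_idem a l j h =>
    simp only [map_mul, FreeAlgebra.lift_ι_apply, Module.End.mul_apply, hI, hE, edgeOp_idemOp _ _ _ h]
  | edge_idem_ne a l j h =>
    simp only [map_mul, FreeAlgebra.lift_ι_apply, Module.End.mul_apply, hI, hE,
      edgeOp_idemOp_ne _ _ _ h, map_zero]
    rfl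
  | perm_one =>
    simp only [FreeAlgebra.lift_ι_apply, map_one, hP, Module.End.one_apply]
    ext x
    rw [permOp_apply, perm_one, one_smul]
    rfl
  | perm_mul s s' =>
    simp only [map_mul, FreeAlgebra.lift_ι_apply, Module.End.mul_apply, hP, permOp_mul]
  | perm_idem s j =>
    simp only [map_mul, FreeAlgebra.lift_ι_apply, Module.End.mul_apply, hP, hI]
    ext x
    simp only [permOp_apply, idemOp_apply]
    have : base ∘ (x ∘ s) = j ↔ base ∘ x = j ∘ s.symm := by
      rw [Equiv.eq_comp_symm, Function.comp_assoc]
    simp only [this]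
    split_ifs <;> simp
  | perm_edge s a l =>
    simp only [map_mul, FreeAlgebra.lift_ι_apply, Module.End.mul_apply, hP, hE, permOp_edgeOp]
  | rel_i l j =>
    have e := idemOp_edge_sum hi f.2 l j
    rw [Fintype.sum_sum_type] at e
    simp only [map_mul, map_sub, map_sum, map_smul, AlgHom.commutes, FreeAlgebra.lift_ι_apply,
      Module.End.mul_apply, LinearMap.sub_apply, LinearMap.sum_apply, LinearMap.smul_apply,
      AddSubgroupClass.coe_sub, AddSubmonoidClass.coe_finsetSum, Submodule.coe_smul, hE, hI, hP,
      Module.algebraMap_end_apply]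
    rw [sub_eq_iff_eq_add', ← e, Finset.sum_sub_distrib, sub_eq_add_neg, ← Finset.sum_neg_distrib]
    simp [sgn, star]
  | rel_ii l m hlm a b j ha hb =>
    have hj : ∀ x : Word n i, idemOp (k := k) i j f.1 x ≠ 0 → base ∘ x = j := by
      intro x hx
      by_contra h
      exact hx (by rw [idemOp_apply, if_neg h])
    have e := edgeComm hi (idemOp_mem f.2 j) j hj a b l m hlm ha hb
    rw [EdgeComm] at e
    simp only [map_mul, map_sub, FreeAlgebra.lift_ι_apply,
      Module.End.mul_apply, LinearMap.sub_apply, AddSubgroupClass.coe_sub, hE, hI]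
    rw [← edgeOp_idemOp _ _ _ hb, ← edgeOp_idemOp _ _ _ ha, idemOp_idemOp, e, add_sub_cancel_left]
    split_ifs
    · simp only [map_smul, map_mul, FreeAlgebra.lift_ι_apply, LinearMap.smul_apply,
        Module.End.mul_apply, Submodule.coe_smul, hP, hI]
    · simp

variable (V) in
/-- The action of `𝒜_{n,r_iλ,ν}` on `F_i(V)`; the parameter `r_iλ` is called `lam'`. -/
noncomputable def reflHom (hi : IsEmpty (i ⟶ i)) {lam' : I → k} (h : lam' = reflect i lam) :
    WAlg n lam' nu →ₐ[k] Module.End k (reflCarrier (n := n) lam nu i V) :=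
  RingQuot.liftAlgHom k ⟨FreeAlgebra.lift k (genAction lam nu i V hi), fun _ _ hxy =>
    genAction_rel hi (by rwa [h] at hxy)⟩

theorem reflHom_mk (hi : IsEmpty (i ⟶ i)) {lam' : I → k} (h : lam' = reflect i lam)
    (x : FreeAlgebra k (Gen I n)) : reflHom V hi h (mk n lam' nu x) =
      FreeAlgebra.lift k (genAction lam nu i V hi) x :=
  RingQuot.liftAlgHom_mkAlgHom_apply _ _ _ _

variable (nu V) in
/-- The module `F_i(V)` over `𝒜_{n,r_iλ,ν}`; the parameter `r_iλ` is called `lam'`. -/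
def ReflObj (n : ℕ) (_ : IsEmpty (i ⟶ i)) {lam lam' : I → k} (_ : lam' = reflect i lam)
    [Module (WAlg n lam nu) V] [IsScalarTower k (WAlg n lam nu) V] : Type w :=
  reflCarrier (n := n) lam nu i V

noncomputable instance (hi : IsEmpty (i ⟶ i)) {lam' : I → k} (h : lam' = reflect i lam) :
    AddCommGroup (ReflObj nu V n hi h) :=
  inferInstanceAs (AddCommGroup (reflCarrier (n := n) lam nu i V))

noncomputable instance (hi : IsEmpty (i ⟶ i)) {lam' : I → k} (h : lam' = reflect i lam) :
    Module k (ReflObj nu V n hi h) :=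
  inferInstanceAs (Module k (reflCarrier (n := n) lam nu i V))

noncomputable instance (hi : IsEmpty (i ⟶ i)) {lam' : I → k} (h : lam' = reflect i lam) :
    Module (WAlg n lam' nu) (ReflObj nu V n hi h) :=
  Module.compHom (reflCarrier (n := n) lam nu i V) (reflHom V hi h).toRingHom

section Map

variable {W : Type w} [AddCommGroup W] [Module k W] [Module (WAlg n lam nu) W]
variable [IsScalarTower k (WAlg n lam nu) W] (g : V →ₗ[WAlg n lam nu] W)

/-- The map induced by a homomorphism on `⨁ V(j, D)`. -/
noncomputable def wordMap (i : I) : (Word n i → V) →ₗ[k] (Word n i → W) :=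
  (g.restrictScalars k).compLeft (Word n i)

theorem wordMap_apply (f : Word n i → V) (x : Word n i) : wordMap g i f x = g (f x) := rfl

theorem wordMap_letterOp (c : WAlg n lam nu) (l : Fin n) (u v : Letter i) (f : Word n i → V) :
    wordMap g i (letterOp c l u v f) = letterOp c l u v (wordMap g i f) := by
  ext x
  simp only [wordMap_apply, letterOp_apply]
  split_ifs <;> simp

theorem wordMap_permOp (s : Equiv.Perm (Fin n)) (f : Word n i → V) :
    wordMap g i (permOp lam nu i V s f) = permOp lam nu i W s (wordMap g i f) := by
  ext x
  simp [wordMap_apply, permOp_apply]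

theorem wordMap_piOp (p : Fin n) (f : Word n i → V) :
    wordMap g i (piOp lam nu i V p f) = piOp lam nu i W p (wordMap g i f) := by
  simp only [piOp, LinearMap.sum_apply, map_sum, wordMap_letterOp]

theorem wordMap_theta (r : InEdge i) (l : Fin n) (f : Word n i → V) :
    wordMap g i (theta lam nu V r l f) = theta lam nu W r l (wordMap g i f) := by
  have h (f : Word n i → V) : wordMap g i (swapOp lam nu i V l f) =
      swapOp lam nu i W l (wordMap g i f) := by
    ext x
    simp [wordMap_apply, swapOp_apply]
  simp only [theta, LinearMap.comp_apply, LinearMap.add_apply, LinearMap.smul_apply, map_add, map_smul,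
    muOp, LinearMap.sum_apply, map_sum, wordMap_letterOp, wordMap_piOp, tauDown, LinearMap.id_apply, h]

theorem wordMap_edgeOp (a : DEdge I) (l : Fin n) (f : Word n i → V) :
    wordMap g i (edgeOp lam nu i V a l f) = edgeOp lam nu i W a l (wordMap g i f) := by
  unfold edgeOp
  split_ifs
  · exact wordMap_theta _ _ _ _
  · simp only [LinearMap.smul_apply, map_smul, tauUp, wordMap_letterOp]
  · exact wordMap_letterOp _ _ _ _ _ _

theorem wordMap_mem {f : Word n i → V} (hf : f ∈ reflCarrier lam nu i V) :
    wordMap g i f ∈ reflCarrier lam nu i W := by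
  refine ⟨fun x => ?_, fun x m h => ?_, fun p => ?_⟩
  · rw [wordMap_apply, ← map_smul, hf.1]
  · rw [wordMap_apply, hf.2.1 x m h, map_zero]
  · rw [← wordMap_piOp, hf.2.2, map_zero]

theorem wordMap_lift (hi : IsEmpty (i ⟶ i)) (c : FreeAlgebra k (Gen I n))
    (f : reflCarrier (n := n) lam nu i V) :
    wordMap g i (FreeAlgebra.lift k (genAction lam nu i V hi) c f).1 =
      (FreeAlgebra.lift k (genAction lam nu i W hi) c ⟨wordMap g i f.1, wordMap_mem g f.2⟩).1 := by
  induction c using FreeAlgebra.induction generalizing f with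
  | grade0 r =>
    rw [AlgHom.commutes, AlgHom.commutes]
    simp [Module.algebraMap_end_apply]
  | grade1 x =>
    rw [FreeAlgebra.lift_ι_apply, FreeAlgebra.lift_ι_apply]
    cases x with
    | idem j =>
      ext x
      change g (if _ then _ else _) = if _ then _ else _
      rw [apply_ite g, map_zero]
      rfl
    | edge a l => exact wordMap_edgeOp g a l f.1
    | perm s => exact wordMap_permOp g s f.1
  | mul a b ha hb =>
    rw [map_mul, map_mul, Module.End.mul_apply, Module.End.mul_apply, ha]
    congr 2
    exact Subtype.ext (hb f)
  | add a b ha hb =>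
    rw [map_add, map_add, LinearMap.add_apply, LinearMap.add_apply, Submodule.coe_add, map_add,
      ha, hb, Submodule.coe_add]

/-- The homomorphism `F_i(g)`, which is `f ↦ g ∘ f`. -/
noncomputable def reflMap (hi : IsEmpty (i ⟶ i)) {lam' : I → k} (h : lam' = reflect i lam) :
    ReflObj nu V n hi h →ₗ[WAlg n lam' nu] ReflObj nu W n hi h where
  toFun f := ⟨wordMap g i f.1, wordMap_mem g f.2⟩
  map_add' f f' := Subtype.ext (map_add (wordMap g i) f.1 f'.1)
  map_smul' c f := by
    obtain ⟨c, rfl⟩ := RingQuot.mkAlgHom_surjective k (Rel n lam' nu) c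
    refine Subtype.ext ?_
    change wordMap g i (reflHom V hi h (mk n lam' nu c) f).1 =
      (reflHom W hi h (mk n lam' nu c) ⟨wordMap g i f.1, wordMap_mem g f.2⟩).1
    rw [reflHom_mk, reflHom_mk]
    exact wordMap_lift g hi c f

end Map

end OperatorFacts

section Functor

variable {i : I}

/-- The underlying `k`-module of a module over `𝒜_{n,λ,ν}`. -/
@[reducible] noncomputable def scalarModule {lam : I → k} {nu : k}
    (V : ModuleCat.{w} (WAlg n lam nu)) : Module k V :=
  Module.compHom V (algebraMap k (WAlg n lam nu))

theorem scalarModule_tower {lam : I → k} {nu : k} (V : ModuleCat.{w} (WAlg n lam nu)) :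
    letI := scalarModule V
    IsScalarTower k (WAlg n lam nu) V :=
  letI := scalarModule V
  IsScalarTower.of_algebraMap_smul fun _ _ => rfl

/-- The reflection functor `F_i : 𝒜_{n,λ,ν}-mod ⥤ 𝒜_{n,r_iλ,ν}-mod` at a vertex `i` without edge-loop.
The parameter `r_iλ` is called `lam'`, so that `λ` can be taken for `r_i(r_iλ)`. -/
noncomputable def reflectionFunctor (n : ℕ) (nu : k) (hi : IsEmpty (i ⟶ i)) {lam lam' : I → k}
    (h : lam' = reflect i lam) :
    ModuleCat.{w} (WAlg n lam nu) ⥤ ModuleCat.{w} (WAlg n lam' nu) where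
  obj V :=
    letI := scalarModule V
    haveI := scalarModule_tower V
    ModuleCat.of (WAlg n lam' nu) (ReflObj nu V n hi h)
  map {V W} g :=
    letI := scalarModule V
    haveI := scalarModule_tower V
    letI := scalarModule W
    haveI := scalarModule_tower W
    ModuleCat.ofHom (reflMap g.hom hi h)
  map_id _ := rfl
  map_comp _ _ := rfl

end Functor

section Generic

/-- The element `λᵢ + c ∑_{m=2}^r s_{1m}` of `k[S_r]`, where `r = q + 1`. -/
noncomputable def swapElement (q : ℕ) (a c : k) : MonoidAlgebra k (Equiv.Perm (Fin (q + 1))) :=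
  algebraMap k _ a + c • ∑ m : Fin q, MonoidAlgebra.of k _ (Equiv.swap 0 m.succ)

/-- The set `Λᵢ` of the parameters `(λ, ν)` such that `λᵢ ± ν ∑_{m=2}^r s_{1m}` are invertible in
`k[S_r]` for all `r ∈ [1, n]`. -/
def genericSet (k : Type u) [CommRing k] (n : ℕ) (i : I) : Set ((I → k) × k) :=
  {p | ∀ q < n, IsUnit (swapElement q (p.1 i) p.2) ∧ IsUnit (swapElement q (p.1 i) (-p.2))}

end Generic

end Algebra

end WreathReflection

/-! An element of `F_i(F_i(V))` is a family `S` of elements of `F_i(V)`, indexed by words. If `S x ≠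
0`, then no letter of `x` is the vertex `i`. As `i` has no edge-loop, the vertex `i` does not occur
in `src ∘ x` either, and in such a degree `F_i(V)` is just a component of `V`. So `S` is the same
thing as one graded family `g` in `⨁ V(j, Δ(j))`. The kernel condition on `S` at `p` is a sum of
maps `θ_{r,p}` of `F_i(V)`; their transposition terms vanish on such elements, and what remains is
`μ_p π_p g = λᵢ g`. This identifies `F_i(F_i(V))` with `doubleCarrier` (`exists_isSpread`,
`exists_doubleCarrier`).

The isomorphism from `V` sends `v ∈ V_j` to the product of the `μ_p`, `p ∈ Δ(j)`, applied to `v`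
(`cubeVec`). The order of the factors is irrelevant, because starred edges at different positions
commute, and the image satisfies `μ_p π_p = λᵢ` by relation (i) (`cubeVec_mem`). The operators
`wideMu` and `widePi` are the identity at positions with a vertex other than `i`, so that one
product over all positions handles every `j` at once.

Bijectivity follows by comparing the product of the `μ` with the product of the `π`. In both orders
the composite is a product of Jucys–Murphy type factors `λᵢ + ν ∑_{m ∈ L} s_{mq}`, where `L` is the
list of the positions after `q`. On `⨁ V_j` this comes from relation (i) at `q` (`widePi_wideMu`,
`widePis_wideMus`). On `doubleCarrier` one has `μ_q π_q = λᵢ`, and by relation (ii) moving `μ_q π_q`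
past `π_m` costs `ν s_{mq}` (`wideMu_widePi_widePi`, `wideMus_widePis`). The hypothesis on `S_r`,
transported along embeddings `S_r → Sₙ`, makes each factor invertible (`isUnit_sum_swap`,
`jmOp_inverse`). The inverse is built from permutations and projections, hence preserves
`doubleCarrier`; this gives surjectivity.

For compatibility with the action, the edges `r` with head `i` are the essential case. Moving `r_ℓ`
past a product of starred edges produces exactly the transposition terms of `θ_{r,ℓ}`
(`edge_pathElem`), and the scalar terms of the inner and the outer `θ` cancel because `(r_iλ)_i =
-λᵢ` (`IsSpread.theta`).

The other composite is the same statement for `r_iλ`; there the sign of `λᵢ` changes, which is why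
both `λᵢ + ν ∑ s_{1m}` and `λᵢ - ν ∑ s_{1m}` have to be invertible. Everything is done for a module
`X` with an isomorphism `X ≅ F_i(V)` instead of `F_i(V)` itself, so that `X` may carry its own
`k`-structure, namely the one that the functor reads off from the algebra. -/

namespace WreathReflection

variable {k : Type u} [CommRing k]
variable {I : Type} [Quiver.{0} I] [Fintype I] [DecidableEq I]
variable [Fintype (Quiver.Total I)] [DecidableEq (Quiver.Total I)] {n : ℕ}

/-! ### Products of starred edges at distinct positions. -/

section StarPath

variable {i : I}

/-- The factor at the position `p` of a path of starred edges: a letter `r ∈ R` contributes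
`ε(r) r*_p`, a vertex different from `i` contributes `1`, and the vertex `i` contributes `0`. -/
noncomputable def stepElem (lam : I → k) (nu : k) (p : Fin n) : Letter i → WAlg n lam nu :=
  Sum.elim (fun v => if v = i then 0 else 1) fun s => sgn k s.1 • edge lam nu (star s.1) p

/-- The product of the factors of a word at the positions of a list. -/
noncomputable def pathElem (lam : I → k) (nu : k) (x : Word n i) : List (Fin n) → WAlg n lam nu
  | [] => 1
  | q :: L => pathElem lam nu x L * stepElem lam nu q (x q)

variable (lam : I → k) (nu : k)

theorem stepElem_inl_self (p : Fin n) : stepElem lam nu p (Sum.inl i : Letter i) = 0 := by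
  simp [stepElem]

theorem stepElem_inl (p : Fin n) {v : I} (h : v ≠ i) :
    stepElem lam nu p (Sum.inl v : Letter i) = 1 := by
  simp [stepElem, h]

theorem stepElem_inr (p : Fin n) (s : InEdge i) :
    stepElem lam nu p (Sum.inr s) = sgn k s.1 • edge lam nu (star s.1) p := rfl

theorem commute_stepElem_of_edge {c : WAlg n lam nu} (p : Fin n) (u : Letter i)
    (h : ∀ s : InEdge i, Commute c (edge lam nu (star s.1) p)) :
    Commute c (stepElem lam nu p u) := by
  rcases u with v | s
  · by_cases hv : v = i
    · subst hv; rw [stepElem_inl_self]; exact Commute.zero_right _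
    · rw [stepElem_inl _ _ _ hv]; exact Commute.one_right _
  · exact (h s).smul_right _

/-- Relation (ii) has a nonzero right-hand side only for an edge and its reverse. Here that would
force `a` to be a letter of `R`, whose head is `i`. -/
theorem commute_edge_stepElem {p q : Fin n} (hpq : p ≠ q) (a : DEdge I) (ha : head a ≠ i)
    (u : Letter i) : Commute (edge lam nu a p) (stepElem lam nu q u) := by
  refine commute_stepElem_of_edge _ _ _ _ fun s => edge_comm _ _ _ _ hpq _ _ fun e => ha ?_
  rw [← star_star a, ← e, star_star, s.2]

theorem stepElem_commute (hi : IsEmpty (i ⟶ i)) {p q : Fin n} (hpq : p ≠ q) (u v : Letter i) :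
    Commute (stepElem lam nu p u) (stepElem lam nu q v) := by
  refine (commute_stepElem_of_edge _ _ _ _ fun s => ?_).symm
  refine (commute_edge_stepElem _ _ hpq _ ?_ _).symm
  rw [head_star]
  exact tail_ne hi s.2

theorem stepElem_idem (p : Fin n) (u : Letter i) (j : Fin n → I) (h : j p = base u) :
    stepElem lam nu p u * idem lam nu j =
      idem lam nu (Function.update j p (src u)) * stepElem lam nu p u := by
  rcases u with v | s
  · have : Function.update j p (src (Sum.inl v : Letter i)) = j := by
      rw [show src (Sum.inl v : Letter i) = j p from h.symm, Function.update_eq_self]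
    rw [this]
    by_cases hv : v = i
    · subst hv; simp [stepElem_inl_self]
    · simp [stepElem_inl _ _ _ hv]
  · rw [stepElem_inr, smul_mul_assoc, edge_idem _ _ _ _ _ (by rw [tail_star, s.2]; exact h),
      mul_smul_comm, head_star]
    rfl

theorem perm_stepElem (s : Equiv.Perm (Fin n)) (p : Fin n) (u : Letter i) :
    perm lam nu s * stepElem lam nu p u = stepElem lam nu (s p) u * perm lam nu s := by
  rcases u with v | r
  · by_cases hv : v = i
    · subst hv; simp [stepElem_inl_self]
    · simp [stepElem_inl _ _ _ hv]
  · rw [stepElem_inr, stepElem_inr, mul_smul_comm, perm_edge, smul_mul_assoc]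

/-- The factors at different positions commute, since a starred edge `s*` with `s ∈ R` ends at a
vertex other than `i`. This is what allows any chosen position to be treated as the first or the
last one. -/
theorem pathElem_perm (hi : IsEmpty (i ⟶ i)) (x : Word n i) {L L' : List (Fin n)}
    (h : L.Perm L') : pathElem lam nu x L = pathElem lam nu x L' := by
  induction h with
  | nil => rfl
  | cons q _ ih => simp only [pathElem, ih]
  | swap p q L =>
    simp only [pathElem, mul_assoc]
    by_cases hpq : p = q
    · rw [hpq]
    · rw [(stepElem_commute lam nu hi hpq _ _).eq]
  | trans _ _ h1 h2 => exact h1.trans h2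

theorem pathElem_update (x : Word n i) {L : List (Fin n)} {p : Fin n} (hp : p ∉ L)
    (u : Letter i) : pathElem lam nu (Function.update x p u) L = pathElem lam nu x L := by
  induction L with
  | nil => rfl
  | cons q L ih =>
    rw [List.mem_cons, not_or] at hp
    rw [pathElem, pathElem, ih hp.2, Function.update_of_ne (Ne.symm hp.1)]

theorem commute_pathElem {c : WAlg n lam nu} (x : Word n i) (L : List (Fin n))
    (h : ∀ p ∈ L, Commute c (stepElem lam nu p (x p))) : Commute c (pathElem lam nu x L) := by
  induction L with
  | nil => exact Commute.one_right _
  | cons q L ih =>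
    exact (ih fun p hp => h p (List.mem_cons_of_mem _ hp)).mul_right (h q List.mem_cons_self)

theorem pathElem_eq_zero {x : Word n i} {L : List (Fin n)} {p : Fin n} (hp : p ∈ L)
    (h : x p = Sum.inl i) : pathElem lam nu x L = 0 := by
  induction L with
  | nil => simp at hp
  | cons q L ih =>
    rw [pathElem]
    rcases List.mem_cons.1 hp with rfl | hp
    · rw [h, stepElem_inl_self, mul_zero]
    · rw [ih hp, zero_mul]

theorem perm_pathElem (s : Equiv.Perm (Fin n)) (x : Word n i) (L : List (Fin n)) :
    perm lam nu s * pathElem lam nu (x ∘ s) L = pathElem lam nu x (L.map s) * perm lam nu s := by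
  induction L with
  | nil => simp [pathElem]
  | cons q L ih =>
    rw [List.map_cons, pathElem, pathElem, ← mul_assoc, ih, mul_assoc, perm_stepElem, mul_assoc]
    rfl

/-- The full path of a word. -/
noncomputable def fullPath (x : Word n i) : WAlg n lam nu := pathElem lam nu x (List.finRange n)

theorem fullPath_split (hi : IsEmpty (i ⟶ i)) (x : Word n i) (l : Fin n) :
    fullPath lam nu x = pathElem lam nu x ((List.finRange n).erase l) * stepElem lam nu l (x l) :=
  pathElem_perm lam nu hi x (List.perm_cons_erase (List.mem_finRange l))

/-- Conjugation by a permutation relabels the positions and thereby reorders the list of factors,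
which does not change the product. -/
theorem perm_fullPath (hi : IsEmpty (i ⟶ i)) (s : Equiv.Perm (Fin n)) (x : Word n i) :
    perm lam nu s * fullPath lam nu (x ∘ s) = fullPath lam nu x * perm lam nu s := by
  rw [fullPath, perm_pathElem, fullPath]
  congr 1
  refine pathElem_perm lam nu hi x ?_
  refine (List.perm_ext_iff_of_nodup ((List.nodup_finRange n).map s.injective)
    (List.nodup_finRange n)).2 fun a => ?_
  simp only [List.mem_finRange, iff_true, List.mem_map, true_and]
  exact ⟨s.symm a, by simp⟩

/-- Each factor moves the vertex at its position from `base` to `src`. The list must have no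
repetitions, as a position that has been moved no longer satisfies the hypothesis on `j`. -/
theorem pathElem_idem (x : Word n i) (L : List (Fin n)) (hL : L.Nodup) (j : Fin n → I)
    (h : ∀ p ∈ L, j p = base (x p)) :
    pathElem lam nu x L * idem lam nu j =
      idem lam nu (fun p => if p ∈ L then src (x p) else j p) * pathElem lam nu x L := by
  induction L generalizing j with
  | nil => simp [pathElem]
  | cons q L ih =>
    rw [List.nodup_cons] at hL
    rw [pathElem, mul_assoc, stepElem_idem _ _ _ _ _ (h q List.mem_cons_self), ← mul_assoc,
      ih hL.2 _ fun p hp => ?_, mul_assoc]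
    · congr 2
      ext p
      by_cases hpq : p = q
      · subst hpq; simp [hL.1]
      · simp [hpq]
    · rw [Function.update_of_ne (by rintro rfl; exact hL.1 hp), h p (List.mem_cons_of_mem _ hp)]

/-- By relation (ii), `r_ℓ` fails to commute only with the factors `r*_m`. Each of these leaves `ν
s_{mℓ}` in place of the factor, and replacing the letter at `m` by the vertex `t(r) ≠ i` is the way
to delete that factor from the path. These terms become the transposition part of `θ_{r,ℓ}`. -/
theorem edge_pathElem (r : InEdge i) (hr : tail r.1 ≠ i) (x : Word n i) (l : Fin n)
    (L : List (Fin n)) (hL : L.Nodup) (hl : l ∉ L) (j : Fin n → I) (hj : j l = tail r.1)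
    (h : ∀ p ∈ L, j p = base (x p)) :
    pathElem lam nu x L * (edge lam nu r.1 l * idem lam nu j) =
      edge lam nu r.1 l * pathElem lam nu x L * idem lam nu j +
        nu • (L.map fun m => if x m = Sum.inr r then
          pathElem lam nu (Function.update x m (Sum.inl (tail r.1))) L *
            (perm lam nu (Equiv.swap m l) * idem lam nu j) else 0).sum := by
  induction L generalizing j with
  | nil => simp [pathElem]
  | cons q L ih =>
    rw [List.nodup_cons] at hL
    rw [List.mem_cons, not_or] at hl
    have hq : j q = base (x q) := h q List.mem_cons_self
    have hj' : Function.update j q (src (x q)) l = tail r.1 := by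
      rw [Function.update_of_ne hl.1, hj]
    -- The case of a single factor. The sign in `stepElem` and the sign in relation (ii) multiply to
    -- `1`, so the correction is `ν s_{qℓ}` whatever the orientation of `r`.
    have hs : stepElem lam nu q (x q) * (edge lam nu r.1 l * idem lam nu j) =
        edge lam nu r.1 l * (idem lam nu (Function.update j q (src (x q))) *
          stepElem lam nu q (x q)) + if x q = Sum.inr r then
            nu • (perm lam nu (Equiv.swap q l) * idem lam nu j) else 0 := by
      rw [← stepElem_idem _ _ _ _ _ hq]
      rcases hx : x q with v | s
      · by_cases hv : v = i
        · subst hv; simp [stepElem_inl_self]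
        · simp [stepElem_inl _ _ _ hv]
      · have hr2 := rel_ii lam nu l q hl.1 r.1 (star s.1) j hj (by rw [tail_star, s.2, hq, hx]; rfl)
        rw [sub_eq_iff_eq_add'] at hr2
        rw [stepElem_inr, smul_mul_assoc, smul_mul_assoc, mul_smul_comm, ← mul_assoc, ← mul_assoc,
          hr2, smul_add, add_assoc, left_eq_add]
        by_cases hsr : s = r
        · subst hsr
          rw [if_pos rfl, if_pos rfl, smul_smul, mul_neg, ← mul_assoc, sgn_mul_self, one_mul,
            Equiv.swap_comm l q, neg_smul, neg_add_cancel]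
        · rw [if_neg (fun e => hsr (Subtype.ext (by rw [← star_star s.1, e, star_star]))),
            if_neg (fun e => hsr (Sum.inr.inj e))]
          simp
    -- The transposition `s_{mℓ}` fixes `q`, so the factor at `q` passes through it unchanged and
    -- rejoins the path.
    have hm (m : Fin n) (hm : m ∈ L) : pathElem lam nu (Function.update x m (Sum.inl (tail r.1))) L *
          (perm lam nu (Equiv.swap m l) * idem lam nu (Function.update j q (src (x q)))) *
          stepElem lam nu q (x q) =
        pathElem lam nu (Function.update x m (Sum.inl (tail r.1))) (q :: L) *
          (perm lam nu (Equiv.swap m l) * idem lam nu j) := by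
      have hqm : q ≠ m := by rintro rfl; exact hL.1 hm
      rw [pathElem, Function.update_of_ne hqm]
      simp only [mul_assoc]
      rw [← stepElem_idem _ _ _ _ _ hq, ← mul_assoc (perm lam nu _), perm_stepElem,
        Equiv.swap_apply_of_ne_of_ne hqm (Ne.symm hl.1), mul_assoc]
    have e := congrArg (· * stepElem lam nu q (x q)) (ih hL.2 hl.2 _ hj' fun p hp => by
      rw [Function.update_of_ne (by rintro rfl; exact hL.1 hp), h p (List.mem_cons_of_mem _ hp)])
    simp only [add_mul, smul_mul_assoc, ← List.sum_map_mul_right, ite_mul, zero_mul] at e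
    rw [List.map_congr_left (g := fun m => if x m = Sum.inr r then
        pathElem lam nu (Function.update x m (Sum.inl (tail r.1))) (q :: L) *
          (perm lam nu (Equiv.swap m l) * idem lam nu j) else 0)
        fun m h' => by rw [hm m h']] at e
    rw [pathElem, mul_assoc, hs, mul_add, ← mul_assoc (edge lam nu r.1 l), ← mul_assoc, e,
      List.map_cons, List.sum_cons, smul_add, add_assoc, add_comm (nu • List.sum _)]
    congr 1
    · simp only [mul_assoc]
      rw [← stepElem_idem _ _ _ _ _ hq]
    · congr 1
      split_ifs
      · rw [pathElem, Function.update_self, stepElem_inl _ _ _ hr, mul_one, pathElem_update _ _ _ hL.1,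
          mul_smul_comm]
      · simp

end StarPath

/-! ### The operators `μ` and `π` on all words, and the composites of their products. -/

section CubeOperators

variable {lam : I → k} {nu : k} {i : I}
variable {V : Type w} [AddCommGroup V] [Module k V] [Module (WAlg n lam nu) V]
variable [IsScalarTower k (WAlg n lam nu) V]

theorem list_map_sum_eq_zero {α M : Type*} [AddCommMonoid M] (L : List α) (F : α → M)
    (h : ∀ m ∈ L, F m = 0) : (L.map F).sum = 0 :=
  List.sum_eq_zero fun a ha => by
    obtain ⟨m, hm, rfl⟩ := List.mem_map.1 ha
    exact h m hm

variable (lam nu i V) in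
/-- The operator that is `μ_p` on the words with a letter of `R` at the position `p`, and the
projection to the words with a vertex different from `i` at `p` otherwise. -/
noncomputable def wideMu (p : Fin n) : (Word n i → V) →ₗ[k] (Word n i → V) where
  toFun f x := stepElem lam nu p (x p) • f (Function.update x p (Sum.inl (base (x p))))
  map_add' f g := by ext x; simp
  map_smul' t f := by ext x; simp [smul_comm t (stepElem lam nu p (x p))]

variable (lam nu i V) in
/-- The operator that is `π_p` on the words with the vertex `i` at the position `p`, and the
projection to the words with a vertex different from `i` at `p` otherwise. -/
noncomputable def widePi (p : Fin n) : (Word n i → V) →ₗ[k] (Word n i → V) where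
  toFun f x := if x p = Sum.inl i then
      ∑ r : InEdge i, edge lam nu r.1 p • f (Function.update x p (Sum.inr r))
    else if (x p).isLeft then f x else 0
  map_add' f g := by
    ext x
    simp only [Pi.add_apply]
    split_ifs <;> simp [Finset.sum_add_distrib]
  map_smul' t f := by
    ext x
    simp only [Pi.smul_apply, RingHom.id_apply]
    split_ifs <;> simp [Finset.smul_sum, smul_comm t (edge lam nu _ p)]

/-- The projection to the words `x` such that `base ∘ x` has a given property. -/
noncomputable def cut (k : Type u) [CommRing k] {V : Type w} [AddCommGroup V] [Module k V]
    (Q : (Fin n → I) → Prop) [DecidablePred Q] :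
    (Word n i → V) →ₗ[k] (Word n i → V) where
  toFun f x := if Q (base ∘ x) then f x else 0
  map_add' f g := by ext x; by_cases h : Q (base ∘ x) <;> simp [h]
  map_smul' t f := by ext x; by_cases h : Q (base ∘ x) <;> simp [h]

variable (lam nu i V) in
/-- The transposition `s_{mq}` on the words with base `i` at both positions, and zero on the other
words. -/
noncomputable def cutSwap (m q : Fin n) : (Word n i → V) →ₗ[k] (Word n i → V) :=
  cut k (fun j => j m = i ∧ j q = i) ∘ₗ permOp lam nu i V (Equiv.swap m q)

variable (i) in
/-- Multiplication by `c` on the words with base `i` at the position `q`, and the identity on the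
other words. -/
noncomputable def cutScalar (k : Type u) [CommRing k] {V : Type w} [AddCommGroup V] [Module k V]
    (c : k) (q : Fin n) : (Word n i → V) →ₗ[k] (Word n i → V) :=
  c • cut k (fun j => j q = i) + cut k (fun j => j q ≠ i)

variable (lam nu i V) in
/-- The operator `λᵢ + ν ∑_{m ∈ L} s_{mq}`, restricted to the positions with base `i`. -/
noncomputable def jmOp (q : Fin n) (L : List (Fin n)) : (Word n i → V) →ₗ[k] (Word n i → V) :=
  cutScalar i k (lam i) q + nu • (L.map fun m => cutSwap lam nu i V m q).sum

variable (lam nu i V) in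
/-- The product of the operators `wideMu`. -/
noncomputable def wideMus : List (Fin n) → ((Word n i → V) →ₗ[k] (Word n i → V))
  | [] => LinearMap.id
  | q :: L => wideMus L ∘ₗ wideMu lam nu i V q

variable (lam nu i V) in
/-- The product of the operators `widePi`. -/
noncomputable def widePis : List (Fin n) → ((Word n i → V) →ₗ[k] (Word n i → V))
  | [] => LinearMap.id
  | q :: L => widePi lam nu i V q ∘ₗ widePis L

variable (lam nu i V) in
/-- The product of the operators `jmOp`. -/
noncomputable def jmOps : List (Fin n) → ((Word n i → V) →ₗ[k] (Word n i → V))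
  | [] => LinearMap.id
  | q :: L => jmOps L ∘ₗ jmOp lam nu i V q L

theorem wideMu_apply (p : Fin n) (f : Word n i → V) (x : Word n i) :
    wideMu lam nu i V p f x =
      stepElem lam nu p (x p) • f (Function.update x p (Sum.inl (base (x p)))) := rfl

theorem widePi_apply (p : Fin n) (f : Word n i → V) (x : Word n i) :
    widePi lam nu i V p f x = if x p = Sum.inl i then
      ∑ r : InEdge i, edge lam nu r.1 p • f (Function.update x p (Sum.inr r))
    else if (x p).isLeft then f x else 0 := rfl

theorem wideMu_apply_self (p : Fin n) (f : Word n i → V) (x : Word n i) (h : x p = Sum.inl i) :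
    wideMu lam nu i V p f x = 0 := by
  rw [wideMu_apply, h, stepElem_inl_self, zero_smul]

theorem wideMu_apply_inl (p : Fin n) (f : Word n i → V) (x : Word n i) {v : I}
    (h : x p = Sum.inl v) (hv : v ≠ i) : wideMu lam nu i V p f x = f x := by
  rw [wideMu_apply, h, stepElem_inl _ _ _ hv, one_smul]
  congr 1
  rw [show (Sum.inl (base (Sum.inl v : Letter i)) : Letter i) = x p from h.symm,
    Function.update_eq_self]

theorem wideMu_apply_inr (p : Fin n) (f : Word n i → V) (x : Word n i) {s : InEdge i}
    (h : x p = Sum.inr s) : wideMu lam nu i V p f x =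
      sgn k s.1 • edge lam nu (star s.1) p • f (Function.update x p (Sum.inl i)) := by
  rw [wideMu_apply, h, stepElem_inr, smul_assoc]
  rfl

theorem widePi_apply_self (p : Fin n) (f : Word n i → V) (x : Word n i) (h : x p = Sum.inl i) :
    widePi lam nu i V p f x =
      ∑ r : InEdge i, edge lam nu r.1 p • f (Function.update x p (Sum.inr r)) := by
  rw [widePi_apply, if_pos h]

theorem widePi_apply_inl (p : Fin n) (f : Word n i → V) (x : Word n i) {v : I}
    (h : x p = Sum.inl v) (hv : v ≠ i) : widePi lam nu i V p f x = f x := by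
  rw [widePi_apply, if_neg (by rw [h]; exact fun e => hv (Sum.inl.inj e)), if_pos (by rw [h]; rfl)]

theorem widePi_apply_inr (p : Fin n) (f : Word n i → V) (x : Word n i) {s : InEdge i}
    (h : x p = Sum.inr s) : widePi lam nu i V p f x = 0 := by
  rw [widePi_apply, if_neg (by rw [h]; simp), if_neg (by rw [h]; simp)]

theorem cut_apply (Q : (Fin n → I) → Prop) [DecidablePred Q] (f : Word n i → V) (x : Word n i) :
    cut k Q f x = if Q (base ∘ x) then f x else 0 := rfl

theorem cutSwap_apply (m q : Fin n) (f : Word n i → V) (x : Word n i) :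
    cutSwap lam nu i V m q f x = if base (x m) = i ∧ base (x q) = i then
      perm lam nu (Equiv.swap m q) • f (x ∘ Equiv.swap m q) else 0 := rfl

theorem cutScalar_apply (c : k) (q : Fin n) (f : Word n i → V) (x : Word n i) :
    cutScalar i k c q f x = if base (x q) = i then c • f x else f x := by
  simp only [cutScalar, LinearMap.add_apply, LinearMap.smul_apply, Pi.add_apply, Pi.smul_apply,
    cut_apply, Function.comp_apply]
  by_cases h : base (x q) = i <;> simp [h]

theorem jmOp_apply (q : Fin n) (L : List (Fin n)) (f : Word n i → V) :
    jmOp lam nu i V q L f =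
      cutScalar i k (lam i) q f + nu • (L.map fun m => cutSwap lam nu i V m q f).sum := by
  rw [jmOp, LinearMap.add_apply, LinearMap.smul_apply]
  congr 2
  induction L with
  | nil => rfl
  | cons m L ih => simp [ih]

theorem list_sum_apply (L : List (Fin n)) (F : Fin n → Word n i → V) (x : Word n i) :
    (L.map F).sum x = (L.map fun m => F m x).sum := by
  induction L with
  | nil => rfl
  | cons m L ih => simp [ih]

theorem IsGraded.wideMu {f : Word n i → V} (hf : IsGraded lam nu f) (p : Fin n) :
    IsGraded lam nu (wideMu lam nu i V p f) := by
  intro x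
  rw [wideMu_apply]
  conv_rhs => rw [← hf, smul_smul, stepElem_idem _ _ _ _ _ (by simp [src]), ← smul_smul]
  congr 2
  rw [comp_update', Function.update_idem, ← comp_update', Function.update_eq_self]

theorem IsGraded.widePi {f : Word n i → V} (hf : IsGraded lam nu f) (p : Fin n) :
    IsGraded lam nu (widePi lam nu i V p f) := by
  intro x
  rw [widePi_apply]
  split_ifs with h h'
  · rw [Finset.smul_sum]
    refine Finset.sum_congr rfl fun r _ => ?_
    conv_rhs => rw [← hf, smul_smul, edge_idem _ _ _ _ _ (by simp [src]), ← smul_smul]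
    congr 2
    rw [comp_update', Function.update_idem, r.2]
    have e : (src ∘ x) p = i := by simp [h, src]
    conv_lhs => rw [← Function.update_eq_self p (src ∘ x), e]
  · exact hf x
  · simp

theorem IsGraded.widePis {f : Word n i → V} (hf : IsGraded lam nu f) (L : List (Fin n)) :
    IsGraded lam nu (widePis lam nu i V L f) := by
  induction L with
  | nil => exact hf
  | cons q L ih => exact ih.widePi q

/-- The operators at positions of `L` never alter the letter at `p ∉ L`, so the vanishing condition
at `p` survives until `π_p` is applied. -/
theorem widePis_support {f : Word n i → V} {p : Fin n} (hf : ∀ x, x p = Sum.inl i → f x = 0)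
    {L : List (Fin n)} (hp : p ∉ L) (x : Word n i) (hx : x p = Sum.inl i) :
    widePis lam nu i V L f x = 0 := by
  induction L generalizing x with
  | nil => exact hf x hx
  | cons q L ih =>
    rw [List.mem_cons, not_or] at hp
    change WreathReflection.widePi lam nu i V q (WreathReflection.widePis lam nu i V L f) x = 0
    rw [widePi_apply]
    split_ifs
    · exact Finset.sum_eq_zero fun r _ => by
        rw [ih hp.2 _ (by rw [Function.update_of_ne hp.1, hx]), smul_zero]
    · exact ih hp.2 x hx
    · rfl

/-- Once `widePi` has been applied at `p`, only words with a vertex at `p` remain. With `L` the list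
of all positions, the result therefore lives on words of vertices and comes from an element of `V`.
-/
theorem widePis_inr (f : Word n i → V) {L : List (Fin n)} {p : Fin n} (hp : p ∈ L)
    (x : Word n i) {s : InEdge i} (hx : x p = Sum.inr s) : widePis lam nu i V L f x = 0 := by
  induction L generalizing x with
  | nil => simp at hp
  | cons q L ih =>
    change WreathReflection.widePi lam nu i V q (WreathReflection.widePis lam nu i V L f) x = 0
    by_cases hpq : p = q
    · subst hpq
      exact widePi_apply_inr _ _ _ hx
    · have hp' : p ∈ L := (List.mem_cons.1 hp).resolve_left hpq
      rw [widePi_apply]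
      split_ifs
      · exact Finset.sum_eq_zero fun r _ => by
          rw [ih hp' _ (by rw [Function.update_of_ne hpq, hx]), smul_zero]
      · exact ih hp' x hx
      · rfl

theorem base_update_inr (x : Word n i) (p : Fin n) (r : InEdge i) (h : base (x p) = i) :
    base ∘ Function.update x p (Sum.inr r) = base ∘ x := by
  rw [comp_update', show base (Sum.inr r) = (base ∘ x) p from h.symm, Function.update_eq_self]

/-- The letters that `π_p` exchanges, the vertex `i` and the elements of `R`, have the same `base`.
Hence `π_p` respects the decomposition by `j`, although it changes `D`. -/
theorem widePi_cut (Q : (Fin n → I) → Prop) [DecidablePred Q] (p : Fin n) (f : Word n i → V) :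
    widePi lam nu i V p (cut k Q f) = cut k Q (widePi lam nu i V p f) := by
  ext x
  by_cases h : x p = Sum.inl i
  · have hb (r : InEdge i) := base_update_inr x p r (by rw [h]; rfl)
    rw [widePi_apply_self _ _ _ h, cut_apply, widePi_apply_self _ _ _ h]
    simp only [cut_apply, hb]
    split_ifs <;> simp
  · simp only [widePi_apply, cut_apply, if_neg h]
    split_ifs <;> rfl

theorem permOp_widePi (s : Equiv.Perm (Fin n)) (p : Fin n) (f : Word n i → V) :
    permOp lam nu i V s (widePi lam nu i V p f) =
      widePi lam nu i V (s p) (permOp lam nu i V s f) := by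
  ext x
  simp only [permOp_apply, widePi_apply, Function.comp_apply, update_comp_perm]
  split_ifs
  · rw [Finset.smul_sum]
    refine Finset.sum_congr rfl fun r _ => ?_
    rw [smul_smul, smul_smul, perm_edge]
  · rfl
  · simp

theorem widePi_cutSwap {m q p : Fin n} (hm : p ≠ m) (hq : p ≠ q) (f : Word n i → V) :
    widePi lam nu i V p (cutSwap lam nu i V m q f) =
      cutSwap lam nu i V m q (widePi lam nu i V p f) := by
  rw [cutSwap, LinearMap.comp_apply, LinearMap.comp_apply, widePi_cut, permOp_widePi,
    Equiv.swap_apply_of_ne_of_ne hm hq]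

theorem widePis_cutSwap {m q : Fin n} {L : List (Fin n)} (hm : m ∉ L) (hq : q ∉ L)
    (f : Word n i → V) : widePis lam nu i V L (cutSwap lam nu i V m q f) =
      cutSwap lam nu i V m q (widePis lam nu i V L f) := by
  induction L with
  | nil => rfl
  | cons p L ih =>
    rw [List.mem_cons, not_or] at hm hq
    rw [widePis, LinearMap.comp_apply, LinearMap.comp_apply, ih hm.2 hq.2,
      widePi_cutSwap (Ne.symm hm.1) (Ne.symm hq.1)]

theorem widePi_jmOp {q p : Fin n} (hq : p ≠ q) {L : List (Fin n)} (hp : p ∉ L)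
    (f : Word n i → V) : widePi lam nu i V p (jmOp lam nu i V q L f) =
      jmOp lam nu i V q L (widePi lam nu i V p f) := by
  rw [jmOp_apply, jmOp_apply, map_add, map_smul]
  congr 1
  · simp only [cutScalar, LinearMap.add_apply, LinearMap.smul_apply, map_add, map_smul, widePi_cut]
  · rw [map_list_sum, List.map_map]
    congr 2
    refine List.map_congr_left fun m hm => ?_
    rw [Function.comp_apply, widePi_cutSwap (by rintro rfl; exact hp hm) hq]

/-- The product over `L` uses only transpositions of positions in `L` and projections by `j`. Both
are compatible with `π_p` for `p ∉ L`. -/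
theorem widePi_jmOps {p : Fin n} {L : List (Fin n)} (hp : p ∉ L) (f : Word n i → V) :
    widePi lam nu i V p (jmOps lam nu i V L f) = jmOps lam nu i V L (widePi lam nu i V p f) := by
  induction L generalizing f with
  | nil => rfl
  | cons q L ih =>
    rw [List.mem_cons, not_or] at hp
    rw [jmOps, LinearMap.comp_apply, LinearMap.comp_apply, ih hp.2, widePi_jmOp hp.1 hp.2]

/-- `π_q μ_q = λᵢ + ν ∑_{m ∈ L} s_{mq}` on the words whose letters at the positions in `L` are
vertices, and whose other letters are different from `i`. -/
theorem widePi_wideMu (hi : IsEmpty (i ⟶ i)) {f : Word n i → V} (hf : IsGraded lam nu f) {q : Fin n} {L : List (Fin n)}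
    (hL : (q :: L).Nodup) (h1 : ∀ x, ∀ m ∈ q :: L, (x m).isRight → f x = 0)
    (h2 : ∀ x, ∀ m ∉ q :: L, x m = Sum.inl i → f x = 0) :
    widePi lam nu i V q (wideMu lam nu i V q f) = jmOp lam nu i V q L f := by
  ext x
  rw [jmOp_apply, Pi.add_apply, Pi.smul_apply, list_sum_apply, cutScalar_apply]
  simp only [cutSwap_apply]
  rcases hx : x q with v | s
  · by_cases hv : v = i
    · subst hv
      have e := rel_i_mod (f x) (src ∘ x) (hf x) q
      have hq : (src ∘ x) q = v := by simp [hx, src]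
      rw [hq, ← sum_inEdge] at e
      rw [widePi_apply_self _ _ _ hx, if_pos (by rfl)]
      have e1 (r : InEdge v) : edge lam nu r.1 q •
          wideMu lam nu v V q f (Function.update x q (Sum.inr r)) =
          sgn k r.1 • edge lam nu r.1 q • edge lam nu (star r.1) q • f x := by
        rw [wideMu_apply_inr _ _ _ (Function.update_self _ _ _), Function.update_idem, ← hx,
          Function.update_eq_self, smul_comm]
      simp only [e1, e]
      congr 2
      rw [List.nodup_cons] at hL
      rw [← List.sum_toFinset _ hL.2, Finset.sum_filter]
      -- Relation (i) sums over all positions `m ≠ q` with vertex `i`, `jmOp` only over `L`. Outside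
      -- of `L` the vertex `i` is excluded by `h2`, and a letter of `R` does not stand for `i` in
      -- `src` because its tail is another vertex.
      refine (Finset.sum_subset_zero_on_sdiff (Finset.subset_univ _) ?_ ?_).symm
      · intro m hm
        have hm : m ∉ L := by simpa using hm
        rw [ite_eq_right_iff]
        rintro ⟨hmq, hm'⟩
        rcases hxm : x m with w | r
        · rw [Function.comp_apply, hxm] at hm'
          rw [h2 x m (by simp [hm, hmq]) (by rw [hxm]; exact congrArg _ hm'), smul_zero]
        · rw [Function.comp_apply, hxm] at hm'
          exact absurd hm' (tail_ne hi r.2)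
      · intro m hm
        have hm : m ∈ L := by simpa using hm
        have hmq : m ≠ q := by rintro rfl; exact hL.1 hm
        rcases hxm : x m with w | r
        · by_cases hw : w = v
          · have e2 : x ∘ Equiv.swap m q = x := by
              ext p
              simp only [Function.comp_apply, Equiv.swap_apply_def]
              split_ifs with h h'
              · rw [h, hxm, hx, hw]
              · rw [h', hxm, hx, hw]
              · rfl
            rw [if_pos ⟨hw, rfl⟩, if_pos ⟨hmq, by rw [Function.comp_apply, hxm]; exact hw⟩, e2,
              Equiv.swap_comm]
          · rw [if_neg fun h => hw h.1, if_neg fun h => hw ?_]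
            have := h.2
            rwa [Function.comp_apply, hxm] at this
        · rw [h1 x m (List.mem_cons_of_mem _ hm) (by rw [hxm]; rfl),
            h1 (x ∘ Equiv.swap m q) q List.mem_cons_self (by simp [hxm])]
          simp
    · rw [widePi_apply_inl _ _ _ hx hv, wideMu_apply_inl _ _ _ hx hv,
        if_neg (show base (Sum.inl v : Letter i) ≠ i from hv), list_map_sum_eq_zero]
      · simp
      · intro m _
        rw [if_neg fun h => hv h.2]
  · rw [widePi_apply_inr _ _ _ hx, h1 x q List.mem_cons_self (by rw [hx]; rfl), smul_zero, ite_self,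
      list_map_sum_eq_zero, smul_zero, add_zero]
    intro m hm
    rw [h1 (x ∘ Equiv.swap m q) m (List.mem_cons_of_mem _ hm) (by simp [hx]), smul_zero, ite_self]

/-- The composite telescopes from the inside. With `L` the tail of the list, the inner product over
`L` acts on `μ_q f`, where it becomes `jmOps L`. This commutes with the outer `π_q`, which then
meets `μ_q` and gives the factor of `q`. The induction applies to `μ_q f` because that function has
no vertex `i` at `q`. -/
theorem widePis_wideMus (hi : IsEmpty (i ⟶ i)) {f : Word n i → V} (hf : IsGraded lam nu f)
    {L : List (Fin n)} (hL : L.Nodup) (h1 : ∀ x, ∀ m ∈ L, (x m).isRight → f x = 0)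
    (h2 : ∀ x, ∀ m ∉ L, x m = Sum.inl i → f x = 0) :
    widePis lam nu i V L (wideMus lam nu i V L f) = jmOps lam nu i V L f := by
  induction L generalizing f with
  | nil => rfl
  | cons q L ih =>
    have hL' := List.nodup_cons.1 hL
    rw [widePis, wideMus, jmOps, LinearMap.comp_apply, LinearMap.comp_apply, LinearMap.comp_apply,
      ih (hf.wideMu q) hL'.2, widePi_jmOps hL'.1, widePi_wideMu hi hf hL h1 h2]
    · intro x m hm hx
      rw [wideMu_apply, h1 _ m (List.mem_cons_of_mem _ hm), smul_zero]
      rwa [Function.update_of_ne (by rintro rfl; exact hL'.1 hm)]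
    · intro x m hm hx
      by_cases hmq : m = q
      · subst hmq
        exact wideMu_apply_self _ _ _ hx
      · rw [wideMu_apply, h2 _ m (by simp [hmq, hm]), smul_zero]
        rwa [Function.update_of_ne hmq]

theorem sum_edge_widePi (f : Word n i → V) (p q : Fin n) (hpq : p ≠ q) (x : Word n i) {v : I}
    (hv : x p = Sum.inl v) (hvi : v ≠ i) :
    ∑ r : InEdge i, edge lam nu r.1 q •
      widePi lam nu i V p f (Function.update x q (Sum.inr r)) =
    ∑ r : InEdge i, edge lam nu r.1 q • f (Function.update x q (Sum.inr r)) := by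
  refine Finset.sum_congr rfl fun r _ => ?_
  rw [widePi_apply_inl _ _ _ (by rw [Function.update_of_ne hpq, hv]) hvi]

/-- The maps `π_q` and `π_m` commute, since both are given by edges with head `i`. Moving the
starred edge of `μ_q` past the edges `t_m` of `π_m` uses relation (ii), and only the edge `t` equal
to the letter at `q` leaves a correction. That correction is `ν s_{mq}`. -/
theorem wideMu_widePi_widePi (hi : IsEmpty (i ⟶ i)) {f : Word n i → V} (hf : IsGraded lam nu f)
    {m q : Fin n} (hmq : m ≠ q) (hm : ∀ x, x m = Sum.inl i → f x = 0)
    (hq : ∀ x, x q = Sum.inl i → f x = 0) :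
    wideMu lam nu i V q (widePi lam nu i V q (widePi lam nu i V m f)) =
      widePi lam nu i V m (wideMu lam nu i V q (widePi lam nu i V q f) +
        nu • cutSwap lam nu i V m q f) := by
  ext x
  rcases hx : x q with v | s
  · by_cases hv : v = i
    · subst hv
      rw [wideMu_apply_self _ _ _ hx]
      symm
      rw [widePi_apply]
      split_ifs with h
      · refine Finset.sum_eq_zero fun r _ => ?_
        rw [Pi.add_apply, wideMu_apply_self _ _ _ (by rw [Function.update_of_ne hmq.symm, hx]),
          Pi.smul_apply, cutSwap_apply, hm (_ ∘ _) (by simp [hmq.symm, hx])]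
        simp
      · rw [Pi.add_apply, wideMu_apply_self _ _ _ hx, Pi.smul_apply, cutSwap_apply,
          hm (_ ∘ _) (by simp [hx])]
        simp
      · rfl
    · rw [wideMu_apply_inl _ _ _ hx hv, widePi_apply_inl _ _ _ hx hv]
      have h1 (y : Word n i) (hy : y q = Sum.inl v) :
          (wideMu lam nu i V q (widePi lam nu i V q f) + nu • cutSwap lam nu i V m q f) y = f y := by
        rw [Pi.add_apply, wideMu_apply_inl _ _ _ hy hv, widePi_apply_inl _ _ _ hy hv, Pi.smul_apply,
          cutSwap_apply, if_neg fun h => hv ?_, smul_zero, add_zero]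
        have := h.2
        rwa [hy] at this
      rw [widePi_apply, widePi_apply, h1 x hx]
      split_ifs
      · exact Finset.sum_congr rfl fun r _ => by
          rw [h1 _ (by rw [Function.update_of_ne hmq.symm, hx])]
      · rfl
      · rfl
  · rw [wideMu_apply_inr _ _ _ hx, widePi_apply_self _ _ _ (Function.update_self _ _ _)]
    simp only [Function.update_idem]
    rcases hxm : x m with v | t
    · by_cases hv : v = i
      · have hxm' : x m = Sum.inl i := by rw [hxm, hv]
        set F : InEdge i → InEdge i → V := fun t r =>
          f (Function.update (Function.update x m (Sum.inr t)) q (Sum.inr r)) with hF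
        set W : InEdge i → V := fun t => ∑ r : InEdge i, edge lam nu r.1 q • F t r with hW
        have e1 (r : InEdge i) : widePi lam nu i V m f (Function.update x q (Sum.inr r)) =
            ∑ t : InEdge i, edge lam nu t.1 m • F t r := by
          rw [widePi_apply_self _ _ _ (by rw [Function.update_of_ne hmq, hxm'])]
          simp only [hF, Function.update_comm hmq]
        have e2 (t : InEdge i) : wideMu lam nu i V q (widePi lam nu i V q f)
            (Function.update x m (Sum.inr t)) = sgn k s.1 • edge lam nu (star s.1) q • W t := by
          rw [wideMu_apply_inr _ _ _ (by rw [Function.update_of_ne hmq.symm, hx]),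
            widePi_apply_self _ _ _ (Function.update_self _ _ _)]
          simp only [Function.update_idem, hW, hF]
        have e3 (t : InEdge i) : cutSwap lam nu i V m q f (Function.update x m (Sum.inr t)) =
            perm lam nu (Equiv.swap m q) • F s t := by
          rw [cutSwap_apply, if_pos
            ⟨by rw [Function.update_self]; rfl, by rw [Function.update_of_ne hmq.symm, hx]; rfl⟩]
          congr 2
          ext p
          simp only [Function.comp_apply, Equiv.swap_apply_def]
          split_ifs with h h'
          · rw [Function.update_of_ne hmq.symm, hx, h, Function.update_of_ne hmq,
              Function.update_self]
          · rw [h', Function.update_self, Function.update_self]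
          · rw [Function.update_of_ne h, Function.update_of_ne h', Function.update_of_ne h]
        have hWi (t : InEdge i) : idem lam nu
            (Function.update (src ∘ Function.update x m (Sum.inr t)) q i) • W t = W t := by
          simp only [hW, Finset.smul_sum]
          refine Finset.sum_congr rfl fun r _ => ?_
          have := edge_mem _ _ (hf (Function.update (Function.update x m (Sum.inr t)) q
            (Sum.inr r))) q r.1 (by simp [src])
          rwa [comp_update', Function.update_idem, r.2] at this
        -- This is where the transposition arises: exchanging `t_m` and `s*_q` leaves a term only
        -- for `t = s`.
        have e4 (t : InEdge i) := rel_ii_mod (W t) _ (hWi t) m q hmq t.1 (star s.1)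
          (by simp [hmq, src]) (by simp [tail_star, s.2])
        have e5 (t : InEdge i) : edge lam nu t.1 m • W t =
            ∑ r : InEdge i, edge lam nu r.1 q • edge lam nu t.1 m • F t r := by
          simp only [hW, Finset.smul_sum]
          refine Finset.sum_congr rfl fun r _ => ?_
          rw [smul_smul, smul_smul, edge_comm _ _ _ _ hmq]
          intro e
          exact tail_ne hi t.2 (by rw [← head_star, ← e, r.2])
        have e6 : (∑ t : InEdge i, sgn k s.1 • if star s.1 = star t.1 then
            -(sgn k t.1 * nu) • perm lam nu (Equiv.swap m q) • W t else 0) =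
            -(nu • perm lam nu (Equiv.swap m q) • W s) := by
          rw [Finset.sum_eq_single s]
          · rw [if_pos rfl, smul_smul, mul_neg, ← mul_assoc, sgn_mul_self, one_mul, neg_smul]
          · intro t _ hts
            rw [if_neg, smul_zero]
            intro e
            exact hts (Subtype.ext (by rw [← star_star t.1, ← e, star_star]))
          · simp
        rw [widePi_apply_self _ _ _ hxm']
        simp only [Pi.add_apply, Pi.smul_apply, e1, e2, e3, smul_add, Finset.sum_add_distrib,
          smul_comm (_ : WAlg n lam nu) (sgn k s.1), smul_comm (_ : WAlg n lam nu) nu, e4, e6,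
          ← Finset.smul_sum]
        -- In the added term, `π_m` passes through `s_{mq}` and becomes `π_q`; this is the opposite
        -- of the correction in `e6`.
        have e7 : ∑ t : InEdge i, edge lam nu t.1 m • perm lam nu (Equiv.swap m q) • F s t =
            perm lam nu (Equiv.swap m q) • W s := by
          simp only [hW, Finset.smul_sum]
          refine Finset.sum_congr rfl fun r _ => ?_
          rw [smul_smul, smul_smul, perm_edge, Equiv.swap_apply_right]
        rw [e7, neg_add_cancel_right]
        congr 2
        simp only [e5, Finset.smul_sum]
        exact Finset.sum_comm
      · rw [sum_edge_widePi _ _ _ hmq _ hxm hv, widePi_apply_inl _ _ _ hxm hv, Pi.add_apply,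
          wideMu_apply_inr _ _ _ hx, widePi_apply_self _ _ _ (Function.update_self _ _ _),
          Pi.smul_apply, cutSwap_apply, if_neg, smul_zero, add_zero]
        · simp only [Function.update_idem]
        · rw [hxm]
          exact fun h => hv h.1
    · rw [widePi_apply_inr _ _ _ hxm, Finset.sum_eq_zero, smul_zero, smul_zero]
      intro r _
      rw [widePi_apply_inr _ _ _ (by rw [Function.update_of_ne hmq, hxm]), smul_zero]

end CubeOperators

/-! ### Transport of invertibility from `k[S_r]` to `k[Sₙ]`. -/

section SymmetricGroup

/-- The invertibility of `λᵢ + ν ∑_{m=2}^r s_{1m}` in `k[S_r]` implies that of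
`λᵢ + ν ∑_{m ∈ D} s_{mq}` in `k[Sₙ]`. -/
theorem isUnit_sum_swap {a c : k} (h : ∀ q < n, IsUnit (swapElement q a c)) (q : Fin n)
    (D : Finset (Fin n)) (hq : q ∉ D) :
    IsUnit (algebraMap k (MonoidAlgebra k (Equiv.Perm (Fin n))) a +
      c • ∑ m ∈ D, MonoidAlgebra.of k _ (Equiv.swap m q)) := by
  have hD : D.card < n := by
    simpa using Finset.card_lt_univ_of_notMem hq
  -- With `r = |D| + 1`, which is at most `n` because `q ∉ D`, the embedding `ι` sends the first
  -- point to `q` and the others onto `D`. The induced homomorphism `S_r → Sₙ` carries the given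
  -- unit to the required element.
  let e : Fin D.card ≃ D := D.equivFin.symm
  have hinj : Function.Injective (Fin.cons q (fun t => (e t : Fin n)) : Fin (D.card + 1) → Fin n) := by
    refine Fin.cons_injective_iff.2 ⟨?_, fun s t hst => e.injective (Subtype.ext hst)⟩
    rintro ⟨t, rfl⟩
    exact hq (e t).2
  let ι : Fin (D.card + 1) ↪ Fin n := ⟨_, hinj⟩
  have hswap (t : Fin D.card) : Equiv.Perm.viaEmbeddingHom ι (Equiv.swap 0 t.succ) =
      Equiv.swap (e t : Fin n) q := by
    have h0 : ι 0 = q := rfl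
    have h1 : ι t.succ = e t := rfl
    ext x
    congr 1
    rw [Equiv.Perm.viaEmbeddingHom_apply]
    by_cases hx : x ∈ Set.range ι
    · obtain ⟨y, rfl⟩ := hx
      rw [Equiv.Perm.viaEmbedding_apply, ← h0, ← h1, Equiv.swap_comm (ι t.succ)]
      exact (ι.injective.swap_apply 0 t.succ y).symm
    · rw [Equiv.Perm.viaEmbedding_apply_of_notMem _ _ _ hx, Equiv.swap_apply_of_ne_of_ne]
      · rintro rfl; exact hx ⟨_, h1⟩
      · rintro rfl; exact hx ⟨_, h0⟩
  have hu := (h D.card hD).map (MonoidAlgebra.mapDomainAlgHom k k (Equiv.Perm.viaEmbeddingHom ι))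
  rw [swapElement, map_add, map_smul, map_sum, AlgHom.commutes] at hu
  convert hu using 3
  rw [← Finset.sum_coe_sort D, ← Equiv.sum_comp e]
  refine Finset.sum_congr rfl fun t _ => ?_
  simp [← hswap]

end SymmetricGroup

/-! ### Invertibility of the Jucys–Murphy type operators. -/

section Invertibility

variable {lam : I → k} {nu : k} {i : I}
variable {V : Type w} [AddCommGroup V] [Module k V] [Module (WAlg n lam nu) V]
variable [IsScalarTower k (WAlg n lam nu) V]

variable (lam nu i V) in
/-- The action of `k[Sₙ]` on `⨁ V(j, D)`. -/
noncomputable def permRep :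
    MonoidAlgebra k (Equiv.Perm (Fin n)) →ₐ[k] Module.End k (Word n i → V) :=
  MonoidAlgebra.lift k _ _
    { toFun := permOp lam nu i V
      map_one' := by
        refine LinearMap.ext fun f => funext fun x => ?_
        rw [permOp_apply, perm_one, one_smul]
        rfl
      map_mul' := fun s t => LinearMap.ext fun f => permOp_mul s t f }

theorem permRep_of (s : Equiv.Perm (Fin n)) :
    permRep lam nu i V (MonoidAlgebra.of k _ s) = permOp lam nu i V s :=
  MonoidAlgebra.lift_of _ _

theorem permRep_mem (U : Submodule k (Word n i → V))
    (hU : ∀ s, ∀ f ∈ U, permOp lam nu i V s f ∈ U) (a : MonoidAlgebra k (Equiv.Perm (Fin n)))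
    {f : Word n i → V} (hf : f ∈ U) : permRep lam nu i V a f ∈ U := by
  induction a using MonoidAlgebra.induction_on with
  | of s => rw [permRep_of]; exact hU s f hf
  | add a b ha hb => rw [map_add]; exact U.add_mem ha hb
  | smul c a ha => rw [map_smul]; exact U.smul_mem c ha

/-- The operator that acts on the words `x` with `base ∘ x = j` by the operator `u j`. -/
noncomputable def fiberOp (u : (Fin n → I) → Module.End k (Word n i → V)) :
    Module.End k (Word n i → V) where
  toFun f x := u (base ∘ x) f x
  map_add' f g := by ext x; simp
  map_smul' t f := by ext x; simp

theorem fiberOp_eq_sum (u : (Fin n → I) → Module.End k (Word n i → V)) (f : Word n i → V) :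
    fiberOp u f = ∑ j, cut k (· = j) (u j f) := by
  ext x
  rw [Finset.sum_apply, Finset.sum_eq_single (base ∘ x)]
  · rw [cut_apply, if_pos rfl]; rfl
  · intro j _ hj
    rw [cut_apply, if_neg hj.symm]
  · simp

/-- The left factor has to commute with the projection to its fiber. Then its value on the words
with base `j` depends only on the restriction of its argument to those words, where the other
operator is `u' j`. -/
theorem fiberOp_mul (u u' : (Fin n → I) → Module.End k (Word n i → V))
    (h : ∀ j, Commute (cut k (· = j)) (u j)) :
    fiberOp u * fiberOp u' = fiberOp (u * u') := by
  refine LinearMap.ext fun f => funext fun x => ?_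
  have e1 (g : Word n i → V) : g x = cut k (· = base ∘ x) g x := by rw [cut_apply, if_pos rfl]
  have e2 (g : Word n i → V) : cut k (· = base ∘ x) (u (base ∘ x) g) =
      u (base ∘ x) (cut k (· = base ∘ x) g) := LinearMap.congr_fun (h (base ∘ x)).eq g
  change u (base ∘ x) (fiberOp u' f) x = u (base ∘ x) (u' (base ∘ x) f) x
  rw [e1 (u _ _), e1 (u _ (u' _ _)), e2, e2]
  refine congrArg (fun g => u (base ∘ x) g x) (funext fun y => ?_)
  simp only [cut_apply]
  split_ifs with hy
  · rw [← hy]; rfl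
  · rfl

theorem commute_cut_permOp_swap (j : Fin n → I) {m q : Fin n} (h : j m = j q) :
    Commute (cut k (· = j)) (permOp lam nu i V (Equiv.swap m q)) := by
  refine LinearMap.ext fun f => funext fun x => ?_
  change cut k (· = j) (permOp lam nu i V (Equiv.swap m q) f) x =
    permOp lam nu i V (Equiv.swap m q) (cut k (· = j) f) x
  simp only [cut_apply, permOp_apply, base_swap x m q j h.symm, smul_ite, smul_zero]

/-- On the words with base `j` the operator is the action of one element of `k[Sₙ]`, whose
transpositions fix `j`, so it can be inverted for each `j` separately. The last clause records that
the inverse is assembled from permutations and projections. It is needed for `doubleCarrier`. -/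
theorem jmOp_inverse (h : ∀ q < n, IsUnit (swapElement q (lam i) nu)) {q : Fin n}
    {L : List (Fin n)} (hL : (q :: L).Nodup) : ∃ S : Module.End k (Word n i → V),
      S * jmOp lam nu i V q L = 1 ∧ jmOp lam nu i V q L * S = 1 ∧
      ∀ U : Submodule k (Word n i → V), (∀ s, ∀ f ∈ U, permOp lam nu i V s f ∈ U) →
        (∀ j, ∀ f ∈ U, cut k (· = j) f ∈ U) → ∀ f ∈ U, S f ∈ U := by
  rw [List.nodup_cons] at hL
  -- For `j_q = i` only the positions of `L` that also carry `i` enter. For `j_q ≠ i` the operator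
  -- is the identity, hence the value `1`.
  have hu (j : Fin n → I) : ∃ a : (MonoidAlgebra k (Equiv.Perm (Fin n)))ˣ,
      (a : MonoidAlgebra k (Equiv.Perm (Fin n))) = if j q = i then algebraMap k _ (lam i) +
        nu • ∑ m ∈ L.toFinset with j m = i, MonoidAlgebra.of k _ (Equiv.swap m q) else 1 := by
    split_ifs
    · exact isUnit_sum_swap h q _ (by simp [hL.1])
    · exact ⟨1, rfl⟩
  choose a ha using hu
  set u : (Fin n → I) → Module.End k (Word n i → V) := fun j => permRep lam nu i V (a j)
  set u' : (Fin n → I) → Module.End k (Word n i → V) := fun j => permRep lam nu i V ↑(a j)⁻¹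
  have hc (j : Fin n → I) : Commute (cut k (· = j)) (u j) := by
    simp only [u, ha]
    split_ifs with hj
    · rw [map_add, map_smul, map_sum, AlgHom.commutes]
      refine (Algebra.commute_algebraMap_right _ _).add_right (Commute.smul_right ?_ _)
      refine Commute.sum_right _ _ _ fun m hm => ?_
      rw [permRep_of]
      exact commute_cut_permOp_swap j ((Finset.mem_filter.1 hm).2.trans hj.symm)
    · rw [map_one]
      exact Commute.one_right _
  have hc' (j : Fin n → I) : Commute (cut k (· = j)) (u' j) :=
    Commute.units_inv_right (u := (a j).map (permRep lam nu i V).toMonoidHom) (hc j)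
  have h1 : fiberOp (V := V) (1 : (Fin n → I) → Module.End k (Word n i → V)) = 1 := rfl
  have huu : u * u' = 1 := by
    ext1 j
    change permRep lam nu i V _ * permRep lam nu i V _ = 1
    rw [← map_mul, Units.mul_inv, map_one]
  have huu' : u' * u = 1 := by
    ext1 j
    change permRep lam nu i V _ * permRep lam nu i V _ = 1
    rw [← map_mul, Units.inv_mul, map_one]
  have hT : jmOp lam nu i V q L = fiberOp u := by
    refine LinearMap.ext fun f => funext fun x => ?_
    change _ = u (base ∘ x) f x
    simp only [u, ha, Function.comp_apply]
    rw [jmOp_apply, Pi.add_apply, Pi.smul_apply, list_sum_apply, cutScalar_apply]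
    simp only [cutSwap_apply]
    by_cases hx : base (x q) = i
    · rw [if_pos hx, if_pos hx, map_add, map_smul, map_sum, AlgHom.commutes, LinearMap.add_apply,
        LinearMap.smul_apply, Pi.add_apply, Pi.smul_apply, LinearMap.sum_apply, Finset.sum_apply,
        ← List.sum_toFinset _ hL.2, Finset.sum_filter]
      congr 2
      refine Finset.sum_congr rfl fun m _ => ?_
      simp only [hx, and_true, permRep_of, permOp_apply]
    · rw [if_neg hx, if_neg hx, list_map_sum_eq_zero]
      · simp
      · intro m _
        rw [if_neg fun h => hx h.2]
  refine ⟨fiberOp u', ?_, ?_, fun U hP hC f hf => ?_⟩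
  · rw [hT, fiberOp_mul _ _ hc', huu', h1]
  · rw [hT, fiberOp_mul _ _ hc, huu, h1]
  · rw [fiberOp_eq_sum]
    exact U.sum_mem fun j _ => hC j _ (permRep_mem U hP _ hf)

theorem jmOps_inverse (h : ∀ q < n, IsUnit (swapElement q (lam i) nu))
    {L : List (Fin n)} (hL : L.Nodup) : ∃ S : Module.End k (Word n i → V),
      S * jmOps lam nu i V L = 1 ∧ jmOps lam nu i V L * S = 1 ∧
      ∀ U : Submodule k (Word n i → V), (∀ s, ∀ f ∈ U, permOp lam nu i V s f ∈ U) →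
        (∀ j, ∀ f ∈ U, cut k (· = j) f ∈ U) → ∀ f ∈ U, S f ∈ U := by
  induction L with
  | nil => exact ⟨1, rfl, rfl, fun U _ _ f hf => hf⟩
  | cons q L ih =>
    obtain ⟨S, h1, h2, h3⟩ := jmOp_inverse (V := V) h hL
    obtain ⟨S', h1', h2', h3'⟩ := ih (List.nodup_cons.1 hL).2
    refine ⟨S * S', ?_, ?_, fun U hP hC f hf => h3 U hP hC _ (h3' U hP hC f hf)⟩
    · change S * S' * (jmOps lam nu i V L * jmOp lam nu i V q L) = 1
      rw [mul_assoc, ← mul_assoc S', h1', one_mul, h1]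
    · change jmOps lam nu i V L * jmOp lam nu i V q L * (S * S') = 1
      rw [mul_assoc, ← mul_assoc (jmOp lam nu i V q L), h2, one_mul, h2']

end Invertibility

/-! ### The equations `μ_p π_p = λᵢ` and the product of the `μ` after the product of the `π`. -/

section DoubleCarrier

variable {lam : I → k} {nu : k} {i : I}
variable {V : Type w} [AddCommGroup V] [Module k V] [Module (WAlg n lam nu) V]
variable [IsScalarTower k (WAlg n lam nu) V]

variable (lam nu i V) in
/-- The submodule of the `f ∈ ⨁ V(j, Δ(j))` such that `μ_p π_p f = λᵢ f` for all `p ∈ Δ(j)`. It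
describes `F_i(F_i(V))`. -/
noncomputable def doubleCarrier : Submodule k (Word n i → V) where
  carrier := {f | IsGraded lam nu f ∧ (∀ x m, x m = Sum.inl i → f x = 0) ∧
    ∀ (x : Word n i) (p : Fin n) (s : InEdge i), x p = Sum.inr s →
      sgn k s.1 • edge lam nu (star s.1) p • ∑ r : InEdge i,
        edge lam nu r.1 p • f (Function.update x p (Sum.inr r)) = lam i • f x}
  zero_mem' := by simp [IsGraded]
  add_mem' := by
    rintro f g ⟨hf, hf', hf''⟩ ⟨hg, hg', hg''⟩
    refine ⟨hf.add hg, fun x m h => ?_, fun x p s h => ?_⟩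
    · simp [hf' x m h, hg' x m h]
    · simp only [Pi.add_apply, smul_add, Finset.sum_add_distrib, hf'' x p s h, hg'' x p s h]
  smul_mem' := by
    rintro t f ⟨hf, hf', hf''⟩
    refine ⟨hf.smul t, fun x m h => ?_, fun x p s h => ?_⟩
    · simp [hf' x m h]
    · simp only [Pi.smul_apply, smul_comm (_ : WAlg n lam nu) t, smul_comm (_ : k) t,
        ← Finset.smul_sum, hf'' x p s h]

theorem permOp_mem_doubleCarrier (s : Equiv.Perm (Fin n)) {f : Word n i → V}
    (hf : f ∈ doubleCarrier lam nu i V) : permOp lam nu i V s f ∈ doubleCarrier lam nu i V := by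
  refine ⟨hf.1.permOp s, fun x m h => ?_, fun x p t h => ?_⟩
  · rw [permOp_apply, hf.2.1 _ (s.symm m) (by simp [h]), smul_zero]
  · obtain ⟨p, rfl⟩ := s.surjective p
    have := congrArg (perm lam nu s • ·) (hf.2.2 (x ∘ s) p t h)
    simp only [smul_comm (_ : WAlg n lam nu) (_ : k)] at this
    have e (a : DEdge I) (v : V) : perm lam nu s • edge lam nu a p • v =
        edge lam nu a (s p) • perm lam nu s • v := by
      rw [smul_smul, smul_smul, perm_edge]
    rw [e, Finset.smul_sum] at this
    simpa only [permOp_apply, update_comp_perm, e] using this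

/-- The equation at a word involves only words obtained by exchanging a letter of `R` for another
one. These all have the same `base`, so the projection keeps or discards the whole equation. -/
theorem cut_mem_doubleCarrier (Q : (Fin n → I) → Prop) [DecidablePred Q] {f : Word n i → V}
    (hf : f ∈ doubleCarrier lam nu i V) : cut k Q f ∈ doubleCarrier lam nu i V := by
  refine ⟨fun x => ?_, fun x m h => ?_, fun x p t h => ?_⟩
  · rw [cut_apply]
    split_ifs
    · exact hf.1 x
    · simp
  · rw [cut_apply, hf.2.1 _ m h, ite_self]
  · simp only [cut_apply, fun r : InEdge i => base_update_inr x p r (by rw [h]; rfl)]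
    split_ifs
    · exact hf.2.2 x p t h
    · simp

theorem jmOp_mem_doubleCarrier (q : Fin n) (L : List (Fin n)) {f : Word n i → V}
    (hf : f ∈ doubleCarrier lam nu i V) : jmOp lam nu i V q L f ∈ doubleCarrier lam nu i V := by
  rw [jmOp_apply]
  refine add_mem (add_mem (Submodule.smul_mem _ _ (cut_mem_doubleCarrier (fun j => j q = i) hf))
    (cut_mem_doubleCarrier (fun j => j q ≠ i) hf)) (Submodule.smul_mem _ _ (list_sum_mem fun g hg => ?_))
  obtain ⟨m, _, rfl⟩ := List.mem_map.1 hg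
  exact cut_mem_doubleCarrier (fun j => j m = i ∧ j q = i) (permOp_mem_doubleCarrier _ hf)

theorem wideMu_widePi (q : Fin n) {f : Word n i → V} (hf : f ∈ doubleCarrier lam nu i V) :
    wideMu lam nu i V q (widePi lam nu i V q f) = cutScalar i k (lam i) q f := by
  ext x
  rw [cutScalar_apply]
  rcases hx : x q with v | s
  · by_cases hv : v = i
    · have hx' : x q = Sum.inl i := by rw [hx, hv]
      rw [wideMu_apply_self _ _ _ hx', hf.2.1 _ _ hx', smul_zero, ite_self]
    · rw [wideMu_apply_inl _ _ _ hx hv, widePi_apply_inl _ _ _ hx hv,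
        if_neg (show base (Sum.inl v : Letter i) ≠ i from hv)]
  · rw [wideMu_apply_inr _ _ _ hx, widePi_apply_self _ _ _ (Function.update_self _ _ _), if_pos (by rfl)]
    simp only [Function.update_idem]
    exact hf.2.2 x q s hx

/-- Each `π_m` crossed by `μ_q π_q` contributes the transposition `s_{mq}`. After all of them have
been crossed, `μ_q π_q` acts on an element of `doubleCarrier`, where it is the scalar `λᵢ` at the
positions with base `i`. -/
theorem wideMu_widePi_widePis (hi : IsEmpty (i ⟶ i)) {f : Word n i → V}
    (hf : f ∈ doubleCarrier lam nu i V) {q : Fin n} {L : List (Fin n)} (hL : (q :: L).Nodup) :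
    wideMu lam nu i V q (widePi lam nu i V q (widePis lam nu i V L f)) =
      widePis lam nu i V L (jmOp lam nu i V q L f) := by
  induction L with
  | nil =>
    rw [jmOp_apply]
    simpa [widePis] using wideMu_widePi q hf
  | cons m L ih =>
    simp only [List.nodup_cons, List.mem_cons, not_or] at hL
    have h0 : jmOp lam nu i V q (m :: L) f =
        jmOp lam nu i V q L f + nu • cutSwap lam nu i V m q f := by
      simp only [jmOp_apply, List.map_cons, List.sum_cons, smul_add]
      abel
    rw [widePis, LinearMap.comp_apply, LinearMap.comp_apply, wideMu_widePi_widePi hi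
      (IsGraded.widePis hf.1 L) (Ne.symm hL.1.1)
      (fun x hx => widePis_support (fun y hy => hf.2.1 y m hy) hL.2.1 x hx)
      (fun x hx => widePis_support (fun y hy => hf.2.1 y q hy) hL.1.2 x hx),
      ih (by simp [hL.1.2, hL.2.2]), ← widePis_cutSwap hL.2.1 hL.1.2, h0]
    simp only [map_add, map_smul]

/-- The pair `μ_q π_q` in the middle is moved to the right of the product of the `π` over the
remaining positions, where it becomes `jmOp`. As `jmOp` preserves `doubleCarrier`, the induction
applies to the shorter list. -/
theorem wideMus_widePis (hi : IsEmpty (i ⟶ i)) {f : Word n i → V}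
    (hf : f ∈ doubleCarrier lam nu i V) {L : List (Fin n)} (hL : L.Nodup) :
    wideMus lam nu i V L (widePis lam nu i V L f) = jmOps lam nu i V L f := by
  induction L generalizing f with
  | nil => rfl
  | cons q L ih =>
    rw [widePis, wideMus, jmOps, LinearMap.comp_apply, LinearMap.comp_apply, LinearMap.comp_apply,
      wideMu_widePi_widePis hi hf hL, ih (jmOp_mem_doubleCarrier q L hf) (List.nodup_cons.1 hL).2]

end DoubleCarrier

/-! ### The map from `V` given by the product of the `μ_p`: bijectivity and behaviour under the
generators. -/

section CubeVec

variable {lam : I → k} {nu : k} {i : I}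
variable {V : Type w} [AddCommGroup V] [Module k V] [Module (WAlg n lam nu) V]
variable [IsScalarTower k (WAlg n lam nu) V]

theorem idem_edge (lam : I → k) (nu : k) (a : DEdge I) (l : Fin n) (j : Fin n → I) :
    idem lam nu j * edge lam nu a l =
      if j l = head a then edge lam nu a l * idem lam nu (Function.update j l (tail a)) else 0 := by
  split_ifs with h
  · rw [edge_idem _ _ _ _ _ (by simp), Function.update_idem, ← h, Function.update_eq_self]
  · refine ext_idem lam nu fun j' => ?_
    rw [zero_mul, mul_assoc]
    by_cases h' : j' l = tail a
    · rw [edge_idem _ _ _ _ _ h', ← mul_assoc, idem_mul_ne, zero_mul]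
      rintro rfl
      simp at h
    · rw [edge_idem_ne _ _ _ _ _ h', mul_zero]

theorem idem_perm (lam : I → k) (nu : k) (s : Equiv.Perm (Fin n)) (j : Fin n → I) :
    idem lam nu j * perm lam nu s = perm lam nu s * idem lam nu (j ∘ s) := by
  rw [perm_idem]
  congr 2
  ext m; simp

theorem sum_idem_smul (v : V) : ∑ j : Fin n → I, idem lam nu j • v = v := by
  rw [← Finset.sum_smul, sum_idem, one_smul]

variable (lam nu i V) in
/-- The map `V_j → V(j, Δ(j))` given by the product of the `μ_p` with `p ∈ Δ(j)`. -/
noncomputable def cubeVec : V →ₗ[k] (Word n i → V) where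
  toFun v x := fullPath lam nu x • idem lam nu (base ∘ x) • v
  map_add' f g := by ext x; simp
  map_smul' t f := by
    ext x
    simp [smul_comm t (fullPath lam nu x), smul_comm t (idem lam nu _)]

variable (lam nu i V) in
/-- The inclusion of `⨁ V_j` into `⨁ V(j, D)`. -/
noncomputable def vertexVec : V →ₗ[k] (Word n i → V) where
  toFun v x := if ∀ p, (x p).isLeft then idem lam nu (src ∘ x) • v else 0
  map_add' f g := by ext x; by_cases h : ∀ p, (x p).isLeft <;> simp [h]
  map_smul' t f := by
    ext x
    by_cases h : ∀ p, (x p).isLeft <;> simp [h, smul_comm t (idem lam nu _)]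

theorem cubeVec_apply (v : V) (x : Word n i) :
    cubeVec lam nu i V v x = fullPath lam nu x • idem lam nu (base ∘ x) • v := rfl

theorem vertexVec_apply (v : V) (x : Word n i) : vertexVec lam nu i V v x =
    if ∀ p, (x p).isLeft then idem lam nu (src ∘ x) • v else 0 := rfl

theorem wideMus_apply (f : Word n i → V) {L : List (Fin n)} (hL : L.Nodup) (x : Word n i) :
    wideMus lam nu i V L f x = pathElem lam nu x L •
      f fun p => if p ∈ L then Sum.inl (base (x p)) else x p := by
  induction L generalizing f with
  | nil => simp [wideMus, pathElem]
  | cons q L ih =>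
    rw [List.nodup_cons] at hL
    rw [wideMus, LinearMap.comp_apply, ih _ hL.2, wideMu_apply, pathElem, mul_smul, if_neg hL.1]
    congr 3
    ext1 p
    by_cases hp : p = q
    · subst hp; simp
    · simp [hp]

/-- The explicit path description serves the computation of the algebra action, the operator
description serves the bijectivity. This is the link between the two. -/
theorem wideMus_vertexVec (v : V) :
    wideMus lam nu i V (List.finRange n) (vertexVec lam nu i V v) = cubeVec lam nu i V v := by
  ext x
  rw [wideMus_apply _ (List.nodup_finRange n), cubeVec_apply, vertexVec_apply, if_pos (by simp)]
  congr 3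
  ext p
  simp [src]

theorem vertexVec_isGraded (v : V) : IsGraded lam nu (vertexVec (n := n) lam nu i V v) := by
  intro x
  rw [vertexVec_apply]
  split_ifs
  · rw [smul_smul, idem_mul_self]
  · simp

theorem vertexVec_injective : Function.Injective (vertexVec (n := n) lam nu i V) := by
  intro v v' h
  rw [← sum_idem_smul (n := n) (lam := lam) (nu := nu) v,
    ← sum_idem_smul (n := n) (lam := lam) (nu := nu) v']
  refine Finset.sum_congr rfl fun j _ => ?_
  have := congrFun h (Sum.inl ∘ j)
  rw [vertexVec_apply, vertexVec_apply, if_pos (by simp), if_pos (by simp)] at this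
  exact this

/-- The preimage is the sum of the values of `f` on the words of vertices. The idempotents recover
the individual values because `f` is graded. -/
theorem exists_vertexVec {f : Word n i → V} (hf : IsGraded lam nu f)
    (h : ∀ x, ∀ p, (x p).isRight → f x = 0) : ∃ v, vertexVec lam nu i V v = f := by
  refine ⟨∑ j : Fin n → I, f (Sum.inl ∘ j), ?_⟩
  ext x
  rw [vertexVec_apply]
  split_ifs with hx
  · have hx' : x = Sum.inl ∘ (src ∘ x) := by
      ext1 p
      obtain ⟨v, hv⟩ := Sum.isLeft_iff.1 (hx p)
      simp [hv, src]
    rw [Finset.smul_sum, Finset.sum_eq_single (src ∘ x), ← hx', hf]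
    · intro j _ hj
      rw [← hf, smul_smul, idem_mul_ne, zero_smul]
      exact fun e => hj e.symm
    · simp
  · push Not at hx
    obtain ⟨p, hp⟩ := hx
    exact (h x p (by simpa using hp)).symm

theorem commute_pathElem_erase (hi : IsEmpty (i ⟶ i)) (l : Fin n) (u : Letter i) (x : Word n i) :
    Commute (stepElem lam nu l u) (pathElem lam nu x ((List.finRange n).erase l)) := by
  refine commute_pathElem lam nu x _ fun p hp => stepElem_commute lam nu hi ?_ _ _
  rintro rfl
  exact (List.nodup_finRange n).not_mem_erase hp

theorem notMem_erase_finRange (l : Fin n) : l ∉ (List.finRange n).erase l :=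
  (List.nodup_finRange n).not_mem_erase

theorem mem_erase_finRange {l m : Fin n} : m ∈ (List.finRange n).erase l ↔ m ≠ l := by
  rw [(List.nodup_finRange n).mem_erase_iff]
  simp

variable (lam nu) in
/-- The path of a word with the position `l` left out. -/
noncomputable def pathOff (x : Word n i) (l : Fin n) : WAlg n lam nu :=
  pathElem lam nu x ((List.finRange n).erase l)

theorem pathOff_update (x : Word n i) (l : Fin n) (u : Letter i) :
    pathOff lam nu (Function.update x l u) l = pathOff lam nu x l :=
  pathElem_update lam nu x (notMem_erase_finRange l) u

theorem cubeVec_split (hi : IsEmpty (i ⟶ i)) (v : V) (x : Word n i) (l : Fin n) :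
    cubeVec lam nu i V v x =
      stepElem lam nu l (x l) • pathOff lam nu x l • idem lam nu (base ∘ x) • v := by
  rw [cubeVec_apply, fullPath_split lam nu hi x l, ← (commute_pathElem_erase hi l _ x).eq, mul_smul]
  rfl

theorem pathOff_idem (x : Word n i) (l : Fin n) (j : Fin n → I)
    (h : ∀ p ≠ l, j p = base (x p)) : pathOff lam nu x l * idem lam nu j =
      idem lam nu (Function.update (src ∘ x) l (j l)) * pathOff lam nu x l := by
  rw [pathOff, pathElem_idem _ _ _ _ ((List.nodup_finRange n).erase l) _ fun p hp =>
    h p (mem_erase_finRange.1 hp)]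
  congr 2
  ext p
  by_cases hp : p = l
  · subst hp; simp [mem_erase_finRange]
  · simp [hp]

theorem pathOff_eq_zero {x : Word n i} {l p : Fin n} (hp : p ≠ l) (h : x p = Sum.inl i) :
    pathOff lam nu x l = 0 :=
  pathElem_eq_zero lam nu (mem_erase_finRange.2 hp) h

theorem cubeVec_isGraded (v : V) : IsGraded lam nu (cubeVec (n := n) lam nu i V v) := by
  intro x
  have : fullPath lam nu x * idem lam nu (base ∘ x) = idem lam nu (src ∘ x) * fullPath lam nu x := by
    rw [fullPath, pathElem_idem _ _ _ _ (List.nodup_finRange n) (base ∘ x) fun p _ => rfl]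
    congr 2
    ext p
    simp
  rw [cubeVec_apply, smul_smul (fullPath lam nu x), this, smul_smul, ← mul_assoc, idem_mul_self]

/-- Split off the factor at `p`. Then `π_p` meets `∑ ε(r) r_p r*_p` on a vector that has the vertex
`i` at `p`, and relation (i) gives `λᵢ` plus transpositions with other positions of vertex `i`. The
remaining path leaves no such position. -/
theorem cubeVec_mem (hi : IsEmpty (i ⟶ i)) (v : V) :
    cubeVec lam nu i V v ∈ doubleCarrier (n := n) lam nu i V := by
  refine ⟨cubeVec_isGraded v, fun x m h => ?_, fun x p s h => ?_⟩
  · rw [cubeVec_split hi v x m, h, stepElem_inl_self, zero_smul]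
  · have hb : base (x p) = i := by rw [h]; rfl
    set z := pathOff lam nu x p • idem lam nu (base ∘ x) • v with hz
    have e1 (r : InEdge i) : cubeVec lam nu i V v (Function.update x p (Sum.inr r)) =
        sgn k r.1 • edge lam nu (star r.1) p • z := by
      rw [cubeVec_split hi v _ p, Function.update_self, stepElem_inr, pathOff_update,
        base_update_inr _ _ _ hb, smul_assoc]
    have hz' : idem lam nu (Function.update (src ∘ x) p i) • z = z := by
      have := pathOff_idem (lam := lam) (nu := nu) x p (base ∘ x) fun _ _ => rfl
      rw [hz, smul_smul (pathOff lam nu x p), this, Function.comp_apply, hb, smul_smul, ← mul_assoc,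
        idem_mul_self]
    have e2 := rel_i_mod z _ hz' p
    rw [Function.update_self, ← sum_inEdge, Finset.sum_eq_zero (s := Finset.univ.filter _)] at e2
    · simp only [e1, smul_comm (_ : WAlg n lam nu) (_ : k), e2]
      rw [smul_zero, add_zero, smul_comm (_ : WAlg n lam nu) (_ : k), smul_comm (_ : k) (lam i),
        cubeVec_split hi v x p, h, stepElem_inr, smul_assoc]
    -- A second position with `src` equal to `i` must carry the letter `i` itself. Its factor in the
    -- path is `0` by the convention in `stepElem`.
    · intro m hm
      simp only [Finset.mem_filter, Finset.mem_univ, true_and] at hm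
      obtain ⟨hmp, hm⟩ := hm
      rw [Function.update_of_ne hmp] at hm
      rw [hz, pathOff_eq_zero hmp, zero_smul, smul_zero]
      rcases hxm : x m with w | r
      · rw [Function.comp_apply, hxm] at hm; exact congrArg _ hm
      · rw [Function.comp_apply, hxm] at hm; exact absurd hm (tail_ne hi r.2)

theorem widePis_cubeVec (hi : IsEmpty (i ⟶ i)) (v : V) :
    widePis lam nu i V (List.finRange n) (cubeVec lam nu i V v) =
      jmOps lam nu i V (List.finRange n) (vertexVec lam nu i V v) := by
  rw [← wideMus_vertexVec, widePis_wideMus hi (vertexVec_isGraded v) (List.nodup_finRange n)]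
  · intro x m _ hm
    rw [vertexVec_apply, if_neg]
    intro h
    have := h m
    rw [Sum.isRight_iff] at hm
    obtain ⟨s, hs⟩ := hm
    simp [hs] at this
  · intro x m hm
    exact absurd (List.mem_finRange m) hm

/-- Applying the product of the `π` turns `cubeVec v` into an invertible operator applied to
`vertexVec v`, from which `v` can be read off. -/
theorem cubeVec_injective (hi : IsEmpty (i ⟶ i))
    (h : ∀ q < n, IsUnit (swapElement q (lam i) nu)) :
    Function.Injective (cubeVec (n := n) lam nu i V) := by
  intro v v' hv
  obtain ⟨S, hS, -, -⟩ := jmOps_inverse (V := V) h (List.nodup_finRange n)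
  have e := congrArg (fun f => S (widePis lam nu i V (List.finRange n) f)) hv
  simp only [widePis_cubeVec hi] at e
  have hS' (f : Word n i → V) : S (jmOps lam nu i V (List.finRange n) f) = f :=
    LinearMap.congr_fun hS f
  rw [hS', hS'] at e
  exact vertexVec_injective e

/-- The operator `jmOps` is undone first, by `S`. Since `S f` is again in `doubleCarrier`, the
product of the `π` maps it to the required vector, and the product of the `μ` returns `jmOps (S f) =
f`. -/
theorem exists_cubeVec (hi : IsEmpty (i ⟶ i))
    (h : ∀ q < n, IsUnit (swapElement q (lam i) nu)) {f : Word n i → V}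
    (hf : f ∈ doubleCarrier lam nu i V) : ∃ v, cubeVec lam nu i V v = f := by
  obtain ⟨S, -, hS, hU⟩ := jmOps_inverse (V := V) h (List.nodup_finRange n)
  have hSf := hU (doubleCarrier lam nu i V) (fun s _ hg => permOp_mem_doubleCarrier s hg)
    (fun j _ hg => cut_mem_doubleCarrier (· = j) hg) f hf
  obtain ⟨v, hv⟩ := exists_vertexVec (IsGraded.widePis hSf.1 (List.finRange n)) fun x p hp => by
    obtain ⟨s, hs⟩ := Sum.isRight_iff.1 hp
    exact widePis_inr _ (List.mem_finRange p) x hs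
  refine ⟨v, ?_⟩
  rw [← wideMus_vertexVec, hv, wideMus_widePis hi hSf (List.nodup_finRange n)]
  exact LinearMap.congr_fun hS f

theorem cubeVec_idem (j : Fin n → I) (v : V) (x : Word n i) :
    cubeVec lam nu i V (idem lam nu j • v) x = if base ∘ x = j then cubeVec lam nu i V v x else 0 := by
  rw [cubeVec_apply, cubeVec_apply, smul_smul (idem lam nu (base ∘ x))]
  split_ifs with h
  · rw [h, idem_mul_self]
  · rw [idem_mul_ne _ _ h, zero_smul, smul_zero]

theorem cubeVec_perm (hi : IsEmpty (i ⟶ i)) (s : Equiv.Perm (Fin n)) (v : V) (x : Word n i) :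
    cubeVec lam nu i V (perm lam nu s • v) x = perm lam nu s • cubeVec lam nu i V v (x ∘ s) := by
  rw [cubeVec_apply, cubeVec_apply, smul_smul (idem lam nu (base ∘ x)), idem_perm, smul_smul,
    ← mul_assoc, ← perm_fullPath lam nu hi, smul_smul, smul_smul, mul_assoc, mul_assoc,
    Function.comp_assoc]

theorem cubeVec_edge_eq_zero (a : DEdge I) (l : Fin n) (v : V) (x : Word n i)
    (h : base (x l) ≠ head a) : cubeVec lam nu i V (edge lam nu a l • v) x = 0 := by
  rw [cubeVec_apply, smul_smul (idem lam nu _), idem_edge,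
    if_neg (show (base ∘ x) l ≠ head a from h), zero_smul, smul_zero]

theorem cubeVec_edge (hi : IsEmpty (i ⟶ i)) (a : DEdge I) (l : Fin n) (v : V) (x : Word n i)
    (h : base (x l) = head a) : cubeVec lam nu i V (edge lam nu a l • v) x =
      stepElem lam nu l (x l) • pathOff lam nu x l • edge lam nu a l •
        idem lam nu (Function.update (base ∘ x) l (tail a)) • v := by
  rw [cubeVec_split hi _ _ l, smul_smul (idem lam nu _), idem_edge,
    if_pos (show (base ∘ x) l = head a from h), mul_smul]

theorem commute_edge_pathOff (a : DEdge I) (ha : head a ≠ i) (x : Word n i) (l : Fin n) :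
    Commute (edge lam nu a l) (pathOff lam nu x l) := by
  refine commute_pathElem lam nu x _ fun p hp => commute_edge_stepElem lam nu ?_ a ha _
  exact (mem_erase_finRange.1 hp).symm

theorem cubeVec_edge_off (hi : IsEmpty (i ⟶ i)) (a : DEdge I) (h : head a ≠ i) (h' : tail a ≠ i)
    (l : Fin n) (v : V) (x : Word n i) : cubeVec lam nu i V (edge lam nu a l • v) x =
      if x l = Sum.inl (head a) then
        edge lam nu a l • cubeVec lam nu i V v (Function.update x l (Sum.inl (tail a))) else 0 := by
  split_ifs with hx
  · rw [cubeVec_edge hi _ _ _ _ (by rw [hx]; rfl), hx, stepElem_inl _ _ _ h, one_smul,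
      cubeVec_split hi _ _ l, Function.update_self, stepElem_inl _ _ _ h', one_smul, pathOff_update,
      comp_update', smul_smul (pathOff lam nu x l), ← (commute_edge_pathOff a h x l).eq, mul_smul]
    rfl
  · refine cubeVec_edge_eq_zero a l v x fun e => hx ?_
    rcases hxl : x l with u | s
    · rw [hxl] at e; exact congrArg _ e
    · rw [hxl] at e; exact absurd e.symm h

/-- The edge `r*_ℓ` commutes with the path off `ℓ` and is, up to the sign `ε(r)`, the factor at `ℓ`
of the word with the letter `r` there. So the action of `r*` becomes `ε(r) τ^!_{r,ℓ}`. -/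
theorem cubeVec_edge_out (hi : IsEmpty (i ⟶ i)) (r : InEdge i) (l : Fin n) (v : V) (x : Word n i) :
    cubeVec lam nu i V (edge lam nu (star r.1) l • v) x =
      if x l = Sum.inl (tail r.1) then
        sgn k r.1 • cubeVec lam nu i V v (Function.update x l (Sum.inr r)) else 0 := by
  have hr := tail_ne hi r.2
  split_ifs with hx
  · rw [cubeVec_edge hi _ _ _ _ (by rw [hx, head_star]; rfl), hx, stepElem_inl _ _ _ hr, one_smul,
      cubeVec_split hi _ _ l, Function.update_self, stepElem_inr, pathOff_update, comp_update',
      smul_assoc, smul_smul (sgn k _), sgn_mul_self, one_smul,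
      smul_smul (pathOff lam nu x l), ← (commute_edge_pathOff (star r.1) (by rwa [head_star]) x l).eq,
      mul_smul, tail_star, r.2]
    rfl
  · refine cubeVec_edge_eq_zero _ l v x fun e => hx ?_
    rw [head_star] at e
    rcases hxl : x l with u | s
    · rw [hxl] at e; exact congrArg _ e
    · rw [hxl] at e; exact absurd e.symm hr

theorem cubeVec_edge_in_inl (hi : IsEmpty (i ⟶ i)) (r : InEdge i) (l : Fin n) (v : V) (x : Word n i)
    {u : I} (hx : x l = Sum.inl u) : cubeVec lam nu i V (edge lam nu r.1 l • v) x = 0 := by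
  by_cases hu : u = i
  · exact (cubeVec_mem hi _).2.1 x l (by rw [hx, hu])
  · refine cubeVec_edge_eq_zero _ l v x ?_
    rw [hx, r.2]
    exact hu

/-- The edge `r_ℓ` is moved through the path off `ℓ` by `edge_pathElem`. Compared with the formula
for `θ_{r,ℓ}` the scalar term is missing: `μ_ℓ π_ℓ` and the transpositions are present, `-λᵢ` is
not. -/
theorem cubeVec_edge_in_inr (hi : IsEmpty (i ⟶ i)) (r : InEdge i) (l : Fin n) (v : V) (x : Word n i)
    {s : InEdge i} (hx : x l = Sum.inr s) : cubeVec lam nu i V (edge lam nu r.1 l • v) x =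
      sgn k s.1 • edge lam nu (star s.1) l • edge lam nu r.1 l •
        cubeVec lam nu i V v (Function.update x l (Sum.inl (tail r.1))) +
      nu • ∑ m with m ≠ l ∧ x m = Sum.inr r, perm lam nu (Equiv.swap m l) • cubeVec lam nu i V v
        (Function.update (Function.update x m (Sum.inr s)) l (Sum.inl (tail r.1))) := by
  have hr := tail_ne hi r.2
  have hL := (List.nodup_finRange n).erase l
  set j := Function.update (base ∘ x) l (tail r.1) with hj
  have e1 : cubeVec lam nu i V v (Function.update x l (Sum.inl (tail r.1))) =
      pathOff lam nu x l • idem lam nu j • v := by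
    rw [cubeVec_split hi _ _ l, Function.update_self, stepElem_inl _ _ _ hr, one_smul, pathOff_update,
      comp_update']
    rfl
  -- The word on the left is `y ∘ s_{mℓ}`, where `y` keeps `s` at `ℓ` and has `t(r)` in place of `r`
  -- at `m`. Equivariance of `cubeVec` therefore yields the path of `y`, with its factor at `m`
  -- deleted.
  have e2 (m : Fin n) (hml : m ≠ l) (hm : x m = Sum.inr r) :
      perm lam nu (Equiv.swap m l) • cubeVec lam nu i V v
        (Function.update (Function.update x m (Sum.inr s)) l (Sum.inl (tail r.1))) =
      stepElem lam nu l (Sum.inr s) •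
        pathOff lam nu (Function.update x m (Sum.inl (tail r.1))) l •
          perm lam nu (Equiv.swap m l) • idem lam nu j • v := by
    set y := Function.update x m (Sum.inl (tail r.1)) with hy
    have hyz : y ∘ Equiv.swap m l =
        Function.update (Function.update x m (Sum.inr s)) l (Sum.inl (tail r.1)) := by
      ext1 p
      simp only [Function.comp_apply, Equiv.swap_apply_def, hy]
      split_ifs with h h'
      · rw [h, Function.update_of_ne hml.symm, Function.update_of_ne hml, Function.update_self, hx]
      · rw [h', Function.update_self, Function.update_self]
      · rw [Function.update_of_ne h, Function.update_of_ne h', Function.update_of_ne h]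
    rw [← hyz, ← cubeVec_perm hi, cubeVec_split hi _ _ l, smul_smul (idem lam nu _), idem_perm,
      Function.comp_assoc, hyz, mul_smul]
    have hb : base ∘ Function.update (Function.update x m (Sum.inr s)) l (Sum.inl (tail r.1)) = j := by
      rw [comp_update', base_update_inr _ _ _ (by rw [hm]; rfl)]
      rfl
    rw [hb, show y l = Sum.inr s by rw [hy, Function.update_of_ne hml.symm, hx]]
  have e3 := edge_pathElem lam nu r hr x l _ hL (notMem_erase_finRange l) j
    (by rw [hj, Function.update_self])
    (fun p hp => by rw [hj, Function.update_of_ne (mem_erase_finRange.1 hp)]; rfl)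
  have e4 := congrArg (· • v) e3
  simp only [add_smul, mul_smul, smul_assoc] at e4
  rw [cubeVec_edge hi _ _ _ _ (by rw [hx, r.2]; rfl), hx, ← hj, pathOff, e4, smul_add, e1]
  congr 1
  · rw [stepElem_inr, smul_assoc]
    rfl
  · rw [smul_comm _ nu, ← List.sum_toFinset _ hL, Finset.sum_smul, Finset.smul_sum, Finset.sum_filter]
    congr 1
    have hF : ((List.finRange n).erase l).toFinset = Finset.univ.erase l := by
      ext m
      simp [mem_erase_finRange]
    rw [hF, ← Finset.sum_erase (a := l) Finset.univ (by simp)]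
    refine Finset.sum_congr rfl fun m hm => ?_
    have hml : m ≠ l := Finset.ne_of_mem_erase hm
    by_cases hxm : x m = Sum.inr r
    · rw [if_pos hxm, if_pos ⟨hml, hxm⟩, e2 m hml hxm, mul_smul, mul_smul]
      rfl
    · rw [if_neg hxm, if_neg (fun h => hxm h.2), zero_smul, smul_zero]

end CubeVec

/-! ### Linearity from generators, and the generators on `F_i(V)`. -/

section ModuleFacts

variable {lam : I → k} {nu : k} {i : I}
variable {V : Type w} [AddCommGroup V] [Module k V] [Module (WAlg n lam nu) V]
variable [IsScalarTower k (WAlg n lam nu) V]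

/-- The algebra is a quotient of the free `k`-algebra on the three kinds of generators, so a
`k`-linear map that commutes with these is linear over it. -/
theorem map_smul_of_generators {W : Type w} [AddCommGroup W] [Module k W]
    [Module (WAlg n lam nu) W] [IsScalarTower k (WAlg n lam nu) W] (φ : V →ₗ[k] W)
    (hI : ∀ (j : Fin n → I) v, φ (idem lam nu j • v) = idem lam nu j • φ v)
    (hE : ∀ a (l : Fin n) v, φ (edge lam nu a l • v) = edge lam nu a l • φ v)
    (hP : ∀ (s : Equiv.Perm (Fin n)) v, φ (perm lam nu s • v) = perm lam nu s • φ v) (c : WAlg n lam nu) (v : V) :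
    φ (c • v) = c • φ v := by
  obtain ⟨c, rfl⟩ := RingQuot.mkAlgHom_surjective k (Rel n lam nu) c
  change φ (mk n lam nu c • v) = mk n lam nu c • φ v
  induction c using FreeAlgebra.induction generalizing v with
  | grade0 r =>
    rw [AlgHom.commutes, algebraMap_smul, algebraMap_smul, map_smul]
  | grade1 x =>
    cases x with
    | idem j => exact hI j v
    | edge a l => exact hE a l v
    | perm s => exact hP s v
  | mul a b ha hb => rw [map_mul, mul_smul, mul_smul, ha, hb]
  | add a b ha hb => rw [map_add, add_smul, add_smul, map_add, ha, hb]

variable {lam' : I → k} (hi : IsEmpty (i ⟶ i)) (h : lam' = reflect i lam)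

instance : IsScalarTower k (WAlg n lam' nu) (ReflObj nu V n hi h) where
  smul_assoc t c f := by
    change reflHom V hi h (t • c) f = t • reflHom V hi h c f
    rw [map_smul]
    rfl

variable {hi h}

/-- The function on words that underlies an element of `F_i(V)`. -/
def wordFun (f : ReflObj nu V n hi h) : Word n i → V := Subtype.val (p := (· ∈ reflCarrier lam nu i V)) f

theorem wordFun_mem (f : ReflObj nu V n hi h) : wordFun f ∈ reflCarrier lam nu i V := f.2

theorem wordFun_injective : Function.Injective (wordFun (n := n) (V := V) (nu := nu) (hi := hi) (h := h)) :=
  Subtype.val_injective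

theorem wordFun_idem (j : Fin n → I) (f : ReflObj nu V n hi h) :
    wordFun (idem lam' nu j • f) = idemOp (k := k) i j (wordFun f) := by
  change (reflHom V hi h (mk n lam' nu (gIdem k j)) f).1 = _
  rw [reflHom_mk, FreeAlgebra.lift_ι_apply]
  rfl

theorem wordFun_edge (a : DEdge I) (l : Fin n) (f : ReflObj nu V n hi h) :
    wordFun (edge lam' nu a l • f) = edgeOp lam nu i V a l (wordFun f) := by
  change (reflHom V hi h (mk n lam' nu (gEdge k a l)) f).1 = _
  rw [reflHom_mk, FreeAlgebra.lift_ι_apply]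
  rfl

theorem wordFun_perm (s : Equiv.Perm (Fin n)) (f : ReflObj nu V n hi h) :
    wordFun (perm lam' nu s • f) = permOp lam nu i V s (wordFun f) := by
  change (reflHom V hi h (mk n lam' nu (gPerm k I s)) f).1 = _
  rw [reflHom_mk, FreeAlgebra.lift_ι_apply]
  rfl

end ModuleFacts

/-! ### The twofold reflection and its identification with `doubleCarrier`. -/

section DoubleReflection

variable {lam lam' : I → k} {nu : k} {i : I}
variable {V : Type w} [AddCommGroup V] [Module k V] [Module (WAlg n lam nu) V]
variable [IsScalarTower k (WAlg n lam nu) V]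
variable {hi : IsEmpty (i ⟶ i)} {h : lam' = reflect i lam}
variable {X : Type w} [AddCommGroup X] [Module k X] [Module (WAlg n lam' nu) X]
variable [IsScalarTower k (WAlg n lam' nu) X]
variable (e : X ≃ₗ[WAlg n lam' nu] ReflObj nu V n hi h)

/-- The function on words that corresponds to an element of a module isomorphic to `F_i(V)`. -/
noncomputable def coord : X →ₗ[k] (Word n i → V) where
  toFun ξ := wordFun (e ξ)
  map_add' ξ η := by rw [map_add]; rfl
  map_smul' t ξ := by
    rw [← algebraMap_smul (WAlg n lam' nu) t ξ, map_smul, algebraMap_smul]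
    rfl

theorem coord_injective : Function.Injective (coord e) :=
  wordFun_injective.comp e.injective

theorem coord_mem (ξ : X) : coord e ξ ∈ reflCarrier lam nu i V := wordFun_mem _

theorem exists_coord {f : Word n i → V} (hf : f ∈ reflCarrier lam nu i V) : ∃ ξ, coord e ξ = f :=
  ⟨e.symm (⟨f, hf⟩ : reflCarrier (n := n) lam nu i V), congrArg wordFun (e.apply_symm_apply _)⟩

theorem coord_idem (j : Fin n → I) (ξ : X) :
    coord e (idem lam' nu j • ξ) = idemOp (k := k) i j (coord e ξ) := by
  change wordFun (e _) = _
  rw [map_smul, wordFun_idem]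
  rfl

theorem coord_edge (a : DEdge I) (l : Fin n) (ξ : X) :
    coord e (edge lam' nu a l • ξ) = edgeOp lam nu i V a l (coord e ξ) := by
  change wordFun (e _) = _
  rw [map_smul, wordFun_edge]
  rfl

theorem coord_perm (s : Equiv.Perm (Fin n)) (ξ : X) :
    coord e (perm lam' nu s • ξ) = permOp lam nu i V s (coord e ξ) := by
  change wordFun (e _) = _
  rw [map_smul, wordFun_perm]
  rfl

/-- The function that is `v` on the word of vertices `j`, and zero on the other words. -/
def pointVec (i : I) (j : Fin n → I) (v : V) : Word n i → V := fun y => if y = Sum.inl ∘ j then v else 0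

theorem pointVec_apply (j : Fin n → I) (v : V) (y : Word n i) :
    pointVec i j v y = if y = Sum.inl ∘ j then v else 0 := rfl

/-- For `j` without the vertex `i` the set `Δ(j)` is empty, so there is no kernel condition and
`V'_j = V_j`. -/
theorem pointVec_mem (j : Fin n → I) (hj : ∀ m, j m ≠ i) (v : V) (hv : idem lam nu j • v = v) :
    pointVec i j v ∈ reflCarrier lam nu i V := by
  refine ⟨fun y => ?_, fun y m hm => ?_, fun p => ?_⟩
  · rw [pointVec_apply]
    split_ifs with hy
    · rw [hy]; exact hv
    · simp
  · rw [pointVec_apply, if_neg]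
    rintro rfl
    exact hj m (Sum.inl.inj hm)
  · ext y
    rw [piOp_apply]
    split_ifs
    · refine Finset.sum_eq_zero fun r _ => ?_
      rw [pointVec_apply, if_neg, smul_zero]
      intro hy
      simpa using congrFun hy p
    · rfl

/-- The relation between the elements `S` of `F_i(F_i(V))` and the elements `g` of
`doubleCarrier`. -/
def IsSpread (S : Word n i → X) (g : Word n i → V) : Prop :=
  ∀ x, coord e (S x) = pointVec i (src ∘ x) (g x)

variable {e}

/-- This uniqueness makes the choice in `toDouble` harmless: every property of that map is checked
on the functions `g`. -/
theorem IsSpread.eq {S S' : Word n i → X} {g : Word n i → V} (hS : IsSpread e S g)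
    (hS' : IsSpread e S' g) : S = S' :=
  funext fun x => coord_injective e ((hS x).trans (hS' x).symm)

theorem update_eq_inl_comp_iff (y : Word n i) (x : Word n i) (p : Fin n) (u : Letter i) :
    Function.update y p (Sum.inl (src u)) = Sum.inl ∘ src ∘ Function.update x p u ↔
      ∀ m ≠ p, y m = Sum.inl (src (x m)) := by
  constructor
  · intro h m hm
    have := congrFun h m
    simpa [hm] using this
  · intro h
    ext1 m
    by_cases hm : m = p
    · subst hm; simp
    · simp [hm, h m hm]

/-- The transposition terms of `θ_{r,p}` evaluate the function at words with a letter of `R` at a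
position other than `p`, and a point vector vanishes there. Only `-λᵢ + μ_p π_p` remains. -/
theorem theta_pointVec (r s : InEdge i) (p : Fin n) (j : Fin n → I) (v : V) (z : Word n i)
    (hz : z p = Sum.inr s) : theta lam nu V r p (pointVec i j v) z =
      if Function.update z p (Sum.inl (tail r.1)) = Sum.inl ∘ j then
        (if s = r then -(lam i • v) else 0) +
          sgn k s.1 • edge lam nu (star s.1) p • edge lam nu r.1 p • v else 0 := by
  rw [theta_apply_inr _ _ _ _ _ hz, Finset.sum_eq_zero, smul_zero, add_zero, pointVec_apply]
  · split_ifs <;> simp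
  · intro m hm
    simp only [Finset.mem_filter, Finset.mem_univ, true_and] at hm
    rw [pointVec_apply, if_neg, smul_zero]
    intro hy
    have := congrFun hy m
    simp [hm.1] at this

/-- This is the map `π_p` of the second reflection, written in terms of `g`: it computes `μ_p π_p g
- λᵢ g`. Its vanishing is the defining equation of `doubleCarrier`. -/
theorem IsSpread.coord_sum {S : Word n i → X} {g : Word n i → V} (hS : IsSpread e S g)
    (p : Fin n) (y z : Word n i) {s : InEdge i} (hz : z p = Sum.inr s) :
    coord e (∑ r : InEdge i, edge lam' nu r.1 p • S (Function.update y p (Sum.inr r))) z =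
      if ∀ m ≠ p, z m = Sum.inl (src (y m)) then
        -(lam i • g (Function.update y p (Sum.inr s))) +
          sgn k s.1 • edge lam nu (star s.1) p • ∑ r : InEdge i, edge lam nu r.1 p •
            g (Function.update y p (Sum.inr r)) else 0 := by
  have h1 (r : InEdge i) := theta_pointVec (lam := lam) (nu := nu) r s p
    (src ∘ Function.update y p (Sum.inr r)) (g (Function.update y p (Sum.inr r))) z hz
  simp only [show ∀ r : InEdge i, tail r.1 = src (Sum.inr r) from fun _ => rfl,
    update_eq_inl_comp_iff] at h1
  simp only [map_sum, Finset.sum_apply, coord_edge, edgeOp_in, hS _, h1]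
  split_ifs
  · rw [Finset.sum_add_distrib]
    simp [Finset.smul_sum]
  · simp

theorem src_eq_self (hi : IsEmpty (i ⟶ i)) {u : Letter i} (h : src u = i) : u = Sum.inl i := by
  rcases u with v | r
  · exact congrArg _ h
  · exact absurd h (tail_ne hi r.2)

theorem exists_isSpread {g : Word n i → V} (hg : g ∈ doubleCarrier lam nu i V) :
    ∃ S ∈ reflCarrier lam' nu i X, IsSpread e S g := by
  -- If a letter of `x` is `i`, then `g x = 0`. Otherwise the vertex `i` does not occur in `src ∘
  -- x`, as `i` has no edge-loop.
  have hmem (x : Word n i) : pointVec i (src ∘ x) (g x) ∈ reflCarrier lam nu i V := by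
    by_cases hx : ∃ m, x m = Sum.inl i
    · obtain ⟨m, hm⟩ := hx
      have : pointVec i (src ∘ x) (g x) = 0 := by
        ext y
        rw [pointVec_apply, hg.2.1 x m hm, ite_self]
        rfl
      rw [this]
      exact zero_mem _
    · exact pointVec_mem _ (fun m hm => hx ⟨m, src_eq_self hi hm⟩) _ (hg.1 x)
  choose S hS using fun x => exists_coord e (hmem x)
  have hS' : IsSpread e S g := hS
  refine ⟨S, ⟨fun x => coord_injective e ?_, fun x m hm => coord_injective e ?_, fun p => ?_⟩, hS⟩
  · rw [coord_idem, hS]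
    ext y
    rw [idemOp_apply, pointVec_apply, ite_eq_left_iff]
    intro hy
    rw [if_neg]
    rintro rfl
    exact hy rfl
  · rw [hS, map_zero, hg.2.1 x m hm]
    ext y
    rw [pointVec_apply, ite_self]
    rfl
  · ext1 y
    rw [piOp_apply]
    split_ifs with hy
    · refine coord_injective e ?_
      ext z
      rw [Pi.zero_apply, map_zero, Pi.zero_apply]
      rcases hz : z p with v | s
      · simp only [map_sum, coord_edge, edgeOp_in, Finset.sum_apply]
        exact Finset.sum_eq_zero fun r _ => theta_apply_inl _ _ _ _ v hz
      · rw [hS'.coord_sum p y z hz]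
        have := hg.2.2 (Function.update y p (Sum.inr s)) p s (Function.update_self _ _ _)
        simp only [Function.update_idem] at this
        rw [this, neg_add_cancel, ite_self]
    · rfl

/-- The grading places `S x` in the component of `F_i(V)` of degree `src ∘ x`. A nonzero `S x` has
no `i` in this degree, so it is determined by its value at the word of vertices `src ∘ x`, and this
value is taken as `g x`. -/
theorem exists_doubleCarrier {S : Word n i → X} (hS : S ∈ reflCarrier lam' nu i X) :
    ∃ g ∈ doubleCarrier lam nu i V, IsSpread e S g := by
  have hS0 (x : Word n i) : idemOp (k := k) i (src ∘ x) (coord e (S x)) = coord e (S x) := by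
    rw [← coord_idem, hS.1]
  have hsp : IsSpread e S fun x => coord e (S x) (Sum.inl ∘ src ∘ x) := by
    intro x
    ext y
    rw [pointVec_apply]
    split_ifs with hy
    · rw [hy]
    · by_cases hb : base ∘ y = src ∘ x
      · have : ∃ m, (y m).isRight := by
          by_contra hcon
          push Not at hcon
          refine hy (funext fun m => ?_)
          have hm := congrFun hb m
          rcases hym : y m with v | s
          · rw [Function.comp_apply, hym] at hm; exact congrArg _ hm
          · exact absurd (hcon m) (by rw [hym]; simp)
        obtain ⟨m, hm⟩ := this
        obtain ⟨s, hs⟩ := Sum.isRight_iff.1 hm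
        have hm := congrFun hb m
        rw [Function.comp_apply, hs] at hm
        rw [hS.2.1 x m (src_eq_self hi hm.symm), map_zero]
        rfl
      · rw [← hS0, idemOp_apply, if_neg hb]
  refine ⟨_, ⟨fun x => ?_, fun x m hm => ?_, fun x p s hs => ?_⟩, hsp⟩
  · exact (coord_mem e (S x)).1 (Sum.inl ∘ src ∘ x)
  · rw [hS.2.1 x m hm, map_zero]
    rfl
  · have h1 := hsp.coord_sum p x (Function.update (Sum.inl ∘ src ∘ x) p (Sum.inr s))
      (Function.update_self _ _ _)
    rw [ker_eq hS, map_zero, Pi.zero_apply, if_pos fun m hm => by rw [Function.update_of_ne hm]; rfl,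
      eq_comm, neg_add_eq_zero] at h1
    rw [← h1, ← hs, Function.update_eq_self]

/-- The outer `θ_{r,ℓ}` contributes `-(r_iλ)_i = λᵢ`, and the edge `r` acting inside of its term
`μ_ℓ π_ℓ` is again a `θ`, which contributes `-λᵢ`. These cancel, and the formula of
`cubeVec_edge_in_inr` is left. -/
theorem IsSpread.theta {S : Word n i → X} {g g' : Word n i → V} (hS : IsSpread e S g)
    (r : InEdge i) (l : Fin n) (h0 : ∀ x v, x l = Sum.inl v → g' x = 0)
    (h1 : ∀ x s, x l = Sum.inr s → g' x =
      sgn k s.1 • edge lam nu (star s.1) l • edge lam nu r.1 l •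
        g (Function.update x l (Sum.inl (tail r.1))) +
      nu • ∑ m with m ≠ l ∧ x m = Sum.inr r, perm lam nu (Equiv.swap m l) • g
        (Function.update (Function.update x m (Sum.inr s)) l (Sum.inl (tail r.1)))) :
    IsSpread e (theta lam' nu X r l S) g' := by
  have hlam : lam' i = -lam i := by rw [h, reflect_self hi]
  intro x
  rcases hx : x l with v | s
  · rw [theta_apply_inl _ _ _ _ v hx, map_zero, h0 x v hx]
    ext y
    rw [pointVec_apply, ite_self]
    rfl
  set x₁ := Function.update x l (Sum.inl (tail r.1)) with hx₁
  ext y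
  rw [theta_apply_inr _ _ _ _ s hx, ← hx₁, pointVec_apply, h1 x s hx, ← hx₁]
  -- In `F_i(V)` the edge `r` acts by `θ_{r,ℓ}` and `s*` by `ε(s) τ^!_{s,ℓ}`; the latter sign
  -- cancels against the one in `μ_ℓ`.
  have t2 : coord e (sgn k s.1 • edge lam' nu (star s.1) l • edge lam' nu r.1 l • S x₁) y =
      if y = Sum.inl ∘ src ∘ x then (if s = r then -(lam i • g x₁) else 0) +
          sgn k s.1 • edge lam nu (star s.1) l • edge lam nu r.1 l • g x₁ else 0 := by
    rw [map_smul, coord_edge, edgeOp_out hi, coord_edge, edgeOp_in, hS, LinearMap.smul_apply,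
      smul_smul, sgn_mul_self, one_smul, tauUp, letterOp_apply, one_smul,
      theta_pointVec r s l _ _ _ (Function.update_self _ _ _), Function.update_idem, hx₁]
    have hu := update_eq_inl_comp_iff y x l (Sum.inl (tail r.1))
    rw [show src (Sum.inl (tail r.1) : Letter i) = tail r.1 from rfl] at hu
    rw [← ite_and]
    congr 1
    rw [hu]
    refine propext ⟨fun hy => funext fun m => ?_, fun hy => ?_⟩
    · by_cases hm : m = l
      · rw [hm, hy.1, Function.comp_apply, Function.comp_apply, hx]; rfl
      · exact hy.2 m hm
    · rw [hy]
      exact ⟨by simp [hx, src], fun m _ => rfl⟩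
  -- For `s = r` the degrees `src ∘ x₁` and `src ∘ x` agree, so this scalar term sits at the same
  -- word as the one in `t2`, with the opposite sign.
  have t1 : coord e (if s = r then -(lam' i • S x₁) else 0) y =
      if y = Sum.inl ∘ src ∘ x then if s = r then lam i • g x₁ else 0 else 0 := by
    by_cases hsr : s = r
    · have : src ∘ x₁ = src ∘ x := by
        rw [hx₁, comp_update', ← hsr]
        conv_rhs => rw [← Function.update_eq_self l (src ∘ x), Function.comp_apply, hx]
        rfl
      rw [if_pos hsr, hlam, neg_smul, neg_neg, map_smul, hS, Pi.smul_apply, pointVec_apply, this,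
        if_pos hsr, smul_ite, smul_zero]
    · rw [if_neg hsr, if_neg hsr, map_zero, ite_self]
      rfl
  have t3 (m : Fin n) (hm : m ≠ l ∧ x m = Sum.inr r) : coord e (perm lam' nu (Equiv.swap m l) •
      S (Function.update (Function.update x m (Sum.inr s)) l (Sum.inl (tail r.1)))) y =
      if y = Sum.inl ∘ src ∘ x then perm lam nu (Equiv.swap m l) • g
        (Function.update (Function.update x m (Sum.inr s)) l (Sum.inl (tail r.1))) else 0 := by
    rw [coord_perm, permOp_apply, hS, pointVec_apply, smul_ite, smul_zero]
    congr 1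
    have hz : src ∘ Function.update (Function.update x m (Sum.inr s)) l (Sum.inl (tail r.1)) =
        (src ∘ x) ∘ Equiv.swap m l := by
      ext1 p
      simp only [Function.comp_apply, Equiv.swap_apply_def]
      split_ifs with h h'
      · rw [h, Function.update_of_ne hm.1, Function.update_self, hx]
      · rw [h', Function.update_self, hm.2]; rfl
      · rw [Function.update_of_ne h', Function.update_of_ne h]
    rw [hz]
    refine propext ⟨fun hy => ?_, fun hy => by rw [hy]; rfl⟩
    have := congrArg (· ∘ Equiv.swap m l) hy
    simp only [Function.comp_assoc] at this
    ext1 p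
    simpa using congrFun this p
  rw [map_add, map_add, Pi.add_apply, Pi.add_apply, t1, t2, map_smul, map_sum, Pi.smul_apply,
    Finset.sum_apply, Finset.sum_congr rfl fun m hm => t3 m (Finset.mem_filter.1 hm).2]
  split_ifs <;> simp

theorem IsSpread.edgeOp {S : Word n i → X} {v : V} (hS : IsSpread e S (cubeVec lam nu i V v))
    (a : DEdge I) (l : Fin n) : IsSpread e (edgeOp lam' nu i X a l S)
      (cubeVec lam nu i V (edge lam nu a l • v)) := by
  rcases edge_cases i a with ⟨r, rfl⟩ | ⟨r, rfl⟩ | ⟨h1, h2⟩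
  · rw [edgeOp_in]
    exact hS.theta r l (fun x u hx => cubeVec_edge_in_inl hi r l v x hx)
      fun x s hx => cubeVec_edge_in_inr hi r l v x hx
  · intro x
    ext y
    rw [edgeOp_out hi, LinearMap.smul_apply, Pi.smul_apply, map_smul, tauUp, letterOp_apply,
      cubeVec_edge_out hi, pointVec_apply]
    split_ifs with hx hy hy
    · rw [one_smul, hS, Pi.smul_apply, pointVec_apply, if_pos]
      rw [hy, comp_update', show src (Sum.inr r) = (src ∘ x) l by simp [hx, src],
        Function.update_eq_self]
    · rw [one_smul, hS, Pi.smul_apply, pointVec_apply, if_neg, smul_zero]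
      rwa [comp_update', show src (Sum.inr r) = (src ∘ x) l by simp [hx, src],
        Function.update_eq_self]
    · simp
    · simp
  · intro x
    ext y
    rw [edgeOp_off a h1 h2, letterOp_apply, cubeVec_edge_off hi a h1 h2, pointVec_apply]
    have hu := update_eq_inl_comp_iff y x l (Sum.inl (tail a))
    rw [show src (Sum.inl (tail a) : Letter i) = tail a from rfl] at hu
    by_cases hx : x l = Sum.inl (head a)
    · rw [if_pos hx, if_pos hx, coord_edge, edgeOp_off a h1 h2, letterOp_apply, hS, pointVec_apply,
        smul_ite, smul_zero, ← ite_and]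
      congr 1
      rw [hu]
      refine propext ⟨fun hy => funext fun m => ?_, fun hy => ?_⟩
      · by_cases hm : m = l
        · rw [hm, hy.1, Function.comp_apply, Function.comp_apply, hx]; rfl
        · exact hy.2 m hm
      · rw [hy]
        exact ⟨by simp [hx, src], fun m _ => rfl⟩
    · rw [if_neg hx, if_neg hx, map_zero, ite_self]
      rfl

theorem IsSpread.permOp {S : Word n i → X} {v : V} (hS : IsSpread e S (cubeVec lam nu i V v))
    (s : Equiv.Perm (Fin n)) : IsSpread e (permOp lam' nu i X s S)
      (cubeVec lam nu i V (perm lam nu s • v)) := by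
  intro x
  ext y
  rw [permOp_apply, coord_perm, permOp_apply, hS, pointVec_apply, pointVec_apply, cubeVec_perm hi,
    smul_ite, smul_zero]
  congr 1
  refine propext ⟨fun hy => ?_, fun hy => by rw [hy]; rfl⟩
  ext1 p
  simpa using congrFun hy (s.symm p)

theorem IsSpread.idemOp {S : Word n i → X} {v : V} (hS : IsSpread e S (cubeVec lam nu i V v))
    (j : Fin n → I) : IsSpread e (idemOp (k := k) i j S)
      (cubeVec lam nu i V (idem lam nu j • v)) := by
  intro x
  ext y
  rw [idemOp_apply, cubeVec_idem, apply_ite (coord e), hS, map_zero, pointVec_apply]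
  split_ifs with hx hy hy <;> simp_all [pointVec_apply]

theorem IsSpread.add {S S' : Word n i → X} {g g' : Word n i → V} (hS : IsSpread e S g)
    (hS' : IsSpread e S' g') : IsSpread e (S + S') (g + g') := by
  intro x
  ext y
  rw [Pi.add_apply, map_add, hS, hS', Pi.add_apply, pointVec_apply, pointVec_apply, Pi.add_apply,
    pointVec_apply]
  split_ifs <;> simp

theorem IsSpread.smul {S : Word n i → X} {g : Word n i → V} (hS : IsSpread e S g) (t : k) :
    IsSpread e (t • S) (t • g) := by
  intro x
  ext y
  rw [Pi.smul_apply, map_smul, hS, Pi.smul_apply, pointVec_apply, Pi.smul_apply, pointVec_apply]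
  split_ifs <;> simp

variable (e) (h' : lam = reflect i lam')

theorem exists_double (v : V) :
    ∃ f : ReflObj nu X n hi h', IsSpread e (wordFun f) (cubeVec lam nu i V v) := by
  obtain ⟨S, hS, hS'⟩ := exists_isSpread (e := e) (cubeVec_mem hi v)
  exact ⟨(⟨S, hS⟩ : reflCarrier (n := n) lam' nu i X), hS'⟩

/-- The homomorphism `V → F_i(F_i(V))`. -/
noncomputable def toDouble : V →ₗ[WAlg n lam nu] ReflObj nu X n hi h' where
  toFun v := (exists_double e h' v).choose
  map_add' v v' := by
    refine wordFun_injective (IsSpread.eq (e := e) (exists_double e h' (v + v')).choose_spec ?_)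
    rw [map_add]
    exact (exists_double e h' v).choose_spec.add (exists_double e h' v').choose_spec
  map_smul' c v := by
    -- The map is first made `k`-linear, since the reduction to generators needs linearity over `k`
    -- beforehand.
    let φ : V →ₗ[k] ReflObj nu X n hi h' :=
      { toFun := fun v => (exists_double e h' v).choose
        map_add' := fun v v' => by
          refine wordFun_injective (IsSpread.eq (e := e) (exists_double e h' (v + v')).choose_spec ?_)
          rw [map_add]
          exact (exists_double e h' v).choose_spec.add (exists_double e h' v').choose_spec
        map_smul' := fun t v => by
          refine wordFun_injective (IsSpread.eq (e := e) (exists_double e h' (t • v)).choose_spec ?_)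
          rw [map_smul]
          exact (exists_double e h' v).choose_spec.smul t }
    refine map_smul_of_generators φ (fun j v => ?_) (fun a l v => ?_) (fun s v => ?_) c v <;>
      refine wordFun_injective (IsSpread.eq (e := e) (exists_double e h' _).choose_spec ?_)
    · rw [wordFun_idem]
      exact (exists_double e h' v).choose_spec.idemOp j
    · rw [wordFun_edge]
      exact (exists_double e h' v).choose_spec.edgeOp a l
    · rw [wordFun_perm]
      exact (exists_double e h' v).choose_spec.permOp s

theorem toDouble_spec (v : V) :
    IsSpread e (wordFun (toDouble e h' v)) (cubeVec lam nu i V v) :=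
  (exists_double e h' v).choose_spec

theorem pointVec_injective (i : I) (j : Fin n → I) : Function.Injective (pointVec (V := V) i j) := by
  intro v v' hv
  have := congrFun hv (Sum.inl ∘ j)
  rwa [pointVec_apply, pointVec_apply, if_pos rfl, if_pos rfl] at this

/-- Passing from `S` to `g` is a bijection onto `doubleCarrier`, so the claim reduces to the
bijectivity of `cubeVec` onto `doubleCarrier`. -/
theorem toDouble_bijective (hu : ∀ q < n, IsUnit (swapElement q (lam i) nu)) :
    Function.Bijective (toDouble e h') := by
  constructor
  · intro v v' hv
    refine cubeVec_injective hi hu (funext fun x => pointVec_injective i (src ∘ x) ?_)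
    rw [← toDouble_spec e h' v, ← toDouble_spec e h' v', hv]
  · intro f
    obtain ⟨g, hg, hg'⟩ := exists_doubleCarrier (e := e) (wordFun_mem f)
    obtain ⟨v, rfl⟩ := exists_cubeVec hi hu hg
    exact ⟨v, wordFun_injective ((toDouble_spec e h' v).eq hg')⟩

end DoubleReflection

/-! ### Naturality of the comparison map. -/

section Naturality

variable {lam lam' : I → k} {nu : k} {i : I} {hi : IsEmpty (i ⟶ i)} {h : lam' = reflect i lam}
variable {V : Type w} [AddCommGroup V] [Module k V] [Module (WAlg n lam nu) V]
variable [IsScalarTower k (WAlg n lam nu) V]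
variable {W : Type w} [AddCommGroup W] [Module k W] [Module (WAlg n lam nu) W]
variable [IsScalarTower k (WAlg n lam nu) W]
variable {X : Type w} [AddCommGroup X] [Module k X] [Module (WAlg n lam' nu) X]
variable [IsScalarTower k (WAlg n lam' nu) X]
variable {Y : Type w} [AddCommGroup Y] [Module k Y] [Module (WAlg n lam' nu) Y]
variable [IsScalarTower k (WAlg n lam' nu) Y]

theorem cubeVec_map (g : V →ₗ[WAlg n lam nu] W) (v : V) (x : Word n i) :
    cubeVec lam nu i W (g v) x = g (cubeVec lam nu i V v x) := by
  rw [cubeVec_apply, cubeVec_apply, map_smul, map_smul]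

/-- Both sides are spread out from `cubeVec (g v)`, because the paths are elements of the algebra
and commute with `g`. The condition `hg` says that `g'` corresponds to `F_i(g)` under the two
isomorphisms. -/
theorem toDouble_naturality (e : X ≃ₗ[WAlg n lam' nu] ReflObj nu V n hi h)
    (e' : Y ≃ₗ[WAlg n lam' nu] ReflObj nu W n hi h) (h' : lam = reflect i lam')
    (g : V →ₗ[WAlg n lam nu] W) (g' : X →ₗ[WAlg n lam' nu] Y)
    (hg : ∀ ξ, coord e' (g' ξ) = wordMap g i (coord e ξ)) (v : V) :
    toDouble e' h' (g v) = reflMap g' hi h' (toDouble e h' v) := by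
  refine wordFun_injective ((toDouble_spec e' h' (g v)).eq fun x => ?_)
  change coord e' (g' (wordFun (toDouble e h' v) x)) = _
  rw [hg, toDouble_spec e h' v x]
  ext y
  rw [wordMap_apply, pointVec_apply, pointVec_apply, cubeVec_map]
  split_ifs <;> simp

end Naturality

/-! ### Natural isomorphisms between the composites and the identity. -/

section Functors

variable {i : I} {nu : k} {hi : IsEmpty (i ⟶ i)} {lam lam' : I → k} {h : lam' = reflect i lam}

/-- The isomorphism `V ≅ F_i(X)` that belongs to an isomorphism `X ≅ F_i(V)`. -/
noncomputable def doubleIso (h' : lam = reflect i lam')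
    (hu : ∀ q < n, IsUnit (swapElement q (lam i) nu)) (V : ModuleCat.{w} (WAlg n lam nu))
    (X : ModuleCat.{w} (WAlg n lam' nu)) (e : X ≅ (reflectionFunctor.{u, w} n nu hi h).obj V) :
    V ≅ (reflectionFunctor.{u, w} n nu hi h').obj X :=
  letI := scalarModule V
  haveI := scalarModule_tower V
  letI := scalarModule X
  haveI := scalarModule_tower X
  (LinearEquiv.ofBijective (toDouble (hi := hi) (h := h) e.toLinearEquiv h')
    (toDouble_bijective _ h' hu)).toModuleIso

theorem doubleIso_naturality (h' : lam = reflect i lam')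
    (hu : ∀ q < n, IsUnit (swapElement q (lam i) nu)) {V W : ModuleCat.{w} (WAlg n lam nu)}
    {X Y : ModuleCat.{w} (WAlg n lam' nu)} (e : X ≅ (reflectionFunctor.{u, w} n nu hi h).obj V)
    (e' : Y ≅ (reflectionFunctor.{u, w} n nu hi h).obj W) (g : V ⟶ W) (g' : X ⟶ Y)
    (hg : g' ≫ e'.hom = e.hom ≫ (reflectionFunctor.{u, w} n nu hi h).map g) :
    g ≫ (doubleIso h' hu W Y e').hom =
      (doubleIso h' hu V X e).hom ≫ (reflectionFunctor.{u, w} n nu hi h').map g' := by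
  let _ := scalarModule V
  have _ := scalarModule_tower V
  let _ := scalarModule W
  have _ := scalarModule_tower W
  let _ := scalarModule X
  have _ := scalarModule_tower X
  let _ := scalarModule Y
  have _ := scalarModule_tower Y
  refine ModuleCat.hom_ext (LinearMap.ext fun v => ?_)
  refine toDouble_naturality (hi := hi) (h := h) e.toLinearEquiv e'.toLinearEquiv h' g.hom g'.hom
    (fun ξ => ?_) v
  exact congrArg (wordFun (hi := hi) (h := h)) (congrArg (fun f => f.hom ξ) hg)

/-- The composite of the two reflection functors is isomorphic to the identity. -/
noncomputable def reflectionFunctorCompIso (nu : k) (hi : IsEmpty (i ⟶ i))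
    (h : lam' = reflect i lam) (h' : lam = reflect i lam')
    (hu : ∀ q < n, IsUnit (swapElement q (lam i) nu)) :
    𝟭 (ModuleCat.{w} (WAlg n lam nu)) ≅
      reflectionFunctor.{u, w} n nu hi h ⋙ reflectionFunctor.{u, w} n nu hi h' :=
  NatIso.ofComponents
    -- Here `X` is `F_i(V)` itself with the identity as isomorphism. The generality in `X` is used
    -- only to give `F_i(V)` the scalar structure induced by the algebra.
    (fun V => doubleIso h' hu V ((reflectionFunctor.{u, w} n nu hi h).obj V) (Iso.refl _))
    fun g => doubleIso_naturality h' hu (Iso.refl _) (Iso.refl _) g _ (by simp)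

end Functors

/-- Since `(r_iλ)_i = -λᵢ`, this turns the invertibility of `λᵢ - ν ∑ s_{1m}` into the condition
with the plus sign for `r_iλ`. -/
theorem swapElement_neg (q : ℕ) (a c : k) : swapElement q (-a) c = -swapElement q a (-c) := by
  rw [swapElement, swapElement, map_neg, neg_smul]
  abel

end WreathReflection

theorem theorem5p1 {k : Type u} [CommRing k] {I : Type} [Quiver.{0} I] [Fintype I]
    [DecidableEq I] [Fintype (Quiver.Total I)] [DecidableEq (Quiver.Total I)] (n : ℕ) (hn : 0 < n)
    (i : I) (hi : IsEmpty (i ⟶ i)) (lam : I → k) (nu : k)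
    (h : (lam, nu) ∈ WreathReflection.genericSet k n i) :
    (WreathReflection.reflectionFunctor.{u, w} (lam := lam)
        (lam' := WreathReflection.reflect i lam) n nu hi rfl).IsEquivalence ∧
    Nonempty (WreathReflection.reflectionFunctor.{u, w} (lam := lam)
          (lam' := WreathReflection.reflect i lam) n nu hi rfl ⋙
        WreathReflection.reflectionFunctor.{u, w} (lam := WreathReflection.reflect i lam)
          (lam' := lam) n nu hi (WreathReflection.reflect_reflect hi lam).symm ≅
      𝟭 (ModuleCat.{w} (WreathReflection.WAlg n lam nu))) ∧
    Nonempty (WreathReflection.reflectionFunctor.{u, w} (lam := WreathReflection.reflect i lam)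
          (lam' := lam) n nu hi (WreathReflection.reflect_reflect hi lam).symm ⋙
        WreathReflection.reflectionFunctor.{u, w} (lam := lam)
          (lam' := WreathReflection.reflect i lam) n nu hi rfl ≅
      𝟭 (ModuleCat.{w} (WreathReflection.WAlg n (WreathReflection.reflect i lam) nu))) := by
  -- The first half of the genericity condition serves the composite on modules for `λ`. The second
  -- half, up to sign, serves the composite that starts from `r_iλ`.
  have h2 : ∀ q < n, IsUnit (WreathReflection.swapElement q (WreathReflection.reflect i lam i) nu) := by
    intro q hq
    rw [WreathReflection.reflect_self hi, WreathReflection.swapElement_neg]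
    exact (h q hq).2.neg
  have e1 := WreathReflection.reflectionFunctorCompIso.{u, w} nu hi (lam := lam) rfl
    (WreathReflection.reflect_reflect hi lam).symm fun q hq => (h q hq).1
  have e2 := WreathReflection.reflectionFunctorCompIso.{u, w} nu hi
    (WreathReflection.reflect_reflect hi lam).symm rfl h2
  exact ⟨(CategoryTheory.Equivalence.mk _ _ e1 e2.symm).isEquivalence_functor, ⟨e1.symm⟩, ⟨e2.symm⟩⟩
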